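/- A 2-tree is a simple graph $G$ such that $G=K_3$, or $G$ has a vertex $v$ of degree $2$ whose two neighbours are adjacent and $G-v$ is a 2-tree. A non-increasing sequence $\pi=(d_1,\dots,d_n)$ of nonnegative integers is graphic if it is the degree sequence of a simple graph on $n$ vertices; such a graph is called a realization of $\pi$. Write $\sigma(\pi)=d_1+\cdots+d_n$, and let $N(3)=6$, $N(4)=7$, $N(5)=24$, $N(7)=93$. **Theorem 1.4.** Let $k\in\{3,4,5,7\}$ and $n\ge N(k)$. 1. If $\pi=(d_1,\dots,d_n)$ is a graphic sequence with $\sigma(\pi)>(k-1)(n-1)$, then $\pi$ has a realization that contains every 2-tree on $k$ vertices as a subgraph. 2. The lower bound $(k-1)(n-1)$ is best possible. Namely, unless $k=4$ and $n$ is even, the sequence $\pi=(n-1,(k-2)^{n-1})$, consisting of one term $n-1$ and $n-1$ terms $k-2$, is graphic, satisfies $\sigma(\pi)=(k-1)(n-1)$, and has no realization containing every 2-tree on $k$ vertices. If $k=4$ and $n$ is even (so that $(k-1)(n-1)$ is odd and is not the sum of a graphic sequence), there is a graphic sequence $\pi$ of length $n$ with $\sigma(\pi)=(k-1)(n-1)-1$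 that has no realization containing every 2-tree on $k$ vertices. -/

import Mathlib

/-- A simple graph `G` is a 2-tree if it is `K₃` (up to isomorphism), or if it has a vertex `v` of
degree 2 whose neighbours are adjacent such that `G - v` is a 2-tree. -/
inductive IsTwoTree : ∀ {V : Type}, SimpleGraph V → Prop
  | triangle {V : Type} (G : SimpleGraph V)
      (hG : Nonempty (G ≃g (⊤ : SimpleGraph (Fin 3)))) : IsTwoTree G
  | ear {V : Type} (G : SimpleGraph V) (v : V)
      (hdeg : (G.neighborSet v).ncard = 2)
      (hadj : G.IsClique (G.neighborSet v))
      (hrec : IsTwoTree (G.induce {v}ᶜ)) : IsTwoTree G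

open Classical in
/-- `G` is a realization of the sequence `π = (d₁, …, dₙ)`: it is a simple graph on `n` vertices
whose `i`-th vertex has degree `dᵢ`. (Every graph on `n` vertices with degree sequence `π` is
isomorphic to one labelled in this way.) -/
def IsRealization {n : ℕ} (π : Fin n → ℕ) (G : SimpleGraph (Fin n)) : Prop :=
  ∀ i, G.degree i = π i

/-- `π` is a graphic sequence: non-increasing, and the degree sequence of a simple graph. -/
def IsGraphicSeq {n : ℕ} (π : Fin n → ℕ) : Prop :=
  Antitone π ∧ ∃ G : SimpleGraph (Fin n), IsRealization π G

/-- `G` contains every 2-tree on `k` vertices as a (not necessarily induced) subgraph. -/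
def ContainsEveryTwoTree {V : Type} (k : ℕ) (G : SimpleGraph V) : Prop :=
  ∀ T : SimpleGraph (Fin k), IsTwoTree T → T.IsContained G

/-- `π` has a realization containing every 2-tree on `k` vertices. -/
def HasTwoTreeRealization {n : ℕ} (k : ℕ) (π : Fin n → ℕ) : Prop :=
  ∃ G : SimpleGraph (Fin n), IsRealization π G ∧ ContainsEveryTwoTree k G

/-- The sequence `(n - 1, k - 2, …, k - 2)` of length `n` (used for `n ≥ 1` and `k ≥ 2`). -/
def starSeq (n k : ℕ) : Fin n → ℕ :=
  fun i => if i.val = 0 then n - 1 else k - 2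

/-! Start from any realization and let A be the k vertices of largest degree. The sufficiency half
reduces to reaching one of a few target graphs by degree-preserving exchanges. For k = 3 the target
is a triangle. For k ≥ 4, deleting a vertex of degree two shows that a 2-tree on k vertices embeds
in a clique on k - 1 vertices with one further vertex adjacent to two of its members
(`IsTwoTree.isContained_of_hasEaredClique`). For k = 7 there is a second target: a triangle joined
to four vertices that span two edges. It suffices because every 2-tree on seven vertices has four
vertices inducing a subgraph of two disjoint edges, and also four inducing a subgraph of a two-edge
path plus an isolated vertex (`IsTwoTree.isContained_of_hasTwoEdgeJoin`), a finite check over all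
ways of building the 2-tree.

The vertices of largest degree are joined to A one after the other, and for k = 3, 5, 7 an exchange
then seeks edges among the remaining vertices of A. Suppose P is already joined to A and an edge rb
inside A cannot be created while the edges gained so far are kept (`StuckConfig`). Let x be a
neighbour of r outside A. Since no two-edge exchange works, every neighbour y of b outside P equals
x or is adjacent to x. Since no three-edge exchange works, every unprotected edge uv has u in N[x]
or v in N[y]. As deg x ≤ deg b, and r is adjacent to x but not to b, the vertex x misses some i in P
(`StuckConfig.missed_nonempty`). The neighbours of i outside A must then crowd around the vertices
y, so, in the absence of a target, deg i is bounded by a constant. Because P consists of the largest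
degrees, all degrees outside P are bounded too. If x misses t ≥ 1 members of P, all but boundedly
many edges are covered by |P| - t vertices of P and boundedly many vertices of bounded degree. This
leaves at most (|P| - t)(n - 1) + O(1) edges, fewer than assumed. `StuckConfig.summary` collects
these estimates, split according to whether the free neighbours of b form a clique. When k = 7 and
the third largest degree is at most 5, the same exchanges are used directly
(`exists_hasEaredClique_six`).

For sharpness, the 2-tree in which two adjacent vertices are joined to all others has two vertices
of degree k - 1, while the extremal sequences have only one term that large
(`not_hasTwoTreeRealization`). They are realized by cones over (k - 3)-regular graphs or, for k = 4
and n even, over a matching that leaves out one vertex. -/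

set_option linter.unusedSectionVars false

/-! ### Degree-preserving exchanges of edges -/

section Switching

open scoped Classical

variable {V : Type*} [Fintype V] [DecidableEq V]

/-- Two graphs on the same vertex set have the same degrees. -/
def SameDegrees (G G' : SimpleGraph V) : Prop := ∀ w, G'.degree w = G.degree w

theorem SameDegrees.refl (G : SimpleGraph V) : SameDegrees G G := fun _ => rfl

theorem SameDegrees.trans {G G' G'' : SimpleGraph V} (h : SameDegrees G G')
    (h' : SameDegrees G' G'') : SameDegrees G G'' := fun w => (h' w).trans (h w)

/-- Replacing a set `R` of edges by a set `N` of non-edges that meets every vertex equally often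
preserves all degrees. -/
theorem exists_exchange (G : SimpleGraph V) (R N : Finset (Sym2 V))
    (hR : ∀ e ∈ R, e ∈ G.edgeSet) (hN : ∀ e ∈ N, e ∉ G.edgeSet) (hd : ∀ e ∈ N, ¬ e.IsDiag)
    (hb : ∀ v, (R.filter (v ∈ ·)).card = (N.filter (v ∈ ·)).card) :
    ∃ G' : SimpleGraph V, SameDegrees G G' ∧ (∀ e ∈ N, e ∈ G'.edgeSet) ∧
      ∀ e ∈ G.edgeSet, e ∉ R → e ∈ G'.edgeSet := by
  have hes : (SimpleGraph.fromEdgeSet ((G.edgeSet \ (R : Set (Sym2 V))) ∪ N)).edgeSet =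
      (G.edgeSet \ (R : Set (Sym2 V))) ∪ N := by
    rw [SimpleGraph.edgeSet_fromEdgeSet]
    ext e
    simp only [Set.mem_sdiff, Set.mem_union, Finset.mem_coe]
    constructor
    · exact fun h => h.1
    · rintro (⟨h, h'⟩ | h)
      · exact ⟨Or.inl ⟨h, h'⟩, G.not_isDiag_of_mem_edgeSet h⟩
      · exact ⟨Or.inr h, hd e h⟩
  refine ⟨SimpleGraph.fromEdgeSet ((G.edgeSet \ (R : Set (Sym2 V))) ∪ N), ?_, ?_, ?_⟩
  · intro w
    rw [← SimpleGraph.card_incidenceFinset_eq_degree, ← SimpleGraph.card_incidenceFinset_eq_degree,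
      SimpleGraph.incidenceFinset_eq_filter, SimpleGraph.incidenceFinset_eq_filter]
    have h1 : (SimpleGraph.fromEdgeSet ((G.edgeSet \ (R : Set (Sym2 V))) ∪ N)).edgeFinset =
        (G.edgeFinset \ R) ∪ N := by
      ext e
      rw [SimpleGraph.mem_edgeFinset, hes]
      simp
    rw [h1, Finset.filter_union, Finset.card_union_of_disjoint]
    · rw [← hb w, ← Finset.card_union_of_disjoint]
      · congr 1
        ext e
        simp only [Finset.mem_union, Finset.mem_filter, Finset.mem_sdiff,
          SimpleGraph.mem_edgeFinset]
        constructor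
        · rintro (⟨⟨h, -⟩, h'⟩ | ⟨h, h'⟩)
          · exact ⟨h, h'⟩
          · exact ⟨hR e h, h'⟩
        · rintro ⟨h, h'⟩
          by_cases he : e ∈ R
          · exact Or.inr ⟨he, h'⟩
          · exact Or.inl ⟨⟨h, he⟩, h'⟩
      · rw [Finset.disjoint_left]
        intro e h h'
        simp only [Finset.mem_filter, Finset.mem_sdiff] at h h'
        exact h.1.2 h'.1
    · rw [Finset.disjoint_left]
      intro e h h'
      simp only [Finset.mem_filter, Finset.mem_sdiff, SimpleGraph.mem_edgeFinset] at h h'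
      exact hN e h'.1 h.1.1
  · intro e he
    rw [hes]
    exact Or.inr he
  · intro e he h
    rw [hes]
    exact Or.inl ⟨he, h⟩

/-- Turns the balance condition of `exists_exchange` into an identity between vertex indicators that
`ring` can check. -/
theorem mem_sym2_indicator {a b : V} (h : a ≠ b) (w : V) :
    (if w ∈ s(a, b) then 1 else 0 : ℕ) = (if w = a then 1 else 0) + (if w = b then 1 else 0) := by
  by_cases h1 : w = a
  · subst h1
    simp [h]
  · by_cases h2 : w = b
    · subst h2
      simp [h1]
    · simp [h1, h2]

theorem exists_two_switch {G : SimpleGraph V} {a b x y : V} (hax : G.Adj a x) (hby : G.Adj b y)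
    (hab : a ≠ b) (hnab : ¬ G.Adj a b) (hxy : x ≠ y) (hnxy : ¬ G.Adj x y) :
    ∃ G' : SimpleGraph V, SameDegrees G G' ∧ G'.Adj a b ∧ ∀ p q, G.Adj p q →
      s(p, q) ≠ s(a, x) → s(p, q) ≠ s(b, y) → G'.Adj p q := by
  have hay : a ≠ y := by rintro rfl; exact hnab hby.symm
  have hbx : b ≠ x := by rintro rfl; exact hnab hax
  have hR : s(a, x) ≠ s(b, y) := by
    simp only [ne_eq, Sym2.eq_iff]; tauto
  have hN : s(a, b) ≠ s(x, y) := by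
    have := hax.ne
    simp only [ne_eq, Sym2.eq_iff]; tauto
  obtain ⟨G', h1, h2, h3⟩ := exists_exchange G {s(a, x), s(b, y)} {s(a, b), s(x, y)}
    (by simp [hax, hby]) (by simp [hnab, hnxy]) (by simp [hab, hxy]) (by
      intro w
      simp only [Finset.card_filter]
      rw [Finset.sum_pair hR, Finset.sum_pair hN, mem_sym2_indicator hax.ne,
        mem_sym2_indicator hby.ne, mem_sym2_indicator hab, mem_sym2_indicator hxy]
      ring)
  refine ⟨G', h1, h2 s(a, b) (by simp), fun p q hpq e1 e2 => h3 s(p, q) hpq ?_⟩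
  simp [e1, e2]

/-- Exchanges along the closed alternating walk a, x, u, v, y, b: the edges ax, uv, yb leave and the
non-edges xu, vy, ba enter. Coincidences such as x = y are allowed; the adjacency hypotheses alone
keep the three edges on each side distinct. -/
theorem exists_three_switch {G : SimpleGraph V} {a b x y u v : V} (hax : G.Adj a x)
    (hby : G.Adj b y) (huv : G.Adj u v) (hab : a ≠ b) (hnab : ¬ G.Adj a b) (hxu : u ≠ x)
    (hnxu : ¬ G.Adj x u) (hyv : v ≠ y) (hnyv : ¬ G.Adj y v) :
    ∃ G' : SimpleGraph V, SameDegrees G G' ∧ G'.Adj a b ∧ ∀ p q, G.Adj p q →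
      s(p, q) ≠ s(a, x) → s(p, q) ≠ s(b, y) → s(p, q) ≠ s(u, v) → G'.Adj p q := by
  have hay : a ≠ y := by rintro rfl; exact hnab hby.symm
  have hbx : b ≠ x := by rintro rfl; exact hnab hax
  have hau : a ≠ u := by rintro rfl; exact hnxu hax.symm
  have hbv : b ≠ v := by rintro rfl; exact hnyv hby.symm
  have hax' := hax.ne
  have hby' := hby.ne
  have huv' := huv.ne
  have hxvuy : ¬ (x = v ∧ u = y) := by
    rintro ⟨rfl, rfl⟩
    exact hnxu huv.symm
  have hR1 : s(a, x) ≠ s(b, y) := by simp only [ne_eq, Sym2.eq_iff]; tauto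
  have hR2 : s(a, x) ≠ s(u, v) := by
    simp only [ne_eq, Sym2.eq_iff]
    rintro (⟨h, -⟩ | ⟨-, h⟩)
    · exact hau h
    · exact hxu h.symm
  have hR3 : s(b, y) ≠ s(u, v) := by
    simp only [ne_eq, Sym2.eq_iff]
    rintro (⟨-, h⟩ | ⟨h, -⟩)
    · exact hyv h.symm
    · exact hbv h
  have hN1 : s(a, b) ≠ s(x, u) := by simp only [ne_eq, Sym2.eq_iff]; tauto
  have hN2 : s(a, b) ≠ s(y, v) := by simp only [ne_eq, Sym2.eq_iff]; tauto
  have hN3 : s(x, u) ≠ s(y, v) := by simp only [ne_eq, Sym2.eq_iff]; tauto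
  obtain ⟨G', h1, h2, h3⟩ := exists_exchange G {s(a, x), s(b, y), s(u, v)}
    {s(a, b), s(x, u), s(y, v)}
    (by simp [hax, hby, huv]) (by simp [hnab, hnxu, hnyv])
    (by simp [hab, hxu.symm, hyv.symm]) (by
      intro w
      simp only [Finset.card_filter]
      rw [Finset.sum_insert (by simp [hR1, hR2]), Finset.sum_pair hR3,
        Finset.sum_insert (by simp [hN1, hN2]), Finset.sum_pair hN3, mem_sym2_indicator hax.ne,
        mem_sym2_indicator hby.ne, mem_sym2_indicator huv.ne, mem_sym2_indicator hab,
        mem_sym2_indicator hxu.symm, mem_sym2_indicator hyv.symm]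
      ring)
  refine ⟨G', h1, h2 s(a, b) (by simp), fun p q hpq e1 e2 e3 => h3 s(p, q) hpq ?_⟩
  simp [e1, e2, e3]

/-- No graph with the degrees of `G` that keeps the edges of `G` in `K` contains the edge `rb`. -/
def Stuck (G : SimpleGraph V) (K : Set (Sym2 V)) (r b : V) : Prop :=
  ∀ G' : SimpleGraph V, SameDegrees G G' →
    (∀ p q, G.Adj p q → s(p, q) ∈ K → G'.Adj p q) → ¬ G'.Adj r b

theorem Stuck.not_adj {G : SimpleGraph V} {K : Set (Sym2 V)} {r b : V} (h : Stuck G K r b) :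
    ¬ G.Adj r b := h G (SameDegrees.refl G) fun _ _ h _ => h

theorem Stuck.eq_or_adj {G : SimpleGraph V} {K : Set (Sym2 V)} {r b x y : V} (h : Stuck G K r b)
    (hrb : r ≠ b) (hx : G.Adj r x) (hxK : s(r, x) ∉ K) (hy : G.Adj b y) (hyK : s(b, y) ∉ K) :
    x = y ∨ G.Adj x y := by
  by_contra! hc
  obtain ⟨G', h1, h2, h3⟩ := exists_two_switch hx hy hrb h.not_adj hc.1 hc.2
  refine h G' h1 (fun p q hpq hK => h3 p q hpq ?_ ?_) h2
  · intro he; exact hxK (he ▸ hK)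
  · intro he; exact hyK (he ▸ hK)

/-- Otherwise a three-edge exchange would create rb. The conclusion is not symmetric in u and v, so
applying it to both orientations of an edge yields more than one application. -/
theorem Stuck.edge_near {G : SimpleGraph V} {K : Set (Sym2 V)} {r b x y u v : V}
    (h : Stuck G K r b) (hrb : r ≠ b) (hx : G.Adj r x) (hxK : s(r, x) ∉ K) (hy : G.Adj b y)
    (hyK : s(b, y) ∉ K) (huv : G.Adj u v) (huvK : s(u, v) ∉ K) :
    (u = x ∨ G.Adj x u) ∨ (v = y ∨ G.Adj y v) := by
  by_contra! hc
  obtain ⟨G', h1, h2, h3⟩ := exists_three_switch hx hy huv hrb h.not_adj hc.1.1 hc.1.2 hc.2.1 hc.2.2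
  refine h G' h1 (fun p q hpq hK => h3 p q hpq ?_ ?_ ?_) h2
  · intro he; exact hxK (he ▸ hK)
  · intro he; exact hyK (he ▸ hK)
  · intro he; exact huvK (he ▸ hK)

/-- Edges are counted by the degrees of a set of vertices and the edges avoiding it. -/
theorem card_edges_le_of_cover (G : SimpleGraph V) (S : Finset V) (Q : Finset (Sym2 V))
    (h : ∀ u v, G.Adj u v → u ∈ S ∨ v ∈ S ∨ s(u, v) ∈ Q) :
    G.edgeFinset.card ≤ ∑ v ∈ S, G.degree v + Q.card := by
  have hsub : G.edgeFinset ⊆ S.biUnion (fun v => G.incidenceFinset v) ∪ Q := by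
    intro e
    induction e using Sym2.ind with
    | _ u v =>
      intro he
      rw [SimpleGraph.mem_edgeFinset, SimpleGraph.mem_edgeSet] at he
      simp only [Finset.mem_union, Finset.mem_biUnion, SimpleGraph.mem_incidenceFinset]
      rcases h u v he with h | h | h
      · exact Or.inl ⟨u, h, (SimpleGraph.mk'_mem_incidenceSet_iff G).2 ⟨he, Or.inl rfl⟩⟩
      · exact Or.inl ⟨v, h, (SimpleGraph.mk'_mem_incidenceSet_iff G).2 ⟨he, Or.inr rfl⟩⟩
      · exact Or.inr h
  calc G.edgeFinset.card ≤ _ := Finset.card_le_card hsub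
    _ ≤ _ := Finset.card_union_le _ _
    _ ≤ _ := by
      gcongr
      refine Finset.card_biUnion_le.trans (le_of_eq ?_)
      exact Finset.sum_congr rfl fun v _ => G.card_incidenceFinset_eq_degree v

/-- A maximal choice among the graphs with a given property. -/
theorem exists_max_graph (p : SimpleGraph V → Prop) (m : SimpleGraph V → ℕ) (h : ∃ G, p G) :
    ∃ G, p G ∧ ∀ G', p G' → m G' ≤ m G := by
  obtain ⟨G, hG, hmax⟩ := Set.exists_max_image {G | p G} m (Set.toFinite _) h
  exact ⟨G, hG, hmax⟩

end Switching

/-! ### Local structure around an edge that cannot be created -/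

section StuckConfigurations

open scoped Classical

variable {V : Type*} [Fintype V] [DecidableEq V]

/-- The set `P` is joined to `A ⊇ P`, the edges in `K` lie inside `A` and are protected, and the
edge `rb` inside `A \ P` cannot be created by any exchange that keeps the protected edges. The
protected edges away from `P` and `r` are listed in `F`. -/
structure StuckConfig (G : SimpleGraph V) (A P : Finset V) (K : Set (Sym2 V))
    (F : Finset (Sym2 V)) (r b : V) : Prop where
  subset : P ⊆ A
  r_mem : r ∈ A
  b_mem : b ∈ A
  r_not : r ∉ P
  b_not : b ∉ P
  ne : r ≠ b
  join : ∀ p ∈ P, ∀ a ∈ A, p ≠ a → G.Adj p a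
  keep : ∀ p ∈ P, ∀ a ∈ A, s(p, a) ∈ K
  inside : ∀ u v, s(u, v) ∈ K → u ∈ A
  free_b : ∀ y, G.Adj b y → y ∉ P → s(b, y) ∉ K
  free_nbr : ∀ y u, G.Adj b y → y ∉ P → s(u, y) ∈ K → u ∈ P ∨ u = r
  listed : ∀ u v, G.Adj u v → s(u, v) ∈ K → u ∈ P ∨ v ∈ P ∨ u = r ∨ v = r ∨ s(u, v) ∈ F
  top : ∀ v ∉ A, G.degree v ≤ G.degree b
  top_P : ∀ p ∈ P, ∀ v ∉ P, G.degree v ≤ G.degree p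
  stuck : Stuck G K r b

namespace StuckConfig

variable {G : SimpleGraph V} {A P : Finset V} {K : Set (Sym2 V)} {F : Finset (Sym2 V)} {r b x : V}

/-- The neighbours of `b` outside `P`. -/
noncomputable def freeNbrs (G : SimpleGraph V) (P : Finset V) (b : V) : Finset V := G.neighborFinset b \ P

/-- The members of `P` that are not adjacent to `x`. -/
noncomputable def missed (G : SimpleGraph V) (P : Finset V) (x : V) : Finset V := P.filter fun p => ¬ G.Adj p x

/-- The neighbours of `x` outside the closed neighbourhood of `b`. -/
noncomputable def extra (G : SimpleGraph V) (b x : V) : Finset V :=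
  G.neighborFinset x \ insert b (G.neighborFinset b)

theorem mem_freeNbrs {y : V} : y ∈ freeNbrs G P b ↔ G.Adj b y ∧ y ∉ P := by
  simp [freeNbrs]

theorem mem_missed {i : V} : i ∈ missed G P x ↔ i ∈ P ∧ ¬ G.Adj i x := by
  simp [missed]

theorem mem_extra {v : V} : v ∈ extra G b x ↔ G.Adj x v ∧ v ≠ b ∧ ¬ G.Adj b v := by
  simp [extra]

theorem inside' (h : StuckConfig G A P K F r b) {u v : V} (huv : s(u, v) ∈ K) : v ∈ A :=
  h.inside v u (by rwa [Sym2.eq_swap])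

theorem near (h : StuckConfig G A P K F r b) (hx : G.Adj r x) (hxA : x ∉ A) {y : V}
    (hy : y ∈ freeNbrs G P b) : x = y ∨ G.Adj x y := by
  rw [mem_freeNbrs] at hy
  exact h.stuck.eq_or_adj h.ne hx (fun hK => hxA (h.inside' hK)) hy.1 (h.free_b y hy.1 hy.2)

theorem edge_near (h : StuckConfig G A P K F r b) (hx : G.Adj r x) (hxA : x ∉ A) {y : V}
    (hy : y ∈ freeNbrs G P b) {u v : V} (huv : G.Adj u v) (hK : s(u, v) ∉ K) :
    (u = x ∨ G.Adj x u) ∨ (v = y ∨ G.Adj y v) := by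
  rw [mem_freeNbrs] at hy
  exact h.stuck.edge_near h.ne hx (fun hK => hxA (h.inside' hK)) hy.1 (h.free_b y hy.1 hy.2) huv hK

theorem subset_nbrs (h : StuckConfig G A P K F r b) : P ⊆ G.neighborFinset b := by
  intro p hp
  rw [SimpleGraph.mem_neighborFinset]
  exact (h.join p hp b h.b_mem (fun e => h.b_not (e ▸ hp))).symm

theorem card_freeNbrs (h : StuckConfig G A P K F r b) :
    (freeNbrs G P b).card + P.card = G.degree b := by
  rw [freeNbrs, Finset.card_sdiff_add_card_eq_card h.subset_nbrs, SimpleGraph.card_neighborFinset_eq_degree]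

/-- Since deg x ≤ deg b, the part of N(x) outside N[b] is no larger than the part of N(b) outside
N[x]. Free neighbours of b are never in the latter, so only members of P missed by x remain there.
-/
theorem card_extra_le (h : StuckConfig G A P K F r b) (hx : G.Adj r x) (hxA : x ∉ A) :
    (extra G b x).card ≤ (missed G P x).card := by
  have hd : G.degree x ≤ G.degree b := h.top x hxA
  have hxb : x ≠ b := fun e => hxA (e ▸ h.b_mem)
  have hsub : G.neighborFinset b \ insert x (G.neighborFinset x) ⊆ missed G P x := by
    intro y hy
    simp only [Finset.mem_sdiff, SimpleGraph.mem_neighborFinset, Finset.mem_insert, not_or] at hy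
    rw [mem_missed]
    refine ⟨?_, fun e => hy.2.2 e.symm⟩
    by_contra hyP
    rcases h.near hx hxA (mem_freeNbrs.2 ⟨hy.1, hyP⟩) with e | e
    · exact hy.2.1 e.symm
    · exact hy.2.2 e
  refine le_trans ?_ (Finset.card_le_card hsub)
  rw [extra]
  have e1 := Finset.card_inter_add_card_sdiff (G.neighborFinset x) (insert b (G.neighborFinset b))
  have e2 := Finset.card_inter_add_card_sdiff (G.neighborFinset b) (insert x (G.neighborFinset x))
  rw [SimpleGraph.card_neighborFinset_eq_degree] at e1 e2
  -- Both intersections consist of the common neighbours, plus one vertex when x and b are adjacent.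
  have e3 : (G.neighborFinset x ∩ insert b (G.neighborFinset b)).card =
      (G.neighborFinset b ∩ insert x (G.neighborFinset x)).card := by
    by_cases hbx : G.Adj b x
    · rw [Finset.inter_insert_of_mem (by simpa using hbx.symm),
        Finset.inter_insert_of_mem (by simpa using hbx), Finset.card_insert_of_notMem (by simp),
        Finset.card_insert_of_notMem (by simp), Finset.inter_comm]
    · rw [Finset.inter_insert_of_notMem (by simpa using fun e => hbx (SimpleGraph.Adj.symm e)),
        Finset.inter_insert_of_notMem (by simpa using hbx), Finset.inter_comm]
  omega

theorem r_mem_extra (h : StuckConfig G A P K F r b) (hx : G.Adj r x) : r ∈ extra G b x :=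
  mem_extra.2 ⟨hx.symm, h.ne, fun e => h.stuck.not_adj e.symm⟩

/-- The vertex r itself lies in N(x) but not in N[b], so the set bounded in `card_extra_le` is
nonempty. -/
theorem missed_nonempty (h : StuckConfig G A P K F r b) (hx : G.Adj r x) (hxA : x ∉ A) :
    (missed G P x).Nonempty := by
  rw [← Finset.card_pos]
  exact lt_of_lt_of_le (Finset.card_pos.2 ⟨r, h.r_mem_extra hx⟩) (h.card_extra_le hx hxA)

/-- The edge iz leaves A and is therefore unprotected, and i is far from x. So `edge_near` must be
satisfied at the other end z. -/
theorem near_of_missed (h : StuckConfig G A P K F r b) (hx : G.Adj r x) (hxA : x ∉ A) {i z y : V}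
    (hi : i ∈ missed G P x) (hiz : G.Adj i z) (hz : z ∉ A) (hy : y ∈ freeNbrs G P b) :
    z = y ∨ G.Adj y z := by
  rw [mem_missed] at hi
  rcases h.edge_near hx hxA hy hiz (fun e => hz (h.inside' e)) with (e | e) | e
  · exact absurd (h.subset hi.1) (e ▸ hxA)
  · exact absurd e.symm hi.2
  · exact e

/-- If u and v were both far from x, both would be near y'. Applying `edge_near` with y to an edge
from u or v to y' is impossible because y and y' are not adjacent, so these edges are protected.
This puts u and v into P, and then uv is protected as well. -/
theorem no_far_edge (h : StuckConfig G A P K F r b) (hx : G.Adj r x) (hxA : x ∉ A) {y y' : V}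
    (hy : y ∈ freeNbrs G P b) (hy' : y' ∈ freeNbrs G P b) (hne : y ≠ y') (hn : ¬ G.Adj y y')
    {u v : V} (huv : G.Adj u v) (hK : s(u, v) ∉ K) :
    (u = x ∨ G.Adj x u) ∨ (v = x ∨ G.Adj x v) := by
  by_contra! hc
  -- A protected edge at the free neighbour y' leads to P or to r, and r is excluded because it is
  -- adjacent to x.
  have key : ∀ w, w ≠ x → ¬ G.Adj x w → (w = y' ∨ G.Adj y' w) → w ∈ P := by
    intro w h1 h2 h3
    have hwy : w ≠ y' := by
      rintro rfl
      rcases h.near hx hxA hy' with e | e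
      · exact h1 e.symm
      · exact h2 e
    have h3' : G.Adj w y' := (h3.resolve_left hwy).symm
    have hKw : s(w, y') ∈ K := by
      by_contra hKw
      rcases h.edge_near hx hxA hy h3' hKw with (e | e) | (e | e)
      · exact h1 e
      · exact h2 e
      · exact hne e.symm
      · exact hn e
    obtain ⟨m1, m2⟩ := mem_freeNbrs.1 hy'
    rcases h.free_nbr y' w m1 m2 hKw with e | e
    · exact e
    · exact absurd (e ▸ hx.symm) h2
  have hv : v ∈ P := by
    refine key v hc.2.1 hc.2.2 ?_
    rcases h.edge_near hx hxA hy' huv hK with (e | e) | e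
    · exact absurd e hc.1.1
    · exact absurd e hc.1.2
    · exact e
  have hu : u ∈ P := by
    refine key u hc.1.1 hc.1.2 ?_
    rcases h.edge_near hx hxA hy' huv.symm (by rwa [Sym2.eq_swap]) with (e | e) | e
    · exact absurd e hc.2.1
    · exact absurd e hc.2.2
    · exact e
  exact hK (h.keep u hu v (h.subset hv))

/-- The vertex z is near y'. If they differ, the unprotected edge zy' is tested by `edge_near`
against x and y; since y' is not near y, z must be near x. -/
theorem adj_of_missed (h : StuckConfig G A P K F r b) (hx : G.Adj r x) (hxA : x ∉ A) {y y' : V}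
    (hy : y ∈ freeNbrs G P b) (hy' : y' ∈ freeNbrs G P b) (hne : y ≠ y') (hn : ¬ G.Adj y y')
    {i z : V} (hi : i ∈ missed G P x) (hiz : G.Adj i z) (hz : z ∉ A) : G.Adj x z := by
  have hzx : z ≠ x := by
    rintro rfl
    exact (mem_missed.1 hi).2 hiz
  rcases h.near_of_missed hx hxA hi hiz hz hy' with e | e
  · subst e
    exact (h.near hx hxA hy').resolve_left (Ne.symm hzx)
  · rcases h.edge_near hx hxA hy e.symm (fun k => hz (h.inside _ _ k)) with (k | k) | (k | k)
    · exact absurd k hzx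
    · exact k
    · exact absurd k.symm hne
    · exact absurd k hn

theorem degree_le_of_mem {i : V} (hi : i ∈ A) :
    G.degree i ≤ A.card - 1 + (G.neighborFinset i \ A).card := by
  have e1 := Finset.card_inter_add_card_sdiff (G.neighborFinset i) A
  rw [SimpleGraph.card_neighborFinset_eq_degree] at e1
  have : (G.neighborFinset i ∩ A).card ≤ (A.erase i).card := by
    apply Finset.card_le_card
    intro v hv
    simp only [Finset.mem_inter, SimpleGraph.mem_neighborFinset] at hv
    exact Finset.mem_erase.2 ⟨hv.1.ne', hv.2⟩
  rw [Finset.card_erase_of_mem hi] at this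
  omega

/-- Apart from b, every neighbour of x lies in one of the three sets summed over, and unprotected
edges at b end in free neighbours. Hence an unprotected edge meeting N[x] or b is covered, and so is
every edge at r because r is one of the extra neighbours. -/
theorem card_edges_le (h : StuckConfig G A P K F r b) (hx : G.Adj r x) (hxA : x ∉ A)
    (Q : Finset (Sym2 V))
    (hQK : ∀ u v, G.Adj u v → s(u, v) ∈ K → u ∉ P \ missed G P x → v ∉ P \ missed G P x →
      u ≠ r → v ≠ r → s(u, v) ∈ Q)
    (hQ : ∀ u v, G.Adj u v → s(u, v) ∉ K → ¬ (u = x ∨ G.Adj x u) → ¬ (v = x ∨ G.Adj x v) →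
      u ≠ b → v ≠ b → s(u, v) ∈ Q) :
    G.edgeFinset.card ≤ ∑ v ∈ P \ missed G P x, G.degree v + ∑ v ∈ freeNbrs G P b, G.degree v +
      ∑ v ∈ extra G b x, G.degree v + Q.card := by
  have hle := card_edges_le_of_cover G
    ((P \ missed G P x) ∪ freeNbrs G P b ∪ extra G b x) Q ?_
  · refine hle.trans (Nat.add_le_add_right ?_ _)
    have hadd : ∀ s t : Finset V,
        ∑ v ∈ s ∪ t, G.degree v ≤ ∑ v ∈ s, G.degree v + ∑ v ∈ t, G.degree v := by
      intro s t
      rw [← Finset.sum_union_inter]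
      exact Nat.le_add_right _ _
    exact (hadd _ _).trans (Nat.add_le_add_right (hadd _ _) _)
  · have aux1 : ∀ w, G.Adj x w → w ≠ b → w ∈ (P \ missed G P x) ∪ freeNbrs G P b ∪ extra G b x := by
      intro w hw hwb
      simp only [Finset.mem_union, Finset.mem_sdiff, mem_missed, mem_freeNbrs, mem_extra]
      have := hw.symm
      tauto
    have aux : ∀ u v, G.Adj u v → s(u, v) ∉ K → (u = x ∨ G.Adj x u ∨ u = b) →
        u ∈ (P \ missed G P x) ∪ freeNbrs G P b ∪ extra G b x ∨
        v ∈ (P \ missed G P x) ∪ freeNbrs G P b ∪ extra G b x := by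
      intro u v huv hK hu
      by_cases hub : u = b
      · subst hub
        right
        by_cases hvP : v ∈ P
        · exact absurd (h.keep v hvP u h.b_mem) (by rwa [Sym2.eq_swap])
        · exact Finset.mem_union_left _ (Finset.mem_union_right _ (mem_freeNbrs.2 ⟨huv, hvP⟩))
      · rcases hu with rfl | hu | hu
        · by_cases hvb : v = b
          · subst hvb
            left
            exact Finset.mem_union_left _ (Finset.mem_union_right _
              (mem_freeNbrs.2 ⟨huv.symm, fun e => hxA (h.subset e)⟩))
          · exact Or.inr (aux1 v huv hvb)
        · exact Or.inl (aux1 u hu hub)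
        · exact absurd hu hub
    intro u v huv
    by_cases hK : s(u, v) ∈ K
    · by_cases h1 : u = r
      · exact Or.inl (h1 ▸ Finset.mem_union_right _ (h.r_mem_extra hx))
      by_cases h2 : v = r
      · exact Or.inr (Or.inl (h2 ▸ Finset.mem_union_right _ (h.r_mem_extra hx)))
      by_cases h3 : u ∈ P \ missed G P x
      · exact Or.inl (Finset.mem_union_left _ (Finset.mem_union_left _ h3))
      by_cases h4 : v ∈ P \ missed G P x
      · exact Or.inr (Or.inl (Finset.mem_union_left _ (Finset.mem_union_left _ h4)))
      exact Or.inr (Or.inr (hQK u v huv hK h3 h4 h1 h2))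
    · by_cases hu : u = x ∨ G.Adj x u ∨ u = b
      · rcases aux u v huv hK hu with e | e
        · exact Or.inl e
        · exact Or.inr (Or.inl e)
      by_cases hv : v = x ∨ G.Adj x v ∨ v = b
      · rcases aux v u huv.symm (by rwa [Sym2.eq_swap]) hv with e | e
        · exact Or.inr (Or.inl e)
        · exact Or.inl e
      push Not at hu hv
      exact Or.inr (Or.inr (hQ u v huv hK (not_or.2 ⟨hu.1, hu.2.1⟩) (not_or.2 ⟨hv.1, hv.2.1⟩)
        hu.2.2 hv.2.2))

end StuckConfig

end StuckConfigurations

/-! ### Edge and degree bounds in a stuck configuration -/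

section StuckCounting

open scoped Classical

variable {V : Type*} [Fintype V] [DecidableEq V]

namespace StuckConfig

variable {G : SimpleGraph V} {A P : Finset V} {K : Set (Sym2 V)} {F : Finset (Sym2 V)} {r b x : V}

theorem degree_le_of_notMem (h : StuckConfig G A P K F r b) {i v : V} (hi : i ∈ missed G P x)
    (hv : v ∉ P) : G.degree v ≤ G.degree i := h.top_P i (mem_missed.1 hi).1 v hv

theorem extra_notMem (h : StuckConfig G A P K F r b) {v : V} (hv : v ∈ extra G b x) : v ∉ P := by
  intro hP
  have := h.subset_nbrs hP
  rw [SimpleGraph.mem_neighborFinset] at this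
  exact (mem_extra.1 hv).2.2 this

/-- The bound on the number of edges in terms of a set `Q` that contains all unprotected edges far
from `x`. -/
theorem card_edges_le' (h : StuckConfig G A P K F r b) (hx : G.Adj r x) (hxA : x ∉ A)
    (Q : Finset (Sym2 V))
    (hQ : ∀ u v, G.Adj u v → s(u, v) ∉ K → ¬ (u = x ∨ G.Adj x u) → ¬ (v = x ∨ G.Adj x v) →
      u ≠ b → v ≠ b → s(u, v) ∈ Q) {i : V} (hi : i ∈ missed G P x) {M : ℕ}
    (hM : ∀ y ∈ freeNbrs G P b, G.degree y ≤ M) :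
    G.edgeFinset.card ≤ (P.card - (missed G P x).card) * (Fintype.card V - 1) +
      (freeNbrs G P b).card * M + (missed G P x).card * G.degree i +
      ((missed G P x).card * (A.card - (P.card - (missed G P x).card) - 1) + F.card + Q.card) := by
  have hIP : missed G P x ⊆ P := Finset.filter_subset _ _
  -- The uncovered protected edges outside `F` run from a missed vertex to the rest of A. Vertices
  -- of P adjacent to x and the vertex r are left out because the covering set already contains
  -- them.
  set Q0 := ((missed G P x) ×ˢ ((A \ (P \ missed G P x)).erase r)).image (Function.uncurry Sym2.mk)
    with hQ0
  have hle := h.card_edges_le hx hxA (Q0 ∪ F ∪ Q) ?_ ?_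
  · have c0 : Q0.card ≤ (missed G P x).card * (A.card - (P.card - (missed G P x).card) - 1) := by
      refine Finset.card_image_le.trans ?_
      rw [Finset.card_product, Finset.card_erase_of_mem, Finset.card_sdiff_of_subset,
        Finset.card_sdiff_of_subset hIP]
      · exact Finset.sdiff_subset.trans h.subset
      · exact Finset.mem_sdiff.2 ⟨h.r_mem, fun e => h.r_not (Finset.mem_sdiff.1 e).1⟩
    have c1 : (Q0 ∪ F ∪ Q).card ≤ Q0.card + F.card + Q.card :=
      (Finset.card_union_le _ _).trans (Nat.add_le_add_right (Finset.card_union_le _ _) _)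
    have c2 : ∑ v ∈ P \ missed G P x, G.degree v ≤
        (P.card - (missed G P x).card) * (Fintype.card V - 1) := by
      rw [← Finset.card_sdiff_of_subset hIP, ← smul_eq_mul]
      exact Finset.sum_le_card_nsmul _ _ _ fun v _ => Nat.le_sub_one_of_lt (G.degree_lt_card_verts v)
    have c3 : ∑ v ∈ freeNbrs G P b, G.degree v ≤ (freeNbrs G P b).card * M := by
      rw [← smul_eq_mul]
      exact Finset.sum_le_card_nsmul _ _ _ hM
    have c4 : ∑ v ∈ extra G b x, G.degree v ≤ (missed G P x).card * G.degree i := by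
      refine le_trans ?_ (Nat.mul_le_mul_right _ (h.card_extra_le hx hxA))
      rw [← smul_eq_mul]
      exact Finset.sum_le_card_nsmul _ _ _ fun v hv => h.degree_le_of_notMem hi (h.extra_notMem hv)
    omega
  · intro u v huv hK hu hv hur hvr
    rw [Finset.mem_union, Finset.mem_union]
    left
    rcases h.listed u v huv hK with e | e | e | e | e
    · left
      have : u ∈ missed G P x := by
        by_contra hc
        exact hu (Finset.mem_sdiff.2 ⟨e, hc⟩)
      exact Finset.mem_image.2 ⟨(u, v), Finset.mem_product.2 ⟨this, Finset.mem_erase.2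
        ⟨hvr, Finset.mem_sdiff.2 ⟨h.inside' hK, hv⟩⟩⟩, rfl⟩
    · left
      have : v ∈ missed G P x := by
        by_contra hc
        exact hv (Finset.mem_sdiff.2 ⟨e, hc⟩)
      exact Finset.mem_image.2 ⟨(v, u), Finset.mem_product.2 ⟨this, Finset.mem_erase.2
        ⟨hur, Finset.mem_sdiff.2 ⟨h.inside _ _ hK, hu⟩⟩⟩, Sym2.eq_swap⟩
    · exact absurd e hur
    · exact absurd e hvr
    · exact Or.inr e
  · intro u v h1 h2 h3 h4 h5 h6
    exact Finset.mem_union_right _ (hQ u v h1 h2 h3 h4 h5 h6)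

/-- Two nonadjacent free neighbours rule out unprotected edges far from x, so no additional set of
edges is needed. -/
theorem card_edges_of_not_clique (h : StuckConfig G A P K F r b) (hx : G.Adj r x) (hxA : x ∉ A)
    {y y' : V} (hy : y ∈ freeNbrs G P b) (hy' : y' ∈ freeNbrs G P b) (hne : y ≠ y')
    (hn : ¬ G.Adj y y') {i : V} (hi : i ∈ missed G P x) :
    G.edgeFinset.card ≤ (P.card - (missed G P x).card) * (Fintype.card V - 1) +
      (freeNbrs G P b).card * G.degree i + (missed G P x).card * G.degree i +
      ((missed G P x).card * (A.card - (P.card - (missed G P x).card) - 1) + F.card) := by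
  refine h.card_edges_le' hx hxA ∅ ?_ hi
    (fun z hz => h.degree_le_of_notMem hi (mem_freeNbrs.1 hz).2)
  intro u v huv hK hu hv
  rcases h.no_far_edge hx hxA hy hy' hne hn huv hK with e | e
  · exact absurd e hu
  · exact absurd e hv

/-- The free neighbours of `b` that are adjacent to all others. -/
noncomputable def core (G : SimpleGraph V) (P : Finset V) (b : V) : Finset V :=
  (freeNbrs G P b).filter fun z => ∀ y ∈ freeNbrs G P b, z = y ∨ G.Adj y z

/-- By `adj_of_missed`, every neighbour of i outside A is adjacent to x. It is in `core` if adjacent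
to b, and otherwise in `extra`, where r does not count since it lies in A. -/
theorem degree_le_of_not_clique (h : StuckConfig G A P K F r b) (hx : G.Adj r x) (hxA : x ∉ A)
    {y y' : V} (hy : y ∈ freeNbrs G P b) (hy' : y' ∈ freeNbrs G P b) (hne : y ≠ y')
    (hn : ¬ G.Adj y y') {i : V} (hi : i ∈ missed G P x) :
    G.degree i + 1 ≤ A.card - 1 + (core G P b).card + (missed G P x).card := by
  have h1 : G.neighborFinset i \ A ⊆ core G P b ∪ (extra G b x).erase r := by
    intro z hz
    simp only [Finset.mem_sdiff, SimpleGraph.mem_neighborFinset] at hz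
    have hxz := h.adj_of_missed hx hxA hy hy' hne hn hi hz.1 hz.2
    rw [Finset.mem_union]
    by_cases hbz : G.Adj b z
    · left
      refine Finset.mem_filter.2 ⟨mem_freeNbrs.2 ⟨hbz, fun e => hz.2 (h.subset e)⟩, fun w hw => ?_⟩
      exact h.near_of_missed hx hxA hi hz.1 hz.2 hw
    · right
      refine Finset.mem_erase.2 ⟨?_, mem_extra.2 ⟨hxz, ?_, hbz⟩⟩
      · rintro rfl
        exact hz.2 h.r_mem
      · rintro rfl
        exact hz.2 h.b_mem
  have h2 := Finset.card_le_card h1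
  have h3 := Finset.card_union_le (core G P b) ((extra G b x).erase r)
  rw [Finset.card_erase_of_mem (h.r_mem_extra hx)] at h3
  have h4 := degree_le_of_mem (G := G) (h.subset (mem_missed.1 hi).1)
  have h5 := h.card_extra_le hx hxA
  have h6 : 0 < (extra G b x).card := Finset.card_pos.2 ⟨r, h.r_mem_extra hx⟩
  omega

theorem isClique_core :
    G.IsClique (insert b (core G P b) : Set V) := by
  rw [SimpleGraph.isClique_insert]
  refine ⟨?_, ?_⟩
  · intro u hu v hv huv
    simp only [core, Finset.coe_filter, Set.mem_ofPred_eq] at hu hv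
    exact (hv.2 u hu.1).resolve_left huv.symm
  · intro u hu _
    simp only [core, Finset.coe_filter, Set.mem_ofPred_eq, mem_freeNbrs] at hu
    exact hu.1.1

/-- The core together with b and y' is a clique, and y' is not in the core because it is not
adjacent to y. -/
theorem card_core_of_cliqueFree {y y' : V}
    (hy : y ∈ freeNbrs G P b) (hy' : y' ∈ freeNbrs G P b) (hne : y ≠ y') (hn : ¬ G.Adj y y')
    {k : ℕ} (hk : G.CliqueFree (k + 3)) : (core G P b).card ≤ k := by
  by_contra! hc
  have hy'c : y' ∉ core G P b := by
    intro e
    rcases (Finset.mem_filter.1 e).2 y hy with e | e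
    · exact hne e.symm
    · exact hn e
  have hbc : b ∉ core G P b := by
    intro e
    exact G.irrefl (mem_freeNbrs.1 (Finset.mem_filter.1 e).1).1
  have hyb : y' ≠ b := (mem_freeNbrs.1 hy').1.ne'
  have hcl : G.IsClique (insert y' (insert b (core G P b)) : Finset V) := by
    rw [Finset.coe_insert, Finset.coe_insert, SimpleGraph.isClique_insert]
    refine ⟨isClique_core, ?_⟩
    rintro u (rfl | hu) hne'
    · exact (mem_freeNbrs.1 hy').1.symm
    · exact ((Finset.mem_filter.1 (Finset.mem_coe.1 hu)).2 y' hy').resolve_left hne'.symm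
  have hcard : k + 3 ≤ (insert y' (insert b (core G P b))).card := by
    rw [Finset.card_insert_of_notMem (by simp [hyb, hy'c]), Finset.card_insert_of_notMem hbc]
    omega
  obtain ⟨t, ht, htc⟩ := Finset.exists_subset_card_eq hcard
  exact hk t ⟨hcl.subset (by exact_mod_cast ht), htc⟩

theorem card_freeNbrs_of_clique {k : ℕ}
    (hcl : ∀ y ∈ freeNbrs G P b, ∀ y' ∈ freeNbrs G P b, y ≠ y' → G.Adj y y')
    (hk : G.CliqueFree (k + 2)) : (freeNbrs G P b).card ≤ k := by
  by_contra! hc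
  have hbc : b ∉ freeNbrs G P b := fun e => G.irrefl (mem_freeNbrs.1 e).1
  have hcl' : G.IsClique (insert b (freeNbrs G P b) : Finset V) := by
    rw [Finset.coe_insert, SimpleGraph.isClique_insert]
    refine ⟨fun u hu v hv huv => hcl u hu v hv huv, fun u hu _ => (mem_freeNbrs.1 hu).1⟩
  have hcard : k + 2 ≤ (insert b (freeNbrs G P b)).card := by
    rw [Finset.card_insert_of_notMem hbc]
    omega
  obtain ⟨t, ht, htc⟩ := Finset.exists_subset_card_eq hcard
  exact hk t ⟨hcl'.subset (by exact_mod_cast ht), htc⟩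

/-- The edge bound by means of a free neighbour `y` of `b`. -/
theorem card_edges_of_freeNbr (h : StuckConfig G A P K F r b) (hx : G.Adj r x) (hxA : x ∉ A)
    {y : V} (hy : y ∈ freeNbrs G P b) {i : V} (hi : i ∈ missed G P x) {M m : ℕ}
    (hM : ∀ y ∈ freeNbrs G P b, G.degree y ≤ M)
    (hm : ((insert y (G.neighborFinset y)) \ insert b (insert x (G.neighborFinset x))).card ≤ m) :
    G.edgeFinset.card ≤ (P.card - (missed G P x).card) * (Fintype.card V - 1) +
      (freeNbrs G P b).card * M + (missed G P x).card * G.degree i +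
      ((missed G P x).card * (A.card - (P.card - (missed G P x).card) - 1) + F.card +
        m.choose 2) := by
  set W := (insert y (G.neighborFinset y)) \ insert b (insert x (G.neighborFinset x)) with hW
  -- An unprotected edge far from x has both ends in N[y], by `edge_near` in both orientations. So
  -- the far edges are pairs from W.
  have hle := h.card_edges_le' hx hxA (W.offDiag.image (Function.uncurry Sym2.mk)) ?_ hi hM
  · rw [Sym2.card_image_offDiag] at hle
    have := Nat.choose_le_choose 2 hm
    omega
  · intro u v huv hK hu hv hub hvb
    have hv' : v = y ∨ G.Adj y v := (h.edge_near hx hxA hy huv hK).resolve_left hu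
    have hu' : u = y ∨ G.Adj y u :=
      (h.edge_near hx hxA hy huv.symm (by rwa [Sym2.eq_swap])).resolve_left hv
    refine Finset.mem_image.2 ⟨(u, v), Finset.mem_offDiag.2 ⟨?_, ?_, huv.ne⟩, rfl⟩
    · simp only [hW, Finset.mem_sdiff, Finset.mem_insert, SimpleGraph.mem_neighborFinset]
      tauto
    · simp only [hW, Finset.mem_sdiff, Finset.mem_insert, SimpleGraph.mem_neighborFinset]
      tauto

/-- A free neighbour of `b` bounds the degree of the missed vertices. -/
theorem degree_le_of_freeNbr (h : StuckConfig G A P K F r b) (hx : G.Adj r x) (hxA : x ∉ A)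
    {y : V} (hy : y ∈ freeNbrs G P b) {i : V} (hi : i ∈ missed G P x) :
    G.degree i + 1 ≤ A.card - 1 + G.degree y := by
  have hnx : x ∉ G.neighborFinset i \ A := by
    simp only [Finset.mem_sdiff, SimpleGraph.mem_neighborFinset]
    exact fun e => (mem_missed.1 hi).2 e.1
  have hsub : insert x (G.neighborFinset i \ A) ⊆ (insert y (G.neighborFinset y)).erase b := by
    intro z hz
    rw [Finset.mem_insert] at hz
    rw [Finset.mem_erase, Finset.mem_insert, SimpleGraph.mem_neighborFinset]
    rcases hz with rfl | hz
    · refine ⟨fun e => hxA (e ▸ h.b_mem), ?_⟩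
      rcases h.near hx hxA hy with e | e
      · exact Or.inl e
      · exact Or.inr e.symm
    · rw [Finset.mem_sdiff, SimpleGraph.mem_neighborFinset] at hz
      exact ⟨fun e => hz.2 (e ▸ h.b_mem), h.near_of_missed hx hxA hi hz.1 hz.2 hy⟩
  have h1 := Finset.card_le_card hsub
  rw [Finset.card_insert_of_notMem hnx, Finset.card_erase_of_mem, Finset.card_insert_of_notMem
    (by simp), SimpleGraph.card_neighborFinset_eq_degree] at h1
  · have := degree_le_of_mem (G := G) (h.subset (mem_missed.1 hi).1)
    omega
  · rw [Finset.mem_insert, SimpleGraph.mem_neighborFinset]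
    exact Or.inr (mem_freeNbrs.1 hy).1.symm

/-- Inside N[y], which has deg y + 1 elements, the vertices far from x avoid b and all free
neighbours. When the latter form a clique, they and b all lie in N[y]. -/
theorem card_far_le (h : StuckConfig G A P K F r b) (hx : G.Adj r x) (hxA : x ∉ A)
    (hcl : ∀ y ∈ freeNbrs G P b, ∀ y' ∈ freeNbrs G P b, y ≠ y' → G.Adj y y')
    {y : V} (hy : y ∈ freeNbrs G P b) :
    ((insert y (G.neighborFinset y)) \ insert b (insert x (G.neighborFinset x))).card +
      (freeNbrs G P b).card ≤ G.degree y := by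
  have hbc : b ∉ freeNbrs G P b := fun e => G.irrefl (mem_freeNbrs.1 e).1
  have hdisj : Disjoint ((insert y (G.neighborFinset y)) \ insert b (insert x (G.neighborFinset x)))
      (insert b (freeNbrs G P b)) := by
    rw [Finset.disjoint_left]
    intro w hw hw'
    rw [Finset.mem_sdiff] at hw
    apply hw.2
    rw [Finset.mem_insert] at hw' ⊢
    refine hw'.imp id fun e => ?_
    rw [Finset.mem_insert, SimpleGraph.mem_neighborFinset]
    exact (h.near hx hxA e).imp Eq.symm id
  have hsub : ((insert y (G.neighborFinset y)) \ insert b (insert x (G.neighborFinset x))) ∪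
      (insert b (freeNbrs G P b)) ⊆ insert y (G.neighborFinset y) := by
    refine Finset.union_subset Finset.sdiff_subset ?_
    intro w hw
    rw [Finset.mem_insert] at hw
    rw [Finset.mem_insert, SimpleGraph.mem_neighborFinset]
    rcases hw with rfl | hw
    · exact Or.inr (mem_freeNbrs.1 hy).1.symm
    · by_cases e : w = y
      · exact Or.inl e
      · exact Or.inr (hcl y hy w hw (Ne.symm e))
  have h1 := Finset.card_le_card hsub
  rw [Finset.card_union_of_disjoint hdisj, Finset.card_insert_of_notMem hbc,
    Finset.card_insert_of_notMem (by simp), SimpleGraph.card_neighborFinset_eq_degree] at h1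
  omega

/-- If a free neighbour `y` of `b` lies in `A`, then its degree exceeds those of the vertices of `P`
missed by some neighbour of `r`. -/
theorem degree_add_card_le_of_inner (h : StuckConfig G A P K F r b) {y : V}
    (hy : y ∈ freeNbrs G P b) (hyA : y ∈ A) {i : V} (hi : i ∈ P)
    (hne : ((G.neighborFinset r \ A).filter fun x => ¬ G.Adj i x).Nonempty) :
    G.degree i + ((G.neighborFinset r \ A).filter fun x => ¬ G.Adj i x).card + P.card + 1 ≤
      A.card - 1 + G.degree y := by
  obtain ⟨x₀, hx₀⟩ := hne
  have hmem : ∀ x, x ∈ ((G.neighborFinset r \ A).filter fun x => ¬ G.Adj i x) ↔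
      (G.Adj r x ∧ x ∉ A) ∧ ¬ G.Adj i x := by
    intro x; simp
  rw [hmem] at hx₀
  obtain ⟨hyb, hyP⟩ := mem_freeNbrs.1 hy
  have hdisj : Disjoint (G.neighborFinset i \ A)
      ((G.neighborFinset r \ A).filter fun x => ¬ G.Adj i x) := by
    rw [Finset.disjoint_left]
    intro w hw hw'
    rw [Finset.mem_sdiff, SimpleGraph.mem_neighborFinset] at hw
    exact ((hmem w).1 hw').2 hw.1
  have hsub : (G.neighborFinset i \ A) ∪ ((G.neighborFinset r \ A).filter fun x => ¬ G.Adj i x) ⊆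
      G.neighborFinset y \ A := by
    intro z hz
    rw [Finset.mem_union, hmem, Finset.mem_sdiff, SimpleGraph.mem_neighborFinset] at hz
    rw [Finset.mem_sdiff, SimpleGraph.mem_neighborFinset]
    rcases hz with hz | hz
    · refine ⟨?_, hz.2⟩
      rcases h.near_of_missed hx₀.1.1 hx₀.1.2 (mem_missed.2 ⟨hi, hx₀.2⟩) hz.1 hz.2 hy with e | e
      · exact absurd hyA (e ▸ hz.2)
      · exact e
    · refine ⟨?_, hz.1.2⟩
      rcases h.near hz.1.1 hz.1.2 hy with e | e
      · exact absurd hyA (e ▸ hz.1.2)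
      · exact e.symm
  have h1 := Finset.card_le_card hsub
  rw [Finset.card_union_of_disjoint hdisj] at h1
  have h2 := degree_le_of_mem (G := G) (h.subset hi)
  have h3 := Finset.card_inter_add_card_sdiff (G.neighborFinset y) A
  rw [SimpleGraph.card_neighborFinset_eq_degree] at h3
  -- Inside A the vertex y is adjacent to b and to all of P, which gives the gain of |P| + 1.
  have h4 : insert b P ⊆ G.neighborFinset y ∩ A := by
    intro w hw
    rw [Finset.mem_inter, SimpleGraph.mem_neighborFinset]
    rcases Finset.mem_insert.1 hw with rfl | hw
    · exact ⟨hyb.symm, h.b_mem⟩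
    · exact ⟨(h.join w hw y hyA (fun e => hyP (e ▸ hw))).symm, h.subset hw⟩
  have h5 := Finset.card_le_card h4
  rw [Finset.card_insert_of_notMem h.b_not] at h5
  omega

end StuckConfig

end StuckCounting

/-! ### Numerical contradictions for k = 7 and k = 5 -/

section StuckContradictions

open scoped Classical

variable {V : Type*} [Fintype V] [DecidableEq V]

namespace StuckConfig

variable {G : SimpleGraph V} {A P : Finset V} {K : Set (Sym2 V)} {F : Finset (Sym2 V)} {r b x : V}

theorem card_missed_le : (missed G P x).card ≤ P.card := Finset.card_filter_le _ _

theorem freeNbrs_nonempty (h : StuckConfig G A P K F r b) (hd : P.card < G.degree b) :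
    (freeNbrs G P b).Nonempty := by
  rw [← Finset.card_pos]
  have := h.card_freeNbrs
  omega

/-- In a stuck configuration without a large clique whose free neighbours form a clique contained
in `A`, the degree of `r` is bounded. -/
theorem degree_le_of_inner (h : StuckConfig G A P K F r b) {y : V} (hy : y ∈ freeNbrs G P b)
    (hyA : y ∈ A) (hr : ∀ y ∈ A, y ∉ P → G.degree y ≤ G.degree r) :
    G.degree r ≤ A.card - 2 + P.card * (A.card - 2 - P.card) := by
  have hyr : G.degree y ≤ G.degree r := hr y hyA (mem_freeNbrs.1 hy).2
  have h1 := Finset.card_inter_add_card_sdiff (G.neighborFinset r) A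
  rw [SimpleGraph.card_neighborFinset_eq_degree] at h1
  have h2 : (G.neighborFinset r ∩ A).card ≤ A.card - 2 := by
    have hsub : G.neighborFinset r ∩ A ⊆ (A.erase b).erase r := by
      intro v hv
      simp only [Finset.mem_inter, SimpleGraph.mem_neighborFinset] at hv
      refine Finset.mem_erase.2 ⟨hv.1.ne', Finset.mem_erase.2 ⟨?_, hv.2⟩⟩
      rintro rfl
      exact h.stuck.not_adj hv.1
    have := Finset.card_le_card hsub
    rw [Finset.card_erase_of_mem (Finset.mem_erase.2 ⟨h.ne, h.r_mem⟩),
      Finset.card_erase_of_mem h.b_mem] at this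
    omega
  have h3 : G.neighborFinset r \ A ⊆
      P.biUnion fun i => (G.neighborFinset r \ A).filter fun x => ¬ G.Adj i x := by
    intro x hx
    have hx' := hx
    simp only [Finset.mem_sdiff, SimpleGraph.mem_neighborFinset] at hx'
    obtain ⟨i, hi⟩ := h.missed_nonempty hx'.1 hx'.2
    exact Finset.mem_biUnion.2 ⟨i, (mem_missed.1 hi).1, Finset.mem_filter.2 ⟨hx, (mem_missed.1 hi).2⟩⟩
  -- Each i ∈ P misses at most |A| - 2 - |P| outer neighbours of r: since deg y ≤ deg r ≤ deg i, the
  -- degrees in `degree_add_card_le_of_inner` cancel. Every outer neighbour of r is missed by some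
  -- i.
  have h4 := (Finset.card_le_card h3).trans (Finset.card_biUnion_le_card_mul _ _
    (A.card - 2 - P.card) ?_)
  · omega
  · intro i hi
    rcases Finset.eq_empty_or_nonempty ((G.neighborFinset r \ A).filter fun x => ¬ G.Adj i x)
      with e | e
    · simp [e]
    · have := h.degree_add_card_le_of_inner hy hyA hi e
      have := h.top_P i hi r h.r_not
      omega

/-- The numerical constraints of a stuck configuration: the set of free neighbours of `b` is not a
clique, or it is a clique. -/
theorem summary (h : StuckConfig G A P K F r b) (hx : G.Adj r x) (hxA : x ∉ A) :
    ∃ t D : ℕ, 1 ≤ t ∧ t ≤ P.card ∧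
      (∃ i ∈ missed G P x, D = G.degree i) ∧ G.degree b ≤ D ∧
      ((G.edgeFinset.card ≤ (P.card - t) * (Fintype.card V - 1) + (freeNbrs G P b).card * D +
          t * D + (t * (A.card - (P.card - t) - 1) + F.card) ∧
        D + 1 ≤ A.card - 1 + (core G P b).card + t ∧
        ∃ y ∈ freeNbrs G P b, ∃ y' ∈ freeNbrs G P b, y ≠ y' ∧ ¬ G.Adj y y') ∨
      ((∀ y ∈ freeNbrs G P b, ∀ y' ∈ freeNbrs G P b, y ≠ y' → G.Adj y y') ∧
        ∀ y ∈ freeNbrs G P b, D + 1 ≤ A.card - 1 + G.degree y ∧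
        ∀ M, (∀ y ∈ freeNbrs G P b, G.degree y ≤ M) →
        G.edgeFinset.card ≤ (P.card - t) * (Fintype.card V - 1) + (freeNbrs G P b).card * M +
          t * D + (t * (A.card - (P.card - t) - 1) + F.card +
            (G.degree y - (freeNbrs G P b).card).choose 2))) := by
  obtain ⟨i, hi⟩ := h.missed_nonempty hx hxA
  refine ⟨(missed G P x).card, G.degree i, Finset.card_pos.2 ⟨i, hi⟩, card_missed_le, ⟨i, hi, rfl⟩,
    h.degree_le_of_notMem hi h.b_not, ?_⟩
  by_cases hcl : ∀ y ∈ freeNbrs G P b, ∀ y' ∈ freeNbrs G P b, y ≠ y' → G.Adj y y'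
  · right
    refine ⟨hcl, fun y hy => ⟨h.degree_le_of_freeNbr hx hxA hy hi, fun M hM => ?_⟩⟩
    have := h.card_far_le hx hxA hcl hy
    exact h.card_edges_of_freeNbr hx hxA hy hi hM (by omega)
  · left
    push Not at hcl
    obtain ⟨y, hy, y', hy', hne, hn⟩ := hcl
    exact ⟨h.card_edges_of_not_clique hx hxA hy hy' hne hn hi,
      h.degree_le_of_not_clique hx hxA hy hy' hne hn hi, y, hy, y', hy', hne, hn⟩

/-- At most two vertices of unbounded degree remain in the covering set. The most restrictive case,
|P| = 3 and t = 1 with a clique of free neighbours, allows 2(n - 1) + 86 edges against the required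
3n - 2. In the clique case `hin` serves to bound deg y: by deg b if y is outside A, and by deg r
through `degree_le_of_inner` if y is inside. -/
theorem false_of_card_seven (h : StuckConfig G A P K F r b) (hx : G.Adj r x) (hxA : x ∉ A)
    (hd : P.card < G.degree b) (hA : A.card = 7) (hP : P.card ≤ 3) (hF : F.card ≤ 1)
    (hn : 93 ≤ Fintype.card V) (he : 3 * Fintype.card V ≤ G.edgeFinset.card + 2)
    (hfree : G.CliqueFree 7)
    (hin : (∃ y ∈ freeNbrs G P b, y ∉ A) ∨
      (P.card ≤ 2 ∧ ∀ y ∈ A, y ∉ P → G.degree y ≤ G.degree r)) : False := by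
  obtain ⟨t, D, ht, htP, ⟨i, hi, hiD⟩, hbD, hc⟩ := h.summary hx hxA
  have hnb := h.card_freeNbrs
  rw [hA] at hc
  rcases hc with ⟨hle, hD, y, hy, y', hy', hne, hnadj⟩ | ⟨hcl, hc⟩
  · have hcore := card_core_of_cliqueFree (k := 4) hy hy' hne hnadj hfree
    have hDt : D ≤ 9 + t := by omega
    have hnbt : (freeNbrs G P b).card ≤ 9 + t - P.card := by omega
    have hmul := Nat.mul_le_mul hnbt hDt
    have hmul' := Nat.mul_le_mul_left t hDt
    generalize P.card = p at *
    interval_cases p <;> interval_cases t <;> omega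
  · have hcard := card_freeNbrs_of_clique (k := 5) hcl hfree
    have hDM : ∀ y ∈ freeNbrs G P b, G.degree y ≤ D := fun z hz =>
      hiD ▸ h.degree_le_of_notMem hi (mem_freeNbrs.1 hz).2
    by_cases hout : ∃ y ∈ freeNbrs G P b, y ∉ A
    · obtain ⟨y, hy, hyA⟩ := hout
      obtain ⟨hD, hle⟩ := hc y hy
      have hle := hle D hDM
      have hyb := h.top y hyA
      have hch : (G.degree y - (freeNbrs G P b).card).choose 2 ≤ 3 :=
        (Nat.choose_le_choose 2 (by omega : _ ≤ 3)).trans (by decide)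
      have hmul := Nat.mul_le_mul hcard (by omega : D ≤ 13)
      have hmul' := Nat.mul_le_mul_left t (by omega : D ≤ 13)
      generalize P.card = p at *
      interval_cases p <;> interval_cases t <;> omega
    · obtain ⟨hP2, hr⟩ := hin.resolve_left hout
      push Not at hout
      obtain ⟨y, hy⟩ := h.freeNbrs_nonempty hd
      obtain ⟨hD, hle⟩ := hc y hy
      have hle := hle D hDM
      have hyr := hr y (hout y hy) (mem_freeNbrs.1 hy).2
      have hrle := h.degree_le_of_inner hy (hout y hy) hr
      rw [hA] at hrle
      have hr11 : G.degree r ≤ 11 := by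
        generalize P.card = p at *
        interval_cases p <;> omega
      have hch : (G.degree y - (freeNbrs G P b).card).choose 2 ≤ 55 :=
        (Nat.choose_le_choose 2 (by omega : _ ≤ 11)).trans (by decide)
      have hmul := Nat.mul_le_mul hcard (by omega : D ≤ 16)
      have hmul' := Nat.mul_le_mul_left t (by omega : D ≤ 16)
      generalize P.card = p at *
      interval_cases p <;> interval_cases t <;> omega

/-- The single vertex of P is missed, so every degree is bounded by a constant and at most 42 edges
are possible, while 2n - 1 ≥ 47 are present. -/
theorem false_of_card_five (h : StuckConfig G A P K F r b) (hx : G.Adj r x) (hxA : x ∉ A)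
    (hd : P.card < G.degree b) (hA : A.card = 5) (hP : P.card ≤ 1) (hF : F.card = 0)
    (hn : 24 ≤ Fintype.card V) (he : 2 * Fintype.card V ≤ G.edgeFinset.card + 1)
    (hfree : G.CliqueFree 5) (hr : ∀ y ∈ A, y ∉ P → G.degree y ≤ G.degree r) : False := by
  obtain ⟨t, D, ht, htP, ⟨i, hi, hiD⟩, hbD, hc⟩ := h.summary hx hxA
  have hnb := h.card_freeNbrs
  have hp : P.card = 1 := by omega
  have ht1 : t = 1 := by omega
  subst ht1
  rw [hA, hp] at hc
  rcases hc with ⟨hle, hD, y, hy, y', hy', hne, hnadj⟩ | ⟨hcl, hc⟩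
  · have hcore := card_core_of_cliqueFree (k := 2) hy hy' hne hnadj hfree
    have hmul := Nat.mul_le_mul (by omega : (freeNbrs G P b).card ≤ 5) (by omega : D ≤ 6)
    omega
  · have hcard := card_freeNbrs_of_clique (k := 3) hcl hfree
    have hDM : ∀ y ∈ freeNbrs G P b, G.degree y ≤ D := fun z hz =>
      hiD ▸ h.degree_le_of_notMem hi (mem_freeNbrs.1 hz).2
    obtain ⟨y, hy⟩ := h.freeNbrs_nonempty hd
    have hpos : 0 < (freeNbrs G P b).card := Finset.card_pos.2 ⟨y, hy⟩
    obtain ⟨hD, hle⟩ := hc y hy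
    have hle := hle D hDM
    have hd5 : G.degree y ≤ 5 := by
      by_cases hyA : y ∈ A
      · have hrle := h.degree_le_of_inner hy hyA hr
        have := hr y hyA (mem_freeNbrs.1 hy).2
        rw [hA, hp] at hrle
        omega
      · have := h.top y hyA
        omega
    have hch : (G.degree y - (freeNbrs G P b).card).choose 2 ≤ 6 :=
      (Nat.choose_le_choose 2 (by omega : _ ≤ 4)).trans (by decide)
    have hmul := Nat.mul_le_mul hcard (by omega : D ≤ 8)
    omega

end StuckConfig

end StuckContradictions

/-! ### Joining one more vertex to A -/

section Joining

open scoped Classical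

variable {V : Type*} [Fintype V] [DecidableEq V]

/-- Every vertex of `P` is adjacent to every other vertex of `A`. -/
def JoinedTo (G : SimpleGraph V) (P A : Finset V) : Prop :=
  ∀ p ∈ P, ∀ a ∈ A, p ≠ a → G.Adj p a

theorem card_inter_le_of_not_adj {G : SimpleGraph V} {A : Finset V} {r b : V} (hr : r ∈ A)
    (hb : b ∈ A) (hrb : r ≠ b) (hn : ¬ G.Adj r b) : (G.neighborFinset r ∩ A).card ≤ A.card - 2 := by
  have hsub : G.neighborFinset r ∩ A ⊆ (A.erase b).erase r := by
    intro v hv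
    simp only [Finset.mem_inter, SimpleGraph.mem_neighborFinset] at hv
    refine Finset.mem_erase.2 ⟨hv.1.ne', Finset.mem_erase.2 ⟨?_, hv.2⟩⟩
    rintro rfl
    exact hn hv.1
  have := Finset.card_le_card hsub
  rw [Finset.card_erase_of_mem (Finset.mem_erase.2 ⟨hrb, hr⟩), Finset.card_erase_of_mem hb] at this
  omega

theorem exists_nbr_notMem {G : SimpleGraph V} {A : Finset V} {r : V}
    (h : (G.neighborFinset r ∩ A).card < G.degree r) : ∃ x, G.Adj r x ∧ x ∉ A := by
  have e1 := Finset.card_inter_add_card_sdiff (G.neighborFinset r) A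
  rw [SimpleGraph.card_neighborFinset_eq_degree] at e1
  obtain ⟨x, hx⟩ := Finset.card_pos.1 (by omega : 0 < (G.neighborFinset r \ A).card)
  rw [Finset.mem_sdiff, SimpleGraph.mem_neighborFinset] at hx
  exact ⟨x, hx⟩

/-- If `P` is joined to `A` and no stuck configuration for `r` exists, then `r` can be joined to `A`
as well. -/
theorem exists_joinedTo_insert {G₀ : SimpleGraph V} {A P : Finset V} {r : V} (hPA : P ⊆ A)
    (hrA : r ∈ A) (hrP : r ∉ P) (hjoin : JoinedTo G₀ P A)
    (htop : ∀ v ∉ A, ∀ a ∈ A, G₀.degree v ≤ G₀.degree a)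
    (htopP : ∀ p ∈ P, ∀ v ∉ P, G₀.degree v ≤ G₀.degree p)
    (hr : A.card - 1 ≤ G₀.degree r)
    (hstuck : ∀ (G : SimpleGraph V) (K : Set (Sym2 V)) (b x : V), SameDegrees G₀ G →
      StuckConfig G A P K ∅ r b → G.Adj r x → x ∉ A → False) :
    ∃ G, SameDegrees G₀ G ∧ JoinedTo G (insert r P) A := by
  obtain ⟨G, ⟨hG, hGP⟩, hmax⟩ := exists_max_graph
    (fun G => SameDegrees G₀ G ∧ JoinedTo G P A) (fun G => (G.neighborFinset r ∩ A).card)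
    ⟨G₀, SameDegrees.refl G₀, hjoin⟩
  refine ⟨G, hG, ?_⟩
  by_contra hc
  have hb : ∃ b ∈ A, r ≠ b ∧ ¬ G.Adj r b := by
    by_contra! hall
    apply hc
    intro p hp a ha hpa
    rcases Finset.mem_insert.1 hp with rfl | hp
    · exact hall a ha hpa
    · exact hGP p hp a ha hpa
  obtain ⟨b, hbA, hrb, hnrb⟩ := hb
  have hbP : b ∉ P := fun e => hnrb (hGP b e r hrA hrb.symm).symm
  -- With these edges protected, an exchange creating rb would give r one more neighbour in A,
  -- against maximality.
  set K : Set (Sym2 V) := {e | (∃ p ∈ P, ∃ a ∈ A, e = s(p, a)) ∨ ∃ a ∈ A, a ≠ b ∧ e = s(r, a)}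
    with hK
  have hcfg : StuckConfig G A P K ∅ r b := by
    refine ⟨hPA, hrA, hbA, hrP, hbP, hrb, hGP, fun p hp a ha => Or.inl ⟨p, hp, a, ha, rfl⟩, ?_, ?_,
      ?_, ?_, ?_, ?_, ?_⟩
    · rintro u v (⟨p, hp, a, ha, e⟩ | ⟨a, ha, -, e⟩)
      · rcases Sym2.eq_iff.1 e with ⟨rfl, -⟩ | ⟨rfl, -⟩
        · exact hPA hp
        · exact ha
      · rcases Sym2.eq_iff.1 e with ⟨rfl, -⟩ | ⟨rfl, -⟩
        · exact hrA
        · exact ha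
    · rintro y hy hyP (⟨p, hp, a, ha, e⟩ | ⟨a, ha, hab, e⟩)
      · rcases Sym2.eq_iff.1 e with ⟨rfl, -⟩ | ⟨-, rfl⟩
        · exact hbP hp
        · exact hyP hp
      · rcases Sym2.eq_iff.1 e with ⟨rfl, -⟩ | ⟨rfl, -⟩
        · exact hrb rfl
        · exact hab rfl
    · rintro y u hy hyP (⟨p, hp, a, ha, e⟩ | ⟨a, ha, hab, e⟩)
      · rcases Sym2.eq_iff.1 e with ⟨rfl, -⟩ | ⟨-, rfl⟩
        · exact Or.inl hp
        · exact absurd hp hyP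
      · rcases Sym2.eq_iff.1 e with ⟨rfl, -⟩ | ⟨-, rfl⟩
        · exact Or.inr rfl
        · exact absurd hy.symm hnrb
    · rintro u v huv (⟨p, hp, a, ha, e⟩ | ⟨a, ha, hab, e⟩)
      · rcases Sym2.eq_iff.1 e with ⟨rfl, -⟩ | ⟨-, rfl⟩
        · exact Or.inl hp
        · exact Or.inr (Or.inl hp)
      · rcases Sym2.eq_iff.1 e with ⟨rfl, -⟩ | ⟨-, rfl⟩
        · exact Or.inr (Or.inr (Or.inl rfl))
        · exact Or.inr (Or.inr (Or.inr (Or.inl rfl)))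
    · intro v hv
      rw [hG v, hG b]
      exact htop v hv b hbA
    · intro p hp v hv
      rw [hG v, hG p]
      exact htopP p hp v hv
    · intro G' hG' hkeep hadj
      have hP' : JoinedTo G' P A := fun p hp a ha hpa =>
        hkeep p a (hGP p hp a ha hpa) (Or.inl ⟨p, hp, a, ha, rfl⟩)
      have := hmax G' ⟨hG.trans hG', hP'⟩
      have hsub : insert b (G.neighborFinset r ∩ A) ⊆ G'.neighborFinset r ∩ A := by
        intro v hv
        rw [Finset.mem_inter, SimpleGraph.mem_neighborFinset]
        rcases Finset.mem_insert.1 hv with rfl | hv'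
        · exact ⟨hadj, hbA⟩
        · rw [Finset.mem_inter, SimpleGraph.mem_neighborFinset] at hv'
          exact ⟨hkeep r v hv'.1 (Or.inr ⟨v, hv'.2, fun e => hnrb (e ▸ hv'.1), rfl⟩), hv'.2⟩
      have h2 := Finset.card_le_card hsub
      rw [Finset.card_insert_of_notMem (by simp [hnrb])] at h2
      omega
  have h1 := card_inter_le_of_not_adj hrA hbA hrb hnrb
  have h2 : 2 ≤ A.card := by
    rw [← Finset.card_pair hrb]
    exact Finset.card_le_card (by
      intro v hv
      rcases Finset.mem_insert.1 hv with rfl | hv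
      · exact hrA
      · rw [Finset.mem_singleton.1 hv]; exact hbA)
  obtain ⟨x, hx, hxA⟩ := exists_nbr_notMem (G := G) (A := A) (r := r) (by
    have := hG r
    omega)
  exact hstuck G K b x hG hcfg hx hxA

/-- The configuration used for adding an edge `rb` inside `A \ P`, keeping the edges in `F`. -/
theorem stuckConfig_of_inner {G₀ G : SimpleGraph V} {A P : Finset V} {F : Finset (Sym2 V)} {r b : V}
    (hPA : P ⊆ A) (hrA : r ∈ A) (hbA : b ∈ A) (hrP : r ∉ P) (hbP : b ∉ P) (hrb : r ≠ b)
    (hG : SameDegrees G₀ G) (hjoin : JoinedTo G P A)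
    (htop : ∀ v ∉ A, ∀ a ∈ A, G₀.degree v ≤ G₀.degree a)
    (htopP : ∀ p ∈ P, ∀ v ∉ P, G₀.degree v ≤ G₀.degree p)
    (hF : ∀ u v, s(u, v) ∈ F → u ∈ A ∧ u ≠ b)
    (hb : ∀ y, G.Adj b y → y ∈ A → y ∈ P)
    (hstuck : ∀ G', SameDegrees G₀ G' → JoinedTo G' P A →
      (∀ u v, s(u, v) ∈ F → G.Adj u v → G'.Adj u v) → ¬ G'.Adj r b) :
    StuckConfig G A P ({e | ∃ p ∈ P, ∃ a ∈ A, e = s(p, a)} ∪ F) F r b := by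
  have hin : ∀ u v, s(u, v) ∈ ({e | ∃ p ∈ P, ∃ a ∈ A, e = s(p, a)} ∪ F : Set (Sym2 V)) → u ∈ A := by
    rintro u v (⟨p, hp, a, ha, e⟩ | e)
    · rcases Sym2.eq_iff.1 e with ⟨rfl, -⟩ | ⟨rfl, -⟩
      · exact hPA hp
      · exact ha
    · exact (hF u v e).1
  refine ⟨hPA, hrA, hbA, hrP, hbP, hrb, hjoin, fun p hp a ha => Or.inl ⟨p, hp, a, ha, rfl⟩, hin,
    ?_, ?_, ?_, ?_, ?_, ?_⟩
  · intro y hy hyP hK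
    exact hyP (hb y hy (hin y b (by rwa [Sym2.eq_swap])))
  · intro y u hy hyP hK
    exact absurd (hb y hy (hin y u (by rwa [Sym2.eq_swap]))) hyP
  · rintro u v huv (⟨p, hp, a, ha, e⟩ | e)
    · rcases Sym2.eq_iff.1 e with ⟨rfl, -⟩ | ⟨-, rfl⟩
      · exact Or.inl hp
      · exact Or.inr (Or.inl hp)
    · exact Or.inr (Or.inr (Or.inr (Or.inr e)))
  · intro v hv
    rw [hG v, hG b]
    exact htop v hv b hbA
  · intro p hp v hv
    rw [hG v, hG p]
    exact htopP p hp v hv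
  · intro G' hG' hkeep
    refine hstuck G' (hG.trans hG') (fun p hp a ha hpa => ?_) (fun u v huv h => ?_)
    · exact hkeep p a (hjoin p hp a ha hpa) (Or.inl ⟨p, hp, a, ha, rfl⟩)
    · exact hkeep u v h (Or.inr huv)

/-- Every `a ∈ A \ P` with enough degree and no neighbours in `A \ P` has a neighbour outside `A`. -/
theorem exists_outer_nbr {G : SimpleGraph V} {A P : Finset V} {r : V}
    (hr : ∀ y, G.Adj r y → y ∈ A → y ∈ P) (hd : P.card < G.degree r) : ∃ x, G.Adj r x ∧ x ∉ A := by
  refine exists_nbr_notMem (lt_of_le_of_lt (Finset.card_le_card ?_) hd)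
  intro y hy
  rw [Finset.mem_inter, SimpleGraph.mem_neighborFinset] at hy
  exact hr y hy.1 hy.2

end Joining

/-! ### Target graphs -/

section Targets

open scoped Classical

variable {V : Type*} [Fintype V] [DecidableEq V]

/-- A clique on `m` vertices with a further vertex adjacent to two of its members. -/
def HasEaredClique (G : SimpleGraph V) (m : ℕ) : Prop :=
  ∃ (S : Finset V) (w p q : V), G.IsNClique m S ∧ w ∉ S ∧ p ∈ S ∧ q ∈ S ∧ p ≠ q ∧
    G.Adj w p ∧ G.Adj w q

/-- The edges of `G` inside `C`. -/
noncomputable def edgesIn (G : SimpleGraph V) (C : Finset V) : Finset (Sym2 V) :=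
  G.edgeFinset ∩ C.sym2

theorem mem_edgesIn {G : SimpleGraph V} {C : Finset V} {u v : V} :
    s(u, v) ∈ edgesIn G C ↔ G.Adj u v ∧ u ∈ C ∧ v ∈ C := by
  simp [edgesIn]

/-- A triangle `P` joined to four further vertices, which span at least two edges. -/
def HasTwoEdgeJoin (G : SimpleGraph V) : Prop :=
  ∃ P C : Finset V, P.card = 3 ∧ C.card = 4 ∧ Disjoint P C ∧ JoinedTo G P (P ∪ C) ∧
    2 ≤ (edgesIn G C).card

/-- Any vertex of the larger clique serves as the ear of the rest. This is why clique-freeness may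
be assumed in the counting arguments. -/
theorem hasEaredClique_of_not_cliqueFree {G : SimpleGraph V} {m : ℕ} (hm : 2 ≤ m)
    (h : ¬ G.CliqueFree (m + 1)) : HasEaredClique G m := by
  simp only [SimpleGraph.CliqueFree, not_forall, not_not] at h
  obtain ⟨S, hS⟩ := h
  obtain ⟨w, hw⟩ : S.Nonempty := Finset.card_pos.1 (by rw [hS.card_eq]; omega)
  have hcard : (S.erase w).card = m := by rw [Finset.card_erase_of_mem hw, hS.card_eq]; rfl
  obtain ⟨p, hp, q, hq, hpq⟩ := Finset.one_lt_card.1 (by omega : 1 < (S.erase w).card)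
  refine ⟨S.erase w, w, p, q, ⟨hS.isClique.subset (by simp), hcard⟩, by simp, hp, hq, hpq, ?_, ?_⟩
  · exact hS.isClique hw (Finset.mem_of_mem_erase hp) (Finset.ne_of_mem_erase hp).symm
  · exact hS.isClique hw (Finset.mem_of_mem_erase hq) (Finset.ne_of_mem_erase hq).symm

theorem SameDegrees.card_edges {G G' : SimpleGraph V} (h : SameDegrees G G') :
    G'.edgeFinset.card = G.edgeFinset.card := by
  have h1 := G.sum_degrees_eq_twice_card_edges
  have h2 := G'.sum_degrees_eq_twice_card_edges
  rw [Finset.sum_congr rfl fun w _ => h w, h1] at h2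
  omega

/-- A bound on the number of edges if all vertices outside `S` have small degree. -/
theorem card_edges_le_of_degree_le (G : SimpleGraph V) (S : Finset V) {s : ℕ}
    (h : ∀ v ∉ S, G.degree v ≤ s) :
    G.edgeFinset.card ≤ (Fintype.card V - S.card) * s + S.card.choose 2 := by
  have hle := card_edges_le_of_cover G Sᶜ (S.offDiag.image (Function.uncurry Sym2.mk)) ?_
  · rw [Sym2.card_image_offDiag] at hle
    refine hle.trans (Nat.add_le_add_right ?_ _)
    rw [← Finset.card_compl, ← smul_eq_mul]
    exact Finset.sum_le_card_nsmul _ _ _ fun v hv => h v (Finset.mem_compl.1 hv)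
  · intro u v huv
    by_cases hu : u ∈ S
    · by_cases hv : v ∈ S
      · exact Or.inr (Or.inr (Finset.mem_image.2
          ⟨(u, v), Finset.mem_offDiag.2 ⟨hu, hv, huv.ne⟩, rfl⟩))
      · exact Or.inr (Or.inl (Finset.mem_compl.2 hv))
    · exact Or.inl (Finset.mem_compl.2 hu)

end Targets

/-! ### Initial segments of the degree order -/

section InitialSegments

open scoped Classical

/-- The first `j` elements of `Fin n`. -/
def initial (n j : ℕ) : Finset (Fin n) := Finset.univ.filter fun i => i.val < j

theorem mem_initial {n j : ℕ} {i : Fin n} : i ∈ initial n j ↔ i.val < j := by simp [initial]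

theorem card_initial {n j : ℕ} (h : j ≤ n) : (initial n j).card = j := by
  rw [initial, Fin.card_filter_val_lt]
  omega

theorem initial_subset {n j k : ℕ} (h : j ≤ k) : initial n j ⊆ initial n k := by
  intro i hi
  rw [mem_initial] at *
  omega

theorem insert_initial {n j : ℕ} (h : j < n) :
    insert (⟨j, h⟩ : Fin n) (initial n j) = initial n (j + 1) := by
  ext i
  rw [Finset.mem_insert, mem_initial, mem_initial, Fin.ext_iff]
  simp only
  omega

variable {n : ℕ} {G₀ : SimpleGraph (Fin n)}

theorem degree_le_of_notMem_initial (hd : Antitone fun i => G₀.degree i) {j : ℕ} {u v : Fin n}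
    (hu : u ∉ initial n j) (hv : v ∈ initial n j) : G₀.degree u ≤ G₀.degree v := by
  rw [mem_initial] at hu hv
  exact hd (Fin.le_def.2 (by omega))

theorem exists_joinedTo_initial_succ (hd : Antitone fun i => G₀.degree i) {j k : ℕ} (hjk : j < k)
    (hkn : k ≤ n) (hj : JoinedTo G₀ (initial n j) (initial n k))
    (hr : k - 1 ≤ G₀.degree ⟨j, by omega⟩)
    (hstuck : ∀ (G : SimpleGraph (Fin n)) (K : Set (Sym2 (Fin n))) (b x : Fin n),
      SameDegrees G₀ G →
      StuckConfig G (initial n k) (initial n j) K ∅ ⟨j, by omega⟩ b → G.Adj ⟨j, by omega⟩ x →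
      x ∉ initial n k → False) :
    ∃ G, SameDegrees G₀ G ∧ JoinedTo G (initial n (j + 1)) (initial n k) := by
  have := exists_joinedTo_insert (G₀ := G₀) (A := initial n k) (P := initial n j)
    (r := ⟨j, by omega⟩) (initial_subset hjk.le) (mem_initial.2 hjk)
    (by simp [mem_initial]) hj
    (fun v hv a ha => degree_le_of_notMem_initial hd hv ha)
    (fun p hp v hv => degree_le_of_notMem_initial hd hv hp)
    (by rwa [card_initial hkn]) hstuck
  rwa [insert_initial (by omega : j < n)] at this

theorem joinedTo_initial_zero {G : SimpleGraph (Fin n)} {A : Finset (Fin n)} :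
    JoinedTo G (initial n 0) A := by
  intro p hp
  simp [mem_initial] at hp

theorem SameDegrees.antitone {G : SimpleGraph (Fin n)} (h : SameDegrees G₀ G)
    (hd : Antitone fun i => G₀.degree i) : Antitone fun i => G.degree i := by
  intro i j hij
  simp only [h i, h j]
  exact hd hij

/-- With P empty there is no vertex for x to miss, so joining the first vertex never gets stuck. -/
theorem false_of_card_eq_zero {G : SimpleGraph (Fin n)} {A P : Finset (Fin n)}
    {K : Set (Sym2 (Fin n))} {F : Finset (Sym2 (Fin n))} {r b x : Fin n}
    (h : StuckConfig G A P K F r b) (hx : G.Adj r x) (hxA : x ∉ A) (hP : P.card = 0) : False := by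
  have h1 := Finset.card_pos.2 (h.missed_nonempty hx hxA)
  have h2 := StuckConfig.card_missed_le (G := G) (P := P) (x := x)
  omega

/-- Join the first vertices one after the other. -/
theorem exists_joinedTo_initial (hd : Antitone fun i => G₀.degree i) {k m : ℕ} (hmk : m < k)
    (hkn : k ≤ n) (hr : ∀ i : Fin n, i.val < m → k - 1 ≤ G₀.degree i)
    (hstuck : ∀ (j : ℕ) (hj : j < n), j < m →
      ∀ (G : SimpleGraph (Fin n)) (K : Set (Sym2 (Fin n))) (b x : Fin n), SameDegrees G₀ G →
      StuckConfig G (initial n k) (initial n j) K ∅ ⟨j, hj⟩ b → G.Adj ⟨j, hj⟩ x →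
      x ∉ initial n k → False) :
    ∃ G, SameDegrees G₀ G ∧ JoinedTo G (initial n m) (initial n k) := by
  have key : ∀ j ≤ m, ∃ G, SameDegrees G₀ G ∧ JoinedTo G (initial n j) (initial n k) := by
    intro j
    induction j with
    | zero => exact fun _ => ⟨G₀, SameDegrees.refl _, joinedTo_initial_zero⟩
    | succ j ih =>
      intro hj
      obtain ⟨G, hG, hGj⟩ := ih (by omega)
      obtain ⟨G', hG', hGj'⟩ := exists_joinedTo_initial_succ (hG.antitone hd) (by omega : j < k) hkn
        hGj (by rw [hG]; exact hr ⟨j, by omega⟩ (by simp only; omega))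
        (fun G' K b x hG' => hstuck j (by omega) (by omega) G' K b x (hG.trans hG'))
      exact ⟨G', hG.trans hG', hGj'⟩
  exact key m le_rfl

/-- A lower bound for the second largest degree. -/
theorem le_degree_one (hd : Antitone fun i => G₀.degree i) (hn : 1 < n) {s : ℕ}
    (he : (s + 1) * (n - 1) < 2 * G₀.edgeFinset.card) : s < G₀.degree ⟨1, hn⟩ := by
  by_contra! hc
  have hsum := G₀.sum_degrees_eq_twice_card_edges
  have h1 : ∑ v, G₀.degree v ≤ G₀.degree ⟨0, by omega⟩ + (n - 1) * s := by
    rw [← Finset.add_sum_erase _ _ (Finset.mem_univ (⟨0, by omega⟩ : Fin n))]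
    refine Nat.add_le_add_left ?_ _
    have := Finset.sum_le_card_nsmul (Finset.univ.erase (⟨0, by omega⟩ : Fin n))
      (fun v => G₀.degree v) s (fun v hv => ?_)
    · rwa [Finset.card_erase_of_mem (Finset.mem_univ _), Finset.card_univ, Fintype.card_fin,
        smul_eq_mul] at this
    · refine le_trans (hd (Fin.le_def.2 ?_)) hc
      have := Finset.ne_of_mem_erase hv
      rw [ne_eq, Fin.ext_iff] at this
      simp only at this ⊢
      omega
  have h2 := G₀.degree_lt_card_verts ⟨0, by omega⟩
  rw [Fintype.card_fin] at h2
  have h3 : (s + 1) * (n - 1) = (n - 1) * s + (n - 1) := by ring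
  omega

/-- A lower bound for the degree of the `(j + 1)`-st vertex. -/
theorem le_degree_of_card_edges (hd : Antitone fun i => G₀.degree i) {j : ℕ} (hj : j < n) {s : ℕ}
    (he : (n - j) * s + j.choose 2 < G₀.edgeFinset.card) : s < G₀.degree ⟨j, hj⟩ := by
  by_contra! hc
  have := card_edges_le_of_degree_le G₀ (initial n j) (s := s) (fun v hv => le_trans
    (hd (Fin.le_def.2 (by rw [mem_initial] at hv; simpa using hv))) hc)
  rw [card_initial hj.le, Fintype.card_fin] at this
  omega

end InitialSegments

/-! ### Targets for k = 7 -/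

section Realizations

open scoped Classical

variable {n : ℕ} {G₀ : SimpleGraph (Fin n)}

theorem exists_joinedTo_seven (hn : 93 ≤ n) (hd : Antitone fun i => G₀.degree i)
    (he : 3 * n ≤ G₀.edgeFinset.card + 2) (hfree : ∀ G, SameDegrees G₀ G → G.CliqueFree 7)
    {m : ℕ} (hm : m ≤ 3) (hr : ∀ i : Fin n, i.val < m → 6 ≤ G₀.degree i) :
    ∃ G, SameDegrees G₀ G ∧ JoinedTo G (initial n m) (initial n 7) := by
  -- If all degrees from the seventh on were at most 3, there would be at most (n - 6) * 3 + 15 = 3n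
  -- - 3 edges.
  have h7 : 3 < G₀.degree ⟨6, by omega⟩ := by
    refine le_degree_of_card_edges hd (by omega) ?_
    simp only [Nat.choose, Nat.reduceAdd]
    omega
  refine exists_joinedTo_initial hd (by omega) (by omega) hr ?_
  intro j hj hjm G K b x hG h hx hxA
  have hjn : j ≤ n := hj.le
  have hb : 4 ≤ G.degree b := by
    rw [hG b]
    refine h7.trans_le (hd (Fin.le_def.2 ?_))
    have := mem_initial.1 h.b_mem
    simp only
    omega
  refine h.false_of_card_seven hx hxA ?_ (card_initial (by omega)) ?_ (by simp) (by simpa using hn)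
    (by rw [Fintype.card_fin, hG.card_edges]; exact he) (hfree G hG) (Or.inr ⟨?_, ?_⟩)
  · rw [card_initial hjn]; omega
  · rw [card_initial hjn]; omega
  · rw [card_initial hjn]; omega
  · intro y _ hyP
    refine hG.antitone hd (Fin.le_def.2 ?_)
    rw [mem_initial] at hyP
    simp only
    omega

/-- Among the realizations with three vertices joined to A, take one with the most edges among the
other four. If there is at most one such edge, two vertices avoiding it are stuck, and the edge
count is contradicted. -/
theorem exists_hasTwoEdgeJoin (hn : 93 ≤ n) (hd : Antitone fun i => G₀.degree i)
    (he : 3 * n ≤ G₀.edgeFinset.card + 2) (hfree : ∀ G, SameDegrees G₀ G → G.CliqueFree 7)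
    (h3 : 6 ≤ G₀.degree ⟨2, by omega⟩) : ∃ G, SameDegrees G₀ G ∧ HasTwoEdgeJoin G := by
  have h7 : 3 < G₀.degree ⟨6, by omega⟩ := by
    refine le_degree_of_card_edges hd (by omega) ?_
    simp only [Nat.choose, Nat.reduceAdd]
    omega
  obtain ⟨G₁, hG₁, hj₁⟩ := exists_joinedTo_seven hn hd he hfree (m := 3) le_rfl (fun i hi =>
    h3.trans (hd (Fin.le_def.2 (by simp only; omega))))
  set A := initial n 7 with hA
  set P := initial n 3 with hP
  have hPA : P ⊆ A := initial_subset (by omega)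
  have hPc : P.card = 3 := card_initial (by omega)
  have hAc : A.card = 7 := card_initial (by omega)
  have hCc : (A \ P).card = 4 := by rw [Finset.card_sdiff_of_subset hPA, hPc, hAc]
  obtain ⟨G, ⟨hG, hGj⟩, hmax⟩ := exists_max_graph
    (fun G => SameDegrees G₀ G ∧ JoinedTo G P A) (fun G => (edgesIn G (A \ P)).card)
    ⟨G₁, hG₁, hj₁⟩
  refine ⟨G, hG, P, A \ P, hPc, hCc, Finset.disjoint_sdiff, ?_, ?_⟩
  · rwa [Finset.union_sdiff_of_subset hPA]
  by_contra! hc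
  set F := edgesIn G (A \ P) with hF
  -- T holds the ends of the only possible edge, so at least two of the four vertices lie outside T
  -- to serve as r and b.
  have hT : ∃ T : Finset (Fin n), T.card ≤ 2 ∧ ∀ u v, s(u, v) ∈ F → u ∈ T := by
    rcases Finset.eq_empty_or_nonempty F with e | ⟨e, he⟩
    · exact ⟨∅, by simp, fun u v h => by simp [e] at h⟩
    · have hFe : F = {e} := by
        refine (Finset.eq_of_subset_of_card_le (Finset.singleton_subset_iff.2 he) ?_).symm
        rw [Finset.card_singleton]; omega
      induction e using Sym2.ind with
      | _ c c' =>
        refine ⟨{c, c'}, Finset.card_le_two, fun u v h => ?_⟩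
        rw [hFe, Finset.mem_singleton, Sym2.eq_iff] at h
        rcases h with ⟨rfl, -⟩ | ⟨rfl, -⟩ <;> simp
  obtain ⟨T, hTc, hT⟩ := hT
  obtain ⟨r, hr, b, hb, hrb⟩ := Finset.one_lt_card.1
    (by have := Finset.le_card_sdiff T (A \ P); omega : 1 < ((A \ P) \ T).card)
  rw [Finset.mem_sdiff, Finset.mem_sdiff] at hr hb
  have hnb : ∀ w, w ∈ A → w ∉ P → w ∉ T → ∀ y, G.Adj w y → y ∈ A → y ∈ P := by
    intro w hw hwP hwT y hy hyA
    by_contra hyP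
    exact hwT (hT w y (mem_edgesIn.2 ⟨hy, Finset.mem_sdiff.2 ⟨hw, hwP⟩,
      Finset.mem_sdiff.2 ⟨hyA, hyP⟩⟩))
  have hcfg : StuckConfig G A P
      ({e | ∃ p ∈ P, ∃ a ∈ A, e = s(p, a)} ∪ F : Set (Sym2 (Fin n))) F r b := by
    refine stuckConfig_of_inner hPA hr.1.1 hb.1.1 hr.1.2 hb.1.2 hrb hG hGj
      (fun v hv a ha => degree_le_of_notMem_initial hd hv ha)
      (fun p hp v hv => degree_le_of_notMem_initial hd hv hp) ?_ (hnb b hb.1.1 hb.1.2 hb.2) ?_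
    · intro u v huv
      refine ⟨(Finset.mem_sdiff.1 (mem_edgesIn.1 huv).2.1).1, ?_⟩
      rintro rfl
      exact hb.2 (hT u v huv)
    · intro G' hG' hj' hkeep hadj
      have := hmax G' ⟨hG', hj'⟩
      have hsub : insert s(r, b) F ⊆ edgesIn G' (A \ P) := by
        intro e
        induction e using Sym2.ind with
        | _ u v =>
          intro huv
          rcases Finset.mem_insert.1 huv with e | e
          · rw [e, mem_edgesIn]
            exact ⟨hadj, Finset.mem_sdiff.2 hr.1, Finset.mem_sdiff.2 hb.1⟩
          · have e' := mem_edgesIn.1 e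
            exact mem_edgesIn.2 ⟨hkeep u v e e'.1, e'.2⟩
      have h2 := Finset.card_le_card hsub
      rw [Finset.card_insert_of_notMem (fun e => hr.2 (hT r b e))] at h2
      omega
  have hdeg : ∀ w ∈ A, P.card < G.degree w := by
    intro w hw
    rw [hPc, hG w]
    refine h7.trans_le (hd (Fin.le_def.2 ?_))
    have := mem_initial.1 hw
    simp only
    omega
  obtain ⟨x, hx, hxA⟩ := exists_outer_nbr (hnb r hr.1.1 hr.1.2 hr.2) (hdeg r hr.1.1)
  refine hcfg.false_of_card_seven hx hxA (hdeg b hb.1.1) hAc hPc.le (by omega) (by simpa using hn)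
    (by rw [Fintype.card_fin, hG.card_edges]; exact he) (hfree G hG) (Or.inl ?_)
  -- All neighbours of b in A lie in P, so a free neighbour is outside A and the first alternative
  -- applies.
  obtain ⟨y, hy⟩ := hcfg.freeNbrs_nonempty (hdeg b hb.1.1)
  refine ⟨y, hy, fun hyA => ?_⟩
  rw [StuckConfig.mem_freeNbrs] at hy
  exact hy.2 (hnb b hb.1.1 hb.1.2 hb.2 y hy.1 hyA)

/-- Otherwise the degree sum is at most 2(n - 1) + 4 · 5 + 4(n - 6) = 6n - 6, below twice the number
of edges. -/
theorem five_le_degree (hn : 93 ≤ n) (hd : Antitone fun i => G₀.degree i)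
    (he : 3 * n ≤ G₀.edgeFinset.card + 2) (h3 : G₀.degree ⟨2, by omega⟩ ≤ 5) :
    5 ≤ G₀.degree ⟨6, by omega⟩ := by
  by_contra! hc
  have hsum := G₀.sum_degrees_eq_twice_card_edges
  have h1 : ∑ v, G₀.degree v ≤
      ∑ v : Fin n, (4 + ((if v.val < 6 then 1 else 0) + if v.val < 2 then n - 6 else 0)) := by
    refine Finset.sum_le_sum fun v _ => ?_
    have h0 := G₀.degree_lt_card_verts v
    rw [Fintype.card_fin] at h0
    by_cases h6 : v.val < 6
    · by_cases h2 : v.val < 2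
      · rw [if_pos h6, if_pos h2]
        omega
      · have : G₀.degree v ≤ 5 := (hd (Fin.le_def.2 (by simp only; omega))).trans h3
        rw [if_pos h6, if_neg h2]
        omega
    · have : G₀.degree v ≤ G₀.degree ⟨6, by omega⟩ := hd (Fin.le_def.2 (by simp only; omega))
      rw [if_neg h6, if_neg (by omega)]
      omega
  rw [Finset.sum_add_distrib, Finset.sum_add_distrib, ← Finset.sum_filter, ← Finset.sum_filter,
    Finset.sum_const, Finset.sum_const, Finset.sum_const, Fin.card_filter_val_lt,
    Fin.card_filter_val_lt, Finset.card_univ, Fintype.card_fin, Nat.min_eq_right (by omega),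
    Nat.min_eq_right (by omega)] at h1
  simp only [smul_eq_mul] at h1
  omega

/-- Only two vertices have degree above 5. They are joined to the first seven, and the edges among
the next four are maximized; if these four form a clique, the seventh vertex is the ear. Otherwise
every edge is at P, inside the four, met by N[x], or inside N[y], and all these sets outside P are
small. -/
theorem exists_hasEaredClique_six (hn : 93 ≤ n) (hd : Antitone fun i => G₀.degree i)
    (he : 3 * n ≤ G₀.edgeFinset.card + 2) (hfree : ∀ G, SameDegrees G₀ G → G.CliqueFree 7)
    (h2 : 6 ≤ G₀.degree ⟨1, by omega⟩) (h3 : G₀.degree ⟨2, by omega⟩ ≤ 5) :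
    ∃ G, SameDegrees G₀ G ∧ HasEaredClique G 6 := by
  have h7 := five_le_degree hn hd he h3
  obtain ⟨G₁, hG₁, hj₁⟩ := exists_joinedTo_seven hn hd he hfree (m := 2) (by omega) (fun i hi =>
    h2.trans (hd (Fin.le_def.2 (by simp only; omega))))
  set B := initial n 6 with hB
  set P := initial n 2 with hP
  have hPB : P ⊆ B := initial_subset (by omega)
  have hPc : P.card = 2 := card_initial (by omega)
  have hBc : B.card = 6 := card_initial (by omega)
  have hCc : (B \ P).card = 4 := by rw [Finset.card_sdiff_of_subset hPB, hPc, hBc]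
  obtain ⟨G, ⟨hG, hGj⟩, hmax⟩ := exists_max_graph
    (fun G => SameDegrees G₀ G ∧ JoinedTo G P (initial n 7)) (fun G => (edgesIn G (B \ P)).card)
    ⟨G₁, hG₁, hj₁⟩
  have hBA : B ⊆ initial n 7 := initial_subset (by omega)
  refine ⟨G, hG, B, ⟨6, by omega⟩, ⟨0, by omega⟩, ⟨1, by omega⟩, ⟨?_, hBc⟩, ?_, ?_, ?_, ?_, ?_, ?_⟩
  rotate_left
  · simp [hB, mem_initial]
  · simp [hB, mem_initial]
  · simp [hB, mem_initial]
  · simp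
  · exact (hGj _ (by simp [hP, mem_initial]) _ (by simp [mem_initial]) (by simp)).symm
  · exact (hGj _ (by simp [hP, mem_initial]) _ (by simp [mem_initial]) (by simp)).symm
  by_contra hc
  have hrb : ∃ r ∈ B \ P, ∃ b ∈ B \ P, r ≠ b ∧ ¬ G.Adj r b := by
    by_contra! hall
    apply hc
    intro u hu v hv huv
    by_cases huP : u ∈ P
    · exact hGj u huP v (hBA hv) huv
    · by_cases hvP : v ∈ P
      · exact (hGj v hvP u (hBA hu) huv.symm).symm
      · exact hall u (Finset.mem_sdiff.2 ⟨hu, huP⟩) v (Finset.mem_sdiff.2 ⟨hv, hvP⟩) huv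
  obtain ⟨r, hr, b, hb, hrb, hn_rb⟩ := hrb
  rw [Finset.mem_sdiff] at hr hb
  -- All edges at P can be protected here: they are covered by P in the count anyway.
  set K : Set (Sym2 (Fin n)) := {e | (∃ p ∈ P, p ∈ e) ∨ e ∈ (B \ P).sym2} with hK
  have hKiff : ∀ u v, s(u, v) ∈ K ↔ u ∈ P ∨ v ∈ P ∨ (u ∈ B \ P ∧ v ∈ B \ P) := by
    intro u v
    rw [hK, Set.mem_ofPred_eq, Finset.mk_mem_sym2_iff]
    simp only [Sym2.mem_iff]
    constructor
    · rintro (⟨p, hp, rfl | rfl⟩ | e)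
      · exact Or.inl hp
      · exact Or.inr (Or.inl hp)
      · exact Or.inr (Or.inr e)
    · rintro (e | e | e)
      · exact Or.inl ⟨u, e, Or.inl rfl⟩
      · exact Or.inl ⟨v, e, Or.inr rfl⟩
      · exact Or.inr e
  have hstuck : Stuck G K r b := by
    intro G' hG' hkeep hadj
    have := hmax G' ⟨hG.trans hG', fun p hp a ha hpa =>
      hkeep p a (hGj p hp a ha hpa) ((hKiff p a).2 (Or.inl hp))⟩
    have hsub : insert s(r, b) (edgesIn G (B \ P)) ⊆ edgesIn G' (B \ P) := by
      intro e
      induction e using Sym2.ind with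
      | _ u v =>
        intro huv
        rcases Finset.mem_insert.1 huv with e | e
        · rw [e, mem_edgesIn]
          exact ⟨hadj, Finset.mem_sdiff.2 hr, Finset.mem_sdiff.2 hb⟩
        · have e' := mem_edgesIn.1 e
          exact mem_edgesIn.2 ⟨hkeep u v e'.1 ((hKiff u v).2 (Or.inr (Or.inr e'.2))), e'.2⟩
    have h2 := Finset.card_le_card hsub
    rw [Finset.card_insert_of_notMem (fun e => hn_rb (mem_edgesIn.1 e).1)] at h2
    omega
  have hsmall : ∀ v ∉ P, G.degree v ≤ 5 := by
    intro v hv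
    rw [hG v]
    refine (hd (Fin.le_def.2 ?_)).trans h3
    rw [hP, mem_initial] at hv
    simp only
    omega
  -- The degree is at least 5, but a vertex missing another member of B has at most 4 neighbours in
  -- B.
  have houter : ∀ w w', w ∈ B → w' ∈ B → w ≠ w' → ¬ G.Adj w w' → ∃ y, G.Adj w y ∧ y ∉ B := by
    intro w w' hw hw' hne hnadj
    refine exists_nbr_notMem (lt_of_le_of_lt (card_inter_le_of_not_adj hw hw' hne hnadj) ?_)
    have : 5 ≤ G.degree w := by
      rw [hG w]
      refine h7.trans (hd (Fin.le_def.2 ?_))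
      have := mem_initial.1 hw
      simp only
      omega
    omega
  obtain ⟨x, hx, hxB⟩ := houter r b hr.1 hb.1 hrb hn_rb
  obtain ⟨y, hy, hyB⟩ := houter b r hb.1 hr.1 hrb.symm (fun e => hn_rb e.symm)
  have hfreeB : ∀ w w', w ∉ P → w' ∉ B → s(w, w') ∉ K := by
    intro w w' hw hw' hk
    rcases (hKiff w w').1 hk with e | e | e
    · exact hw e
    · exact hw' (hPB e)
    · exact hw' (Finset.mem_sdiff.1 e.2).1
  -- The total is at most 2(n - 1) for P, 6 · 5 for N[x], 6 pairs inside B \ P and 15 pairs inside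
  -- N[y].
  have hcount := card_edges_le_of_cover G (P ∪ (insert x (G.neighborFinset x) \ P))
    (((B \ P).offDiag ∪ (insert y (G.neighborFinset y)).offDiag).image (Function.uncurry Sym2.mk)) ?_
  · have c1 : ∑ v ∈ P ∪ (insert x (G.neighborFinset x) \ P), G.degree v ≤ 2 * (n - 1) + 6 * 5 := by
      rw [Finset.sum_union Finset.disjoint_sdiff]
      refine Nat.add_le_add ?_ ?_
      · rw [← hPc, ← smul_eq_mul]
        refine Finset.sum_le_card_nsmul _ _ _ fun v _ => Nat.le_sub_one_of_lt ?_
        have := G.degree_lt_card_verts v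
        rwa [Fintype.card_fin] at this
      · refine (Finset.sum_le_card_nsmul _ _ 5 fun v hv =>
          hsmall v (Finset.mem_sdiff.1 hv).2).trans ?_
        rw [smul_eq_mul]
        refine Nat.mul_le_mul_right _ ((Finset.card_le_card Finset.sdiff_subset).trans
          ((Finset.card_insert_le _ _).trans ?_))
        rw [SimpleGraph.card_neighborFinset_eq_degree]
        have := hsmall x (fun e => hxB (hPB e))
        omega
    have c2 : (((B \ P).offDiag ∪ (insert y (G.neighborFinset y)).offDiag).image
        (Function.uncurry Sym2.mk)).card ≤ 6 + 15 := by
      rw [Finset.image_union]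
      refine (Finset.card_union_le _ _).trans (Nat.add_le_add ?_ ?_)
      · rw [Sym2.card_image_offDiag, hCc]; decide
      · rw [Sym2.card_image_offDiag]
        refine (Nat.choose_le_choose 2 ((Finset.card_insert_le _ _).trans ?_)).trans
          (by decide : Nat.choose 6 2 ≤ 15)
        rw [SimpleGraph.card_neighborFinset_eq_degree]
        have := hsmall y (fun e => hyB (hPB e))
        omega
    rw [hG.card_edges] at hcount
    omega
  · intro u v huv
    by_cases hk : s(u, v) ∈ K
    · rcases (hKiff u v).1 hk with e | e | e
      · exact Or.inl (Finset.mem_union_left _ e)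
      · exact Or.inr (Or.inl (Finset.mem_union_left _ e))
      · exact Or.inr (Or.inr (Finset.mem_image.2 ⟨(u, v), Finset.mem_union_left _
          (Finset.mem_offDiag.2 ⟨e.1, e.2, huv.ne⟩), rfl⟩))
    · have hkey : ∀ u v, G.Adj u v → s(u, v) ∉ K →
          u ∈ P ∪ (insert x (G.neighborFinset x) \ P) ∨ v ∈ insert y (G.neighborFinset y) := by
        intro u v huv hk
        have huP : u ∉ P := fun e => hk ((hKiff u v).2 (Or.inl e))
        simp only [Finset.mem_union, Finset.mem_sdiff, Finset.mem_insert,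
          SimpleGraph.mem_neighborFinset]
        rcases hstuck.edge_near hrb hx (hfreeB r x hr.2 hxB) hy (hfreeB b y hb.2 hyB) huv hk with
          e | e
        · exact Or.inl (Or.inr ⟨e, huP⟩)
        · exact Or.inr e
      rcases hkey u v huv hk with e | e
      · exact Or.inl e
      · rcases hkey v u huv.symm (by rwa [Sym2.eq_swap]) with e' | e'
        · exact Or.inr (Or.inl e')
        · exact Or.inr (Or.inr (Finset.mem_image.2 ⟨(u, v), Finset.mem_union_right _
            (Finset.mem_offDiag.2 ⟨e', e, huv.ne⟩), rfl⟩))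

theorem exists_target_seven (hn : 93 ≤ n) (hd : Antitone fun i => G₀.degree i)
    (he : 3 * n ≤ G₀.edgeFinset.card + 2) :
    ∃ G, SameDegrees G₀ G ∧ (HasEaredClique G 6 ∨ HasTwoEdgeJoin G) := by
  by_cases hfree : ∀ G, SameDegrees G₀ G → G.CliqueFree 7
  · have h2 : 5 < G₀.degree ⟨1, by omega⟩ := le_degree_one hd (by omega) (by omega)
    by_cases h3 : 6 ≤ G₀.degree ⟨2, by omega⟩
    · obtain ⟨G, hG, h⟩ := exists_hasTwoEdgeJoin hn hd he hfree h3
      exact ⟨G, hG, Or.inr h⟩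
    · obtain ⟨G, hG, h⟩ := exists_hasEaredClique_six hn hd he hfree h2 (by omega)
      exact ⟨G, hG, Or.inl h⟩
  · push Not at hfree
    obtain ⟨G, hG, h⟩ := hfree
    exact ⟨G, hG, Or.inl (hasEaredClique_of_not_cliqueFree (by omega) h)⟩

end Realizations

/-! ### Targets for k = 5 -/

section FiveRealizations

open scoped Classical

theorem hasEaredClique_of_adj_of_joinedTo {V : Type*} [Fintype V] [DecidableEq V]
    {G : SimpleGraph V} {P A : Finset V} (hPA : P ⊆ A) (hG : JoinedTo G P A) (hP : 2 ≤ P.card)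
    {c c' w : V} (hc : c ∈ A \ P) (hc' : c' ∈ A \ P) (hcc : G.Adj c c') (hw : w ∈ A \ P)
    (hwc : w ≠ c) (hwc' : w ≠ c') : HasEaredClique G (P.card + 2) := by
  rw [Finset.mem_sdiff] at hc hc' hw
  have hadj : ∀ p ∈ P, ∀ v ∈ A, v ∉ P → G.Adj p v := fun p hp v hv hvP =>
    hG p hp v hv (fun e => hvP (e ▸ hp))
  obtain ⟨p, hp, q, hq, hpq⟩ := Finset.one_lt_card.1 (by omega : 1 < P.card)
  refine ⟨insert c (insert c' P), w, p, q, ⟨?_, ?_⟩, ?_, ?_, ?_, hpq, (hadj p hp w hw.1 hw.2).symm,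
    (hadj q hq w hw.1 hw.2).symm⟩
  · rw [Finset.coe_insert, Finset.coe_insert, SimpleGraph.isClique_insert,
      SimpleGraph.isClique_insert]
    refine ⟨⟨fun u hu v hv huv => hG u hu v (hPA hv) huv,
      fun u hu _ => (hadj u hu c' hc'.1 hc'.2).symm⟩, ?_⟩
    rintro u (rfl | hu) _
    · exact hcc
    · exact (hadj u hu c hc.1 hc.2).symm
  · rw [Finset.card_insert_of_notMem, Finset.card_insert_of_notMem hc'.2]
    rw [Finset.mem_insert, not_or]
    exact ⟨hcc.ne, hc.2⟩
  · simp [hwc, hwc', hw.2]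
  · simp [hp]
  · simp [hq]

namespace StuckConfig

variable {V : Type*} [Fintype V] [DecidableEq V]
variable {G : SimpleGraph V} {A P : Finset V} {K : Set (Sym2 V)} {F : Finset (Sym2 V)} {r b x : V}

/-- The core with b and y is a clique, and y' is an ear attached at b and a core vertex. Excluding
this saves one compared with `card_core_of_cliqueFree` at the corresponding clique size. -/
theorem card_core_of_not_hasEaredClique {y y' : V}
    (hy : y ∈ freeNbrs G P b) (hy' : y' ∈ freeNbrs G P b) (hne : y ≠ y') (hn : ¬ G.Adj y y')
    {k : ℕ} (hk : ¬ HasEaredClique G (k + 3)) : (core G P b).card ≤ k := by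
  by_contra! hc
  have hnc : ∀ z z', z ∈ freeNbrs G P b → z ≠ z' → ¬ G.Adj z z' → z' ∉ core G P b := by
    intro z z' hz hne hn e
    rcases (Finset.mem_filter.1 e).2 z hz with e | e
    · exact hne e.symm
    · exact hn e
  have hbc : b ∉ core G P b := by
    intro e
    exact G.irrefl (mem_freeNbrs.1 (Finset.mem_filter.1 e).1).1
  have hyb : y ≠ b := (mem_freeNbrs.1 hy).1.ne'
  have hyb' : y' ≠ b := (mem_freeNbrs.1 hy').1.ne'
  have hyc := hnc y' y hy' hne.symm (fun e => hn e.symm)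
  have hyc' := hnc y y' hy hne hn
  obtain ⟨T, hT, hTc⟩ := Finset.exists_subset_card_eq hc
  have hadj : ∀ u ∈ T, ∀ z ∈ freeNbrs G P b, z ∉ core G P b → G.Adj z u := by
    intro u hu z hz hzc
    refine ((Finset.mem_filter.1 (hT hu)).2 z hz).resolve_left ?_
    rintro rfl
    exact hzc (hT hu)
  obtain ⟨q, hq⟩ : T.Nonempty := Finset.card_pos.1 (by omega)
  refine hk ⟨insert y (insert b T), y', b, q, ⟨?_, ?_⟩, ?_, by simp, by simp [hq], ?_, ?_,
    hadj q hq y' hy' hyc'⟩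
  · rw [Finset.coe_insert, Finset.coe_insert, SimpleGraph.isClique_insert]
    refine ⟨isClique_core.subset (Set.insert_subset_insert (by exact_mod_cast hT)), ?_⟩
    rintro u (rfl | hu) _
    · exact (mem_freeNbrs.1 hy).1.symm
    · exact hadj u hu y hy hyc
  · rw [Finset.card_insert_of_notMem, Finset.card_insert_of_notMem (fun e => hbc (hT e)), hTc]
    rw [Finset.mem_insert, not_or]
    exact ⟨hyb, fun e => hyc (hT e)⟩
  · rw [Finset.mem_insert, Finset.mem_insert, not_or, not_or]
    exact ⟨hne.symm, hyb', fun e => hyc' (hT e)⟩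
  · rintro rfl
    exact hbc (hT hq)
  · exact (mem_freeNbrs.1 hy').1.symm

/-- If the free neighbours of `b` form a clique, there are few of them unless some clique with an
ear arises. -/
theorem hasEaredClique_of_clique (h : StuckConfig G A P K F r b)
    (hcl : ∀ y ∈ freeNbrs G P b, ∀ y' ∈ freeNbrs G P b, y ≠ y' → G.Adj y y')
    (hout : P.card + 2 ≤ G.degree b) (hr : ∀ y, G.Adj r y → y ∈ A → y ∈ P)
    (hbr : G.degree b ≤ G.degree r) :
    HasEaredClique G ((freeNbrs G P b).card + 1) := by
  have hcard := h.card_freeNbrs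
  obtain ⟨p, hp, q, hq, hpq⟩ := Finset.one_lt_card.1 (by omega : 1 < (freeNbrs G P b).card)
  have hbc : b ∉ freeNbrs G P b := fun e => G.irrefl (mem_freeNbrs.1 e).1
  have hclique : G.IsNClique ((freeNbrs G P b).card + 1) (insert b (freeNbrs G P b)) := by
    refine ⟨?_, Finset.card_insert_of_notMem hbc⟩
    rw [Finset.coe_insert, SimpleGraph.isClique_insert]
    exact ⟨fun u hu v hv huv => hcl u hu v hv huv, fun u hu _ => (mem_freeNbrs.1 hu).1⟩
  -- The clique consists of b and its free neighbours. If all outer neighbours of r are free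
  -- neighbours of b, then by cardinality r is adjacent to every one of them and is the ear.
  -- Otherwise another outer neighbour x of r is the ear.
  by_cases hsub : G.neighborFinset r \ A ⊆ freeNbrs G P b
  · have hc1 := Finset.card_inter_add_card_sdiff (G.neighborFinset r) A
    rw [SimpleGraph.card_neighborFinset_eq_degree] at hc1
    have hc2 : (G.neighborFinset r ∩ A).card ≤ P.card := by
      refine Finset.card_le_card fun y hy => ?_
      rw [Finset.mem_inter, SimpleGraph.mem_neighborFinset] at hy
      exact hr y hy.1 hy.2
    have heq := Finset.eq_of_subset_of_card_le hsub (by omega)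
    have hadj : ∀ y ∈ freeNbrs G P b, G.Adj r y := by
      intro y hy
      rw [← heq, Finset.mem_sdiff, SimpleGraph.mem_neighborFinset] at hy
      exact hy.1
    refine ⟨_, r, p, q, hclique, ?_, by simp [hp], by simp [hq], hpq, hadj p hp, hadj q hq⟩
    rw [Finset.mem_insert, not_or]
    exact ⟨h.ne, fun e => h.stuck.not_adj (mem_freeNbrs.1 e).1.symm⟩
  · obtain ⟨x, hx, hxb⟩ := Finset.not_subset.1 hsub
    rw [Finset.mem_sdiff, SimpleGraph.mem_neighborFinset] at hx
    have hadj : ∀ y ∈ freeNbrs G P b, G.Adj x y := fun y hy =>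
      (h.near hx.1 hx.2 hy).resolve_left (fun e => hxb (e ▸ hy))
    refine ⟨_, x, p, q, hclique, ?_, by simp [hp], by simp [hq], hpq, hadj p hp, hadj q hq⟩
    rw [Finset.mem_insert, not_or]
    exact ⟨fun e => hx.2 (e ▸ h.b_mem), hxb⟩

theorem false_of_not_hasEaredClique_four (h : StuckConfig G A P K F r b) (hx : G.Adj r x)
    (hxA : x ∉ A) (hd : P.card < G.degree b) (hA : A.card = 5) (hP : P.card = 2) (hF : F.card = 0)
    (hn : 24 ≤ Fintype.card V) (he : 2 * Fintype.card V ≤ G.edgeFinset.card + 1)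
    (hfree : ¬ HasEaredClique G 4) (hr : ∀ y, G.Adj r y → y ∈ A → y ∈ P)
    (hb : ∀ y, G.Adj b y → y ∈ A → y ∈ P) (hbr : G.degree b ≤ G.degree r) : False := by
  obtain ⟨t, D, ht, htP, ⟨i, hi, hiD⟩, hbD, hc⟩ := h.summary hx hxA
  have hnb := h.card_freeNbrs
  rw [hP] at htP hnb
  rw [hA, hP, hF] at hc
  rcases hc with ⟨hle, hD, y, hy, y', hy', hne, hnadj⟩ | ⟨hcl, hc⟩
  · have hcore := card_core_of_not_hasEaredClique (k := 1) hy hy' hne hnadj hfree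
    have hDt : D ≤ 4 + t := by omega
    have hmul := Nat.mul_le_mul (by omega : (freeNbrs G P b).card ≤ 2 + t) hDt
    have hmul' := Nat.mul_le_mul_left t hDt
    -- The case t = 1 needs n ≥ 24: it allows (n - 1) + 3 · 5 + 5 + 3 = n + 22 edges, against at
    -- least 2n - 1.
    interval_cases t <;> omega
  · have hcf : G.CliqueFree 5 := by
      by_contra hc
      exact hfree (hasEaredClique_of_not_cliqueFree (by omega) hc)
    have hcard3 := card_freeNbrs_of_clique (k := 3) hcl hcf
    have hcard : (freeNbrs G P b).card ≤ 2 := by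
      by_contra! hc3
      have := h.hasEaredClique_of_clique hcl (by omega) hr hbr
      rw [(by omega : (freeNbrs G P b).card = 3)] at this
      exact hfree this
    obtain ⟨y, hy⟩ := h.freeNbrs_nonempty hd
    have htop : ∀ y ∈ freeNbrs G P b, G.degree y ≤ G.degree b := fun z hz =>
      h.top z fun hzA => (mem_freeNbrs.1 hz).2 (hb z (mem_freeNbrs.1 hz).1 hzA)
    obtain ⟨hD, hle⟩ := hc y hy
    have hle := hle _ htop
    have hyb := htop y hy
    have hch : (G.degree y - (freeNbrs G P b).card).choose 2 ≤ 1 :=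
      (Nat.choose_le_choose 2 (by omega : _ ≤ 2)).trans (by decide)
    have hmul := Nat.mul_le_mul hcard (by omega : G.degree b ≤ 4)
    have hmul' := Nat.mul_le_mul_left t (by omega : D ≤ 7)
    interval_cases t <;> omega

end StuckConfig

variable {n : ℕ} {G₀ : SimpleGraph (Fin n)}

theorem exists_target_five (hn : 24 ≤ n) (hd : Antitone fun i => G₀.degree i)
    (he : 2 * n ≤ G₀.edgeFinset.card + 1) : ∃ G, SameDegrees G₀ G ∧ HasEaredClique G 4 := by
  by_contra! hno
  have hfree : ∀ G, SameDegrees G₀ G → G.CliqueFree 5 := by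
    intro G hG
    by_contra hc
    exact hno G hG (hasEaredClique_of_not_cliqueFree (by omega) hc)
  have h1 : 3 < G₀.degree ⟨1, by omega⟩ := le_degree_one hd (by omega) (by omega)
  have h4 : 2 < G₀.degree ⟨4, by omega⟩ := by
    refine le_degree_of_card_edges hd (by omega) ?_
    simp only [Nat.choose, Nat.reduceAdd]
    omega
  have hdeg : ∀ G, SameDegrees G₀ G → ∀ a ∈ initial n 5, 2 < G.degree a := by
    intro G hG a ha
    rw [hG a]
    refine h4.trans_le (hd (Fin.le_def.2 ?_))
    have := mem_initial.1 ha
    simp only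
    omega
  obtain ⟨G, hG, hGj⟩ : ∃ G, SameDegrees G₀ G ∧ JoinedTo G (initial n 2) (initial n 5) := by
    refine exists_joinedTo_initial hd (by omega) (by omega) (fun i hi =>
      (show 5 - 1 ≤ G₀.degree ⟨1, by omega⟩ from h1).trans (hd (Fin.le_def.2 (by simp only; omega)))) ?_
    intro j hj hj2 G K b x hG h hx hxA
    have hjc := card_initial (n := n) hj.le
    have hb := hdeg G hG b h.b_mem
    refine h.false_of_card_five hx hxA (by omega) (card_initial (by omega)) (by omega) (by simp)
      (by simpa using hn) (by rw [Fintype.card_fin, hG.card_edges]; exact he) (hfree G hG) ?_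
    intro y _ hyP
    refine hG.antitone hd (Fin.le_def.2 ?_)
    rw [mem_initial] at hyP
    simp only
    omega
  set A := initial n 5 with hA
  set P := initial n 2 with hP
  have hPA : P ⊆ A := initial_subset (by omega)
  have hPc : P.card = 2 := card_initial (by omega)
  have hAc : A.card = 5 := card_initial (by omega)
  -- An edge among the three vertices of A \ P would form a 4-clique with P, having the third vertex
  -- as ear. So these vertices are independent in every such realization, and any two of them are
  -- stuck.
  have hind : ∀ G, SameDegrees G₀ G → JoinedTo G P A → ∀ c c', c ∈ A \ P → c' ∈ A \ P →
      ¬ G.Adj c c' := by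
    intro G hG hGj c c' hc hc' hcc
    obtain ⟨w, hw⟩ : (((A \ P).erase c).erase c').Nonempty := by
      rw [← Finset.card_pos, Finset.card_erase_of_mem (Finset.mem_erase.2 ⟨hcc.ne', hc'⟩),
        Finset.card_erase_of_mem hc, Finset.card_sdiff_of_subset hPA]
      omega
    simp only [Finset.mem_erase] at hw
    have := hasEaredClique_of_adj_of_joinedTo hPA hGj hPc.ge hc hc' hcc hw.2.2 hw.2.1 hw.1
    rw [hPc] at this
    exact hno G hG this
  have hnb : ∀ c ∈ A \ P, ∀ y, G.Adj c y → y ∈ A → y ∈ P := by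
    intro c hc y hy hyA
    by_contra hyP
    exact hind G hG hGj c y hc (Finset.mem_sdiff.2 ⟨hyA, hyP⟩) hy
  have hrm : (⟨2, by omega⟩ : Fin n) ∈ A \ P := by simp [hA, hP, mem_initial]
  have hbm : (⟨3, by omega⟩ : Fin n) ∈ A \ P := by simp [hA, hP, mem_initial]
  have hrm' := Finset.mem_sdiff.1 hrm
  have hbm' := Finset.mem_sdiff.1 hbm
  have hcfg : StuckConfig G A P ({e | ∃ p ∈ P, ∃ a ∈ A, e = s(p, a)} ∪ (∅ : Finset (Sym2 (Fin n))))
      ∅ ⟨2, by omega⟩ ⟨3, by omega⟩ :=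
    stuckConfig_of_inner hPA hrm'.1 hbm'.1 hrm'.2 hbm'.2 (by simp) hG hGj
      (fun v hv a ha => degree_le_of_notMem_initial hd hv ha)
      (fun p hp v hv => degree_le_of_notMem_initial hd hv hp) (by simp) (hnb _ hbm)
      (fun G' hG' hj' _ => hind G' hG' hj' _ _ hrm hbm)
  obtain ⟨x, hx, hxA⟩ := exists_outer_nbr (hnb _ hrm) (by rw [hPc]; exact hdeg G hG _ hrm'.1)
  exact hcfg.false_of_not_hasEaredClique_four hx hxA (by rw [hPc]; exact hdeg G hG _ hbm'.1) hAc hPc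
    (by simp) (by simpa using hn) (by rw [Fintype.card_fin, hG.card_edges]; exact he) (hno G hG)
    (hnb _ hrm) (hnb _ hbm) (hG.antitone hd (Fin.le_def.2 (by simp)))

end FiveRealizations

/-! ### Targets for k = 3 and k = 4 -/

section SmallRealizations

open scoped Classical

variable {V : Type*} [Fintype V] [DecidableEq V]

/-- The edges from `v` to vertices outside `T`. -/
noncomputable def starAway (G : SimpleGraph V) (v : V) (T : Finset V) : Finset (Sym2 V) :=
  (G.neighborFinset v \ T).image fun w => s(v, w)

theorem mem_starAway {G : SimpleGraph V} {v w : V} {T : Finset V} (h : G.Adj v w) (hw : w ∉ T) :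
    s(v, w) ∈ starAway G v T :=
  Finset.mem_image.2 ⟨w, by simp [h, hw], rfl⟩

theorem card_starAway_le {G : SimpleGraph V} {v : V} {T : Finset V} (hT : ∀ w ∈ T, G.Adj v w) :
    (starAway G v T).card ≤ G.degree v - T.card := by
  refine Finset.card_image_le.trans ?_
  rw [Finset.card_sdiff_of_subset, SimpleGraph.card_neighborFinset_eq_degree]
  intro w hw
  simpa using hT w hw

/-- A vertex of degree at most `T.card` that is adjacent to all of `T` has no other neighbours. -/
theorem mem_of_adj_of_degree_le {G : SimpleGraph V} {v w : V} {T : Finset V}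
    (hT : ∀ w ∈ T, G.Adj v w) (hd : G.degree v ≤ T.card) (h : G.Adj v w) : w ∈ T := by
  have hsub : T ⊆ G.neighborFinset v := fun w hw => by simpa using hT w hw
  have := Finset.eq_of_subset_of_card_le hsub
    (by rwa [SimpleGraph.card_neighborFinset_eq_degree])
  rw [this]
  simpa using h

theorem hasEaredClique_three {G : SimpleGraph V} {a b c w : V} (hab : G.Adj a b) (hac : G.Adj a c)
    (hbc : G.Adj b c) (hwa : G.Adj w a) (hwb : G.Adj w b) (hwc : w ≠ c) : HasEaredClique G 3 := by
  refine ⟨{a, b, c}, w, a, b, SimpleGraph.is3Clique_triple_iff.2 ⟨hab, hac, hbc⟩, ?_, by simp,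
    by simp, hab.ne, hwa, hwb⟩
  simp [hwa.ne, hwb.ne, hwc]

namespace StuckConfig

variable {G : SimpleGraph V} {A P : Finset V} {K : Set (Sym2 V)} {F : Finset (Sym2 V)} {r b x o : V}

/-- By `card_far_le`, at most one vertex other than b is near y and far from x, while a far edge
avoiding b would need two. -/
theorem no_far_edge_of_degree_le (h : StuckConfig G A P K F r b) (hx : G.Adj r x) (hxA : x ∉ A)
    (hcl : ∀ y ∈ freeNbrs G P b, ∀ y' ∈ freeNbrs G P b, y ≠ y' → G.Adj y y')
    {y : V} (hy : y ∈ freeNbrs G P b) (hd : G.degree y ≤ (freeNbrs G P b).card + 1) {u v : V}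
    (huv : G.Adj u v) (hK : s(u, v) ∉ K) :
    ((u = x ∨ G.Adj x u) ∨ u = b) ∨ ((v = x ∨ G.Adj x v) ∨ v = b) := by
  by_contra! hc
  have hu := (h.edge_near hx hxA hy huv hK).resolve_left (not_or.2 hc.1.1)
  have hv := (h.edge_near hx hxA hy huv.symm (by rwa [Sym2.eq_swap])).resolve_left
    (not_or.2 hc.2.1)
  have hfar := h.card_far_le hx hxA hcl hy
  have hone : ((insert y (G.neighborFinset y)) \
      insert b (insert x (G.neighborFinset x))).card ≤ 1 := by omega
  refine huv.ne (Finset.card_le_one.1 hone u ?_ v ?_) <;>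
    simp only [Finset.mem_sdiff, Finset.mem_insert, SimpleGraph.mem_neighborFinset] <;> tauto

theorem missed_of_singleton (h : StuckConfig G A {o} K F r b) (hx : G.Adj r x) (hxA : x ∉ A) :
    o ∈ missed G {o} x := by
  obtain ⟨i, hi⟩ := h.missed_nonempty hx hxA
  rwa [Finset.mem_singleton.1 (mem_missed.1 hi).1] at hi

theorem degree_le_of_singleton (h : StuckConfig G A {o} K F r b)
    (ho : ∀ z, G.Adj o z → z ∈ A) : G.degree o ≤ A.card - 1 := by
  have := degree_le_of_mem (G := G) (h.subset (Finset.mem_singleton_self o))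
  have he : G.neighborFinset o \ A = ∅ := by
    rw [Finset.sdiff_eq_empty_iff_subset]
    intro z hz
    exact ho z (by simpa using hz)
  rwa [he, Finset.card_empty, Nat.add_zero] at this

/-- Two nonadjacent free neighbours contradict deg b ≤ deg o ≤ 2, so b has a unique free neighbour
y, outside A. Then o has no neighbours outside A, every degree is at most 2, and the cover gives 2 +
2 + 1 = 5 edges, one too few. -/
theorem false_of_cliqueFree_three (h : StuckConfig G A {o} K ∅ r b) (hx : G.Adj r x)
    (hxA : x ∉ A) (hd : 2 ≤ G.degree b) (hA : A.card = 3) (he : 6 ≤ G.edgeFinset.card)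
    (hfree : G.CliqueFree 3) : False := by
  obtain ⟨t, D, ht, htP, ⟨i, hi, hiD⟩, hbD, hc⟩ := h.summary hx hxA
  have hnb := h.card_freeNbrs
  rw [Finset.card_singleton] at hnb htP
  obtain rfl : t = 1 := by omega
  have hmiss := h.missed_of_singleton hx hxA
  have hmiss' : missed G {o} x = {o} := by
    refine Finset.eq_singleton_iff_unique_mem.2 ⟨hmiss, fun i hi => ?_⟩
    exact Finset.mem_singleton.1 (mem_missed.1 hi).1
  have hio : i = o := by rwa [hmiss', Finset.mem_singleton] at hi
  subst hio
  have hib : G.Adj i b := by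
    have := h.subset_nbrs (Finset.mem_singleton_self i)
    rw [SimpleGraph.mem_neighborFinset] at this
    exact this.symm
  rw [hA, Finset.card_singleton, hiD] at hc
  rcases hc with ⟨hle, hD, y, hy, y', hy', hne, hnadj⟩ | ⟨hcl, hc⟩
  · have hcore := card_core_of_cliqueFree (k := 0) hy hy' hne hnadj hfree
    have := Finset.one_lt_card.2 ⟨y, hy, y', hy', hne⟩
    omega
  · have hcard := card_freeNbrs_of_clique (k := 1) hcl hfree
    obtain ⟨y, hy⟩ := h.freeNbrs_nonempty (by rw [Finset.card_singleton]; omega)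
    obtain ⟨hby, hyi⟩ := mem_freeNbrs.1 hy
    rw [Finset.mem_singleton] at hyi
    have htri : ∀ u v w, G.Adj u v → G.Adj u w → G.Adj v w → False := fun u v w h1 h2 h3 =>
      hfree _ (SimpleGraph.is3Clique_triple_iff.2 ⟨h1, h2, h3⟩)
    have hyA : y ∉ A := fun hyA =>
      htri i b y hib (h.join i (Finset.mem_singleton_self i) y hyA (Ne.symm hyi)) hby
    have hyd := h.top y hyA
    have hxb : x ≠ b := fun e => hxA (e ▸ h.b_mem)
    have ho : ∀ z, G.Adj i z → z ∈ A := by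
      intro z hz
      by_contra hzA
      have hzb : z ≠ b := fun e => hzA (e ▸ h.b_mem)
      have hzr : z ≠ r := fun e => hzA (e ▸ h.r_mem)
      have hzx : z ≠ x := fun e => (mem_missed.1 hmiss).2 (e ▸ hz)
      rcases h.near_of_missed hx hxA hmiss hz hzA hy with e | e
      · exact htri i b y hib (e ▸ hz) hby
      · rcases h.near hx hxA hy with e' | e'
        · have := mem_of_adj_of_degree_le (G := G) (v := y) (T := {b, r}) (w := z) (by
            intro w hw
            simp only [Finset.mem_insert, Finset.mem_singleton] at hw
            rcases hw with rfl | rfl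
            · exact hby.symm
            · exact e' ▸ hx.symm) (by rw [Finset.card_pair h.ne.symm]; omega) e
          simp [hzb, hzr] at this
        · have := mem_of_adj_of_degree_le (G := G) (v := y) (T := {b, x}) (w := z) (by
            intro w hw
            simp only [Finset.mem_insert, Finset.mem_singleton] at hw
            rcases hw with rfl | rfl
            · exact hby.symm
            · exact e'.symm) (by rw [Finset.card_pair hxb.symm]; omega) e
          simp [hzb, hzx] at this
    have hi2 := h.degree_le_of_singleton ho
    have hle := h.card_edges_le hx hxA {s(i, b)} ?_ ?_
    · have hex := h.card_extra_le hx hxA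
      rw [hmiss', Finset.card_singleton] at hex
      have c1 := Finset.sum_le_card_nsmul (extra G b x) (fun v => G.degree v) 2 fun v hv =>
        (h.degree_le_of_notMem hi (h.extra_notMem hv)).trans (by omega)
      have c2 := Finset.sum_le_card_nsmul (freeNbrs G {i} b) (fun v => G.degree v) 2 fun v hv =>
        (h.degree_le_of_notMem hi (mem_freeNbrs.1 hv).2).trans (by omega)
      rw [hmiss', Finset.sdiff_self, Finset.sum_empty, Finset.card_singleton] at hle
      simp only [smul_eq_mul] at c1 c2
      omega
    · have hAeq : ∀ w ∈ A, w ≠ r → w = i ∨ w = b := by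
        intro w hw hwr
        by_contra! hc
        have : ({i, r, b, w} : Finset V) ⊆ A := by
          intro v hv
          simp only [Finset.mem_insert, Finset.mem_singleton] at hv
          rcases hv with rfl | rfl | rfl | rfl
          · exact h.subset (Finset.mem_singleton_self _)
          · exact h.r_mem
          · exact h.b_mem
          · exact hw
        have := Finset.card_le_card this
        have hir : i ≠ r := fun e => h.r_not (by simp [e])
        rw [Finset.card_insert_of_notMem (by simp [hir, hib.ne, hc.1.symm]),
          Finset.card_insert_of_notMem (by simp [h.ne, hwr.symm]), Finset.card_pair hc.2.symm] at this
        omega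
      intro u v huv hK _ _ hur hvr
      rw [Finset.mem_singleton, Sym2.eq_iff]
      have := huv.ne
      rcases hAeq u (h.inside u v hK) hur with rfl | rfl <;>
        rcases hAeq v (h.inside' hK) hvr with rfl | rfl <;> simp_all
    · intro u v huv hK hu hv hub hvb
      rcases h.no_far_edge_of_degree_le hx hxA hcl hy (by omega) huv hK with (e | e) | e | e
      · exact absurd e hu
      · exact absurd e hub
      · exact absurd e hv
      · exact absurd e hvb

/-- Outside `Q` there are at most two edges at o besides ob, and at most one edge at r besides ro
and rx. The edges ob and rx belong to `Q`, being incident to b and x. -/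
theorem card_edges_le_of_singleton (h : StuckConfig G A {o} K ∅ r b) (hx : G.Adj r x)
    (hxA : x ∉ A) (ho : G.degree o ≤ 3) (Q : Finset (Sym2 V))
    (hQ : ∀ u v, G.Adj u v → u = b ∨ u = x → s(u, v) ∈ Q)
    (hfree : ∀ u v, G.Adj u v → s(u, v) ∉ K → (u = r ∨ u = b ∨ u = x ∨ u = o) ∨
      (v = r ∨ v = b ∨ v = x ∨ v = o) ∨ s(u, v) ∈ Q) : G.edgeFinset.card ≤ 3 + Q.card := by
  have hoA := h.subset (Finset.mem_singleton_self o)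
  have hro : r ≠ o := fun e => h.r_not (by simp [e])
  have hbo : b ≠ o := fun e => h.b_not (by simp [e])
  have hxo : x ≠ o := fun e => hxA (e ▸ hoA)
  have hob : G.Adj o b := h.join o (Finset.mem_singleton_self o) b h.b_mem hbo.symm
  have hor : G.Adj o r := h.join o (Finset.mem_singleton_self o) r h.r_mem hro.symm
  have hdr : G.degree r ≤ 3 := (h.top_P o (Finset.mem_singleton_self o) r h.r_not).trans ho
  have key : ∀ u v, G.Adj u v → (u = r ∨ u = b ∨ u = x ∨ u = o) →
      s(u, v) ∈ starAway G o {b} ∪ starAway G r {o, x} ∪ Q := by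
    intro u v huv hu
    have swap : ∀ w, G.Adj w v → (v = b ∨ v = x) → s(w, v) ∈ Q := by
      intro w hw hv
      rw [Sym2.eq_swap]
      exact hQ v w hw.symm hv
    have hstar : ∀ w, G.Adj o w → s(o, w) ∈ starAway G o {b} ∪ starAway G r {o, x} ∪ Q := by
      intro w hw
      by_cases hwb : w = b
      · rw [Sym2.eq_swap]
        exact Finset.mem_union_right _ (hQ w o hw.symm (Or.inl hwb))
      · exact Finset.mem_union_left _ (Finset.mem_union_left _ (mem_starAway hw (by simp [hwb])))
    rcases hu with rfl | rfl | rfl | rfl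
    · by_cases hvo : v = o
      · subst hvo
        rw [Sym2.eq_swap]
        exact hstar u huv.symm
      by_cases hvx : v = x
      · exact Finset.mem_union_right _ (swap u huv (Or.inr hvx))
      exact Finset.mem_union_left _ (Finset.mem_union_right _
        (mem_starAway huv (by simp [hvo, hvx])))
    · exact Finset.mem_union_right _ (hQ _ _ huv (Or.inl rfl))
    · exact Finset.mem_union_right _ (hQ _ _ huv (Or.inr rfl))
    · exact hstar v huv
  have hle := card_edges_le_of_cover G ∅ (starAway G o {b} ∪ starAway G r {o, x} ∪ Q) ?_
  · rw [Finset.sum_empty] at hle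
    have c1 := Finset.card_union_le (starAway G o {b} ∪ starAway G r {o, x}) Q
    have c2 := Finset.card_union_le (starAway G o {b}) (starAway G r {o, x})
    have c3 := card_starAway_le (G := G) (v := o) (T := {b}) (by simpa using hob)
    have c4 := card_starAway_le (G := G) (v := r) (T := {o, x}) (by simp [hor.symm, hx])
    rw [Finset.card_singleton] at c3
    rw [Finset.card_pair hxo.symm] at c4
    omega
  · intro u v huv
    right; right
    have keyr : (v = r ∨ v = b ∨ v = x ∨ v = o) →
        s(u, v) ∈ starAway G o {b} ∪ starAway G r {o, x} ∪ Q := by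
      intro hv
      rw [Sym2.eq_swap]
      exact key v u huv.symm hv
    by_cases hK : s(u, v) ∈ K
    · rcases h.listed u v huv hK with e | e | e | e | e
      · exact key u v huv (by simp_all)
      · exact keyr (by simp_all)
      · exact key u v huv (Or.inl e)
      · exact keyr (Or.inl e)
      · simp at e
    · rcases hfree u v huv hK with e | e | e
      · exact key u v huv e
      · exact keyr e
      · exact Finset.mem_union_right _ e

/-- Let y be the free neighbour of b. If y ∈ A, comparing degrees leaves r only one outer neighbour
and deg r = 3, so y is adjacent to o, b, x and r although deg y ≤ 3. If y ∉ A, then x and y have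
degree at most 2, their neighbourhoods are known, and o has no neighbours outside A. -/
theorem false_of_card_freeNbrs_le_one (h : StuckConfig G A {o} K ∅ r b) (hx : G.Adj r x)
    (hxA : x ∉ A) (hd : 2 ≤ G.degree b) (hdr : 3 ≤ G.degree r) (hA : A.card = 4)
    (he : 10 ≤ G.edgeFinset.card)
    (hr : ∀ y ∈ A, y ≠ o → G.degree y ≤ G.degree r)
    (h2 : (freeNbrs G {o} b).card ≤ 1) : False := by
  have hoP := Finset.mem_singleton_self o
  have hoA := h.subset hoP
  have hnb := h.card_freeNbrs
  rw [Finset.card_singleton] at hnb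
  have hmiss := h.missed_of_singleton hx hxA
  have hox := (mem_missed.1 hmiss).2
  have hro : r ≠ o := fun e => h.r_not (by simp [e])
  have hbo : b ≠ o := fun e => h.b_not (by simp [e])
  have hxo : x ≠ o := fun e => hxA (e ▸ hoA)
  have hxb : x ≠ b := fun e => hxA (e ▸ h.b_mem)
  have hxr : x ≠ r := fun e => hxA (e ▸ h.r_mem)
  have hob : G.Adj o b := h.join o hoP b h.b_mem hbo.symm
  have hor : G.Adj o r := h.join o hoP r h.r_mem hro.symm
  have hnrb := h.stuck.not_adj
  have hxd := h.top x hxA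
  have hsb := card_starAway_le (G := G) (v := b) (T := ∅) (by simp)
  rw [Finset.card_empty] at hsb
  obtain ⟨y, hy⟩ := h.freeNbrs_nonempty (by rw [Finset.card_singleton]; omega)
  obtain ⟨hby, hyo⟩ := mem_freeNbrs.1 hy
  rw [Finset.mem_singleton] at hyo
  have hsx := card_starAway_le (G := G) (v := x) (T := ∅) (by simp)
  rw [Finset.card_empty] at hsx
  by_cases hyA : y ∈ A
  · have hxy : G.Adj x y := (h.near hx hxA hy).resolve_left (fun e => hxA (e ▸ hyA))
    have hX : (G.neighborFinset r \ A).filter (fun x => ¬ G.Adj o x) =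
        G.neighborFinset r \ A := by
      refine Finset.filter_true_of_mem fun z hz => ?_
      rw [Finset.mem_sdiff, SimpleGraph.mem_neighborFinset] at hz
      exact (mem_missed.1 (h.missed_of_singleton hz.1 hz.2)).2
    have hxX : x ∈ G.neighborFinset r \ A := by simp [hx, hxA]
    have hin := h.degree_add_card_le_of_inner hy hyA hoP (by rw [hX]; exact ⟨x, hxX⟩)
    rw [hX, Finset.card_singleton, hA] at hin
    have hXpos := Finset.card_pos.2 ⟨x, hxX⟩
    have hyr := hr y hyA hyo
    have hyd := h.top_P o hoP y (by simpa using hyo)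
    have hrd := h.top_P o hoP r h.r_not
    have hsplit := Finset.card_inter_add_card_sdiff (G.neighborFinset r) A
    rw [SimpleGraph.card_neighborFinset_eq_degree] at hsplit
    have hri : (G.neighborFinset r ∩ A).card ≤ (((A.erase r).erase b)).card := by
      refine Finset.card_le_card fun z hz => ?_
      rw [Finset.mem_inter, SimpleGraph.mem_neighborFinset] at hz
      refine Finset.mem_erase.2 ⟨?_, Finset.mem_erase.2 ⟨hz.1.ne', hz.2⟩⟩
      rintro rfl
      exact hnrb hz.1
    rw [Finset.card_erase_of_mem (Finset.mem_erase.2 ⟨h.ne.symm, h.b_mem⟩),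
      Finset.card_erase_of_mem h.r_mem, hA] at hri
    have heq := Finset.eq_of_subset_of_card_le (s := G.neighborFinset r ∩ A)
      (t := (A.erase r).erase b) (fun z hz => by
        rw [Finset.mem_inter, SimpleGraph.mem_neighborFinset] at hz
        refine Finset.mem_erase.2 ⟨?_, Finset.mem_erase.2 ⟨hz.1.ne', hz.2⟩⟩
        rintro rfl
        exact hnrb hz.1) (by
        rw [Finset.card_erase_of_mem (Finset.mem_erase.2 ⟨h.ne.symm, h.b_mem⟩),
          Finset.card_erase_of_mem h.r_mem, hA]
        omega)
    have hyr' : y ≠ r := by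
      rintro rfl
      exact hnrb hby.symm
    have hry : G.Adj r y := by
      have : y ∈ G.neighborFinset r ∩ A := by
        rw [heq]
        simp [hby.ne', hyr', hyA]
      rw [Finset.mem_inter, SimpleGraph.mem_neighborFinset] at this
      exact this.1
    have hoy : G.Adj o y := h.join o hoP y hyA (Ne.symm hyo)
    have := mem_of_adj_of_degree_le (G := G) (v := y) (T := {o, b, x}) (w := r)
      (by simp [hoy.symm, hby.symm, hxy.symm])
      (by rw [Finset.card_insert_of_notMem (by simp [hbo.symm, hxo.symm]),
            Finset.card_pair hxb.symm]; omega) hry.symm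
    simp [hro, h.ne, hxr.symm] at this
  · have hyd := h.top y hyA
    by_cases hxy : x = y
    · subst hxy
      have hNx : ∀ z, G.Adj x z → z = r ∨ z = b := by
        intro z hz
        have := mem_of_adj_of_degree_le (G := G) (v := x) (T := {r, b}) (w := z)
          (by simp [hx.symm, hby.symm]) (by rw [Finset.card_pair h.ne]; omega) hz
        simpa using this
      have ho := h.degree_le_of_singleton (fun z hz => by
        by_contra hzA
        rcases h.near_of_missed hx hxA hmiss hz hzA hy with e | e
        · exact hox (e ▸ hz)
        · rcases hNx z e with rfl | rfl
          · exact hzA h.r_mem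
          · exact hzA h.b_mem)
      have := h.card_edges_le_of_singleton hx hxA (by omega)
        (starAway G b ∅ ∪ starAway G x ∅) ?_ ?_
      · have := Finset.card_union_le (starAway G b ∅) (starAway G x ∅)
        omega
      · rintro u v huv (rfl | rfl)
        · exact Finset.mem_union_left _ (mem_starAway huv (by simp))
        · exact Finset.mem_union_right _ (mem_starAway huv (by simp))
      · intro u v huv hK
        rcases h.edge_near hx hxA hy huv hK with (e | e) | e | e
        · exact Or.inl (Or.inr (Or.inr (Or.inl e)))
        · exact Or.inl ((hNx u e).imp id Or.inl)
        · exact Or.inr (Or.inl (Or.inr (Or.inr (Or.inl e))))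
        · exact Or.inr (Or.inl ((hNx v e).imp id Or.inl))
    · have hxy' : G.Adj x y := (h.near hx hxA hy).resolve_left hxy
      have hyr : y ≠ r := fun e => hyA (e ▸ h.r_mem)
      have hNx : ∀ z, G.Adj x z → z = r ∨ z = y := by
        intro z hz
        have := mem_of_adj_of_degree_le (G := G) (v := x) (T := {r, y}) (w := z)
          (by simp [hx.symm, hxy']) (by rw [Finset.card_pair hyr.symm]; omega) hz
        simpa using this
      have hNy : ∀ z, G.Adj y z → z = b ∨ z = x := by
        intro z hz
        have := mem_of_adj_of_degree_le (G := G) (v := y) (T := {b, x}) (w := z)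
          (by simp [hby.symm, hxy'.symm]) (by rw [Finset.card_pair hxb.symm]; omega) hz
        simpa using this
      have ho := h.degree_le_of_singleton (fun z hz => by
        by_contra hzA
        rcases h.near_of_missed hx hxA hmiss hz hzA hy with e | e
        · subst e
          rcases hNy o hz.symm with e | e
          · exact hbo e.symm
          · exact hxo e.symm
        · rcases hNy z e with rfl | rfl
          · exact hzA h.b_mem
          · exact hox hz)
      have := h.card_edges_le_of_singleton hx hxA (by omega)
        (starAway G b ∅ ∪ starAway G x ∅) ?_ ?_
      · have := Finset.card_union_le (starAway G b ∅) (starAway G x ∅)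
        omega
      · rintro u v huv (rfl | rfl)
        · exact Finset.mem_union_left _ (mem_starAway huv (by simp))
        · exact Finset.mem_union_right _ (mem_starAway huv (by simp))
      · intro u v huv hK
        rcases h.edge_near hx hxA hy huv hK with (e | e) | e | e
        · exact Or.inl (Or.inr (Or.inr (Or.inl e)))
        · rcases hNx u e with e | e
          · exact Or.inl (Or.inl e)
          · exact Or.inr (Or.inl (Or.inr ((hNy v (e ▸ huv)).imp id Or.inl)))
        · exact Or.inl (Or.inr ((hNy u (e ▸ huv.symm)).imp id Or.inl))
        · exact Or.inr (Or.inl (Or.inr ((hNy v e).imp id Or.inl)))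

/-- There are exactly two free neighbours, and x is one of them: otherwise x is an ear of the
triangle they form with b. With w the other one, N(x) = {r, b, w}. An outer neighbour of o would
have to be w, making o an ear of the triangle b, w, x; so deg o ≤ 3 and at most 3 + (3 + 2 + 1) = 9
edges exist. -/
theorem false_of_clique_of_not_hasEaredClique (h : StuckConfig G A {o} K ∅ r b) (hx : G.Adj r x)
    (hxA : x ∉ A) (hd : 2 ≤ G.degree b) (hdr : 3 ≤ G.degree r) (hA : A.card = 4)
    (he : 10 ≤ G.edgeFinset.card)
    (hfree : ¬ HasEaredClique G 3) (hcl : ∀ y ∈ freeNbrs G {o} b, ∀ y' ∈ freeNbrs G {o} b, y ≠ y' → G.Adj y y')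
    (h2 : 1 < (freeNbrs G {o} b).card) : False := by
  have hoP := Finset.mem_singleton_self o
  have hoA := h.subset hoP
  have hnb := h.card_freeNbrs
  rw [Finset.card_singleton] at hnb
  have hmiss := h.missed_of_singleton hx hxA
  have hox := (mem_missed.1 hmiss).2
  have hro : r ≠ o := fun e => h.r_not (by simp [e])
  have hbo : b ≠ o := fun e => h.b_not (by simp [e])
  have hxo : x ≠ o := fun e => hxA (e ▸ hoA)
  have hxb : x ≠ b := fun e => hxA (e ▸ h.b_mem)
  have hxr : x ≠ r := fun e => hxA (e ▸ h.r_mem)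
  have hob : G.Adj o b := h.join o hoP b h.b_mem hbo.symm
  have hor : G.Adj o r := h.join o hoP r h.r_mem hro.symm
  have hnrb := h.stuck.not_adj
  have hxd := h.top x hxA
  have hsb := card_starAway_le (G := G) (v := b) (T := ∅) (by simp)
  rw [Finset.card_empty] at hsb
  have hcf : G.CliqueFree 4 := by
    by_contra hc
    exact hfree (hasEaredClique_of_not_cliqueFree (by omega) hc)
  have hcard := card_freeNbrs_of_clique (k := 2) hcl hcf
  obtain ⟨z, hz, z', hz', hzz⟩ := Finset.one_lt_card.1 (by omega : 1 < (freeNbrs G {o} b).card)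
  have hzz' := hcl z hz z' hz' hzz
  have hbz := (mem_freeNbrs.1 hz).1
  have hbz' := (mem_freeNbrs.1 hz').1
  have hpair : ∃ w, w ∈ freeNbrs G {o} b ∧ G.Adj x w ∧ x ∈ freeNbrs G {o} b := by
    by_cases hxz : x = z
    · exact ⟨z', hz', hxz ▸ hzz', hxz ▸ hz⟩
    by_cases hxz' : x = z'
    · exact ⟨z, hz, hxz' ▸ hzz'.symm, hxz' ▸ hz'⟩
    exact absurd (hasEaredClique_three hzz' hbz.symm hbz'.symm
      ((h.near hx hxA hz).resolve_left hxz) ((h.near hx hxA hz').resolve_left hxz') hxb) hfree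
  obtain ⟨w, hw, hxw, hxN⟩ := hpair
  have hbw := (mem_freeNbrs.1 hw).1
  have hbx := (mem_freeNbrs.1 hxN).1
  have hwo : w ≠ o := by
    have := (mem_freeNbrs.1 hw).2
    simpa using this
  have hwr : w ≠ r := by
    rintro rfl
    exact hnrb hbw.symm
  have hNx : ∀ z, G.Adj x z → z = r ∨ z = b ∨ z = w := by
    intro z hz
    have := mem_of_adj_of_degree_le (G := G) (v := x) (T := {r, b, w}) (w := z)
      (by simp [hx.symm, hbx.symm, hxw]) (by
        rw [Finset.card_insert_of_notMem (by simp [h.ne, hwr.symm]), Finset.card_pair hbw.ne]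
        omega) hz
    simpa using this
  have ho := h.degree_le_of_singleton (fun z hz => by
    by_contra hzA
    rcases h.near_of_missed hx hxA hmiss hz hzA hxN with e | e
    · exact hox (e ▸ hz)
    · rcases hNx z e with rfl | rfl | rfl
      · exact hzA h.r_mem
      · exact hzA h.b_mem
      · exact hfree (hasEaredClique_three hbw hbx hxw.symm hob hz hxo.symm))
  rw [hA] at ho
  have hwd : G.degree w ≤ 3 := (h.top_P o hoP w (by simpa using hwo)).trans ho
  have := h.card_edges_le_of_singleton hx hxA (by omega)
    (starAway G b ∅ ∪ starAway G x {b} ∪ starAway G w {x, b}) ?_ ?_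
  · have c1 := Finset.card_union_le (starAway G b ∅ ∪ starAway G x {b}) (starAway G w {x, b})
    have c2 := Finset.card_union_le (starAway G b ∅) (starAway G x {b})
    have c3 := card_starAway_le (G := G) (v := x) (T := {b}) (by simp [hbx.symm])
    have c4 := card_starAway_le (G := G) (v := w) (T := {x, b}) (by simp [hbw.symm, hxw.symm])
    rw [Finset.card_singleton] at c3
    rw [Finset.card_pair hxb] at c4
    omega
  · rintro u v huv (rfl | rfl)
    · exact Finset.mem_union_left _ (Finset.mem_union_left _ (mem_starAway huv (by simp)))
    · by_cases hvb : v = b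
      · rw [hvb, Sym2.eq_swap]
        exact Finset.mem_union_left _ (Finset.mem_union_left _
          (mem_starAway (hvb ▸ huv.symm) (by simp)))
      · exact Finset.mem_union_left _ (Finset.mem_union_right _
          (mem_starAway huv (by simp [hvb])))
  · have key : ∀ v, G.Adj w v → (v = r ∨ v = b ∨ v = x ∨ v = o) ∨
        s(w, v) ∈ starAway G b ∅ ∪ starAway G x {b} ∪ starAway G w {x, b} := by
      intro v hwv
      by_cases hv : v = r ∨ v = b ∨ v = x ∨ v = o
      · exact Or.inl hv
      · exact Or.inr (Finset.mem_union_right _ (mem_starAway hwv (fun hm => hv (by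
          simp only [Finset.mem_insert, Finset.mem_singleton] at hm
          exact Or.inr (hm.elim (fun e => Or.inr (Or.inl e)) Or.inl)))))
    have key2 : ∀ u v, G.Adj u v → (u = x ∨ G.Adj x u) → (u = r ∨ u = b ∨ u = x ∨ u = o) ∨
        (v = r ∨ v = b ∨ v = x ∨ v = o) ∨
        s(u, v) ∈ starAway G b ∅ ∪ starAway G x {b} ∪ starAway G w {x, b} := by
      rintro u v huv (e | e)
      · exact Or.inl (Or.inr (Or.inr (Or.inl e)))
      · rcases hNx u e with e | e | rfl
        · exact Or.inl (Or.inl e)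
        · exact Or.inl (Or.inr (Or.inl e))
        · exact Or.inr (key v huv)
    intro u v huv hK
    rcases h.edge_near hx hxA hxN huv hK with e | e
    · exact key2 u v huv e
    · rcases key2 v u huv.symm e with e | e | e
      · exact Or.inr (Or.inl e)
      · exact Or.inl e
      · exact Or.inr (Or.inr (by rwa [Sym2.eq_swap]))

/-- The core is empty, so deg o ≤ 3 and b has exactly two free neighbours y and y'. Since x would
belong to the core if it were free, N(x) = {r, y, y'}. Every edge then meets r, b, x or o, which
leaves at most 3 + 3 + 3 = 9. -/
theorem false_of_not_clique_of_not_hasEaredClique (h : StuckConfig G A {o} K ∅ r b) (hx : G.Adj r x)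
    (hxA : x ∉ A) (hd : 2 ≤ G.degree b) (hdr : 3 ≤ G.degree r) (hA : A.card = 4)
    (he : 10 ≤ G.edgeFinset.card)
    (hfree : ¬ HasEaredClique G 3) (hcl : ¬ ∀ y ∈ freeNbrs G {o} b, ∀ y' ∈ freeNbrs G {o} b, y ≠ y' → G.Adj y y') : False := by
  have hoP := Finset.mem_singleton_self o
  have hoA := h.subset hoP
  have hnb := h.card_freeNbrs
  rw [Finset.card_singleton] at hnb
  have hmiss := h.missed_of_singleton hx hxA
  have hox := (mem_missed.1 hmiss).2
  have hro : r ≠ o := fun e => h.r_not (by simp [e])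
  have hbo : b ≠ o := fun e => h.b_not (by simp [e])
  have hxo : x ≠ o := fun e => hxA (e ▸ hoA)
  have hxb : x ≠ b := fun e => hxA (e ▸ h.b_mem)
  have hxr : x ≠ r := fun e => hxA (e ▸ h.r_mem)
  have hob : G.Adj o b := h.join o hoP b h.b_mem hbo.symm
  have hor : G.Adj o r := h.join o hoP r h.r_mem hro.symm
  have hnrb := h.stuck.not_adj
  have hxd := h.top x hxA
  have hsb := card_starAway_le (G := G) (v := b) (T := ∅) (by simp)
  rw [Finset.card_empty] at hsb
  push Not at hcl
  obtain ⟨y, hy, y', hy', hne, hnadj⟩ := hcl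
  have hcore := card_core_of_not_hasEaredClique (k := 0) hy hy' hne hnadj hfree
  have ho := h.degree_le_of_not_clique hx hxA hy hy' hne hnadj hmiss
  have hm1 : (missed G {o} x).card ≤ 1 := card_missed_le
  have hbd := h.top_P o hoP b h.b_not
  have h2 := Finset.one_lt_card.2 ⟨y, hy, y', hy', hne⟩
  have hnbeq : freeNbrs G {o} b = {y, y'} := by
    refine (Finset.eq_of_subset_of_card_le ?_ ?_).symm
    · intro z hz
      simp only [Finset.mem_insert, Finset.mem_singleton] at hz
      rcases hz with rfl | rfl
      · exact hy
      · exact hy'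
    · rw [Finset.card_pair hne]
      omega
  have hby := (mem_freeNbrs.1 hy).1
  have hby' := (mem_freeNbrs.1 hy').1
  have hxN : x ∉ freeNbrs G {o} b := by
    intro e
    have : x ∈ core G {o} b := Finset.mem_filter.2 ⟨e, fun z hz =>
      (h.near hx hxA hz).imp id fun e => e.symm⟩
    have := Finset.card_pos.2 ⟨x, this⟩
    omega
  have hxy : G.Adj x y := (h.near hx hxA hy).resolve_left (fun e => hxN (e ▸ hy))
  have hxy' : G.Adj x y' := (h.near hx hxA hy').resolve_left (fun e => hxN (e ▸ hy'))
  have hyr : y ≠ r := by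
    rintro rfl
    exact hnrb hby.symm
  have hyr' : y' ≠ r := by
    rintro rfl
    exact hnrb hby'.symm
  have hNx : ∀ z, G.Adj x z → z = r ∨ z = y ∨ z = y' := by
    intro z hz
    have := mem_of_adj_of_degree_le (G := G) (v := x) (T := {r, y, y'}) (w := z)
      (by simp [hx.symm, hxy, hxy']) (by
        rw [Finset.card_insert_of_notMem (by simp [hyr.symm, hyr'.symm]), Finset.card_pair hne]
        omega) hz
    simpa using this
  have key : ∀ y y' z, y ∈ freeNbrs G {o} b → y' ∈ freeNbrs G {o} b → y ≠ y' → ¬ G.Adj y y' →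
      (∀ z, G.Adj x z → z = r ∨ z = y ∨ z = y') →
      G.Adj y z → z = r ∨ z = b ∨ z = x ∨ z = o := by
    intro y y' z hy hy' hne hnadj hNx hyz
    by_cases hK : s(z, y) ∈ K
    · have := h.free_nbr y z (mem_freeNbrs.1 hy).1 (mem_freeNbrs.1 hy).2 hK
      rw [Finset.mem_singleton] at this
      exact this.elim (fun e => Or.inr (Or.inr (Or.inr e))) Or.inl
    · rcases h.edge_near hx hxA hy' hyz.symm hK with (e | e) | e | e
      · exact Or.inr (Or.inr (Or.inl e))
      · rcases hNx z e with e | e | e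
        · exact Or.inl e
        · exact absurd e hyz.ne'
        · exact absurd (e ▸ hyz) hnadj
      · exact absurd e hne
      · exact absurd e.symm hnadj
  have key2 : ∀ u v, G.Adj u v → (u = x ∨ G.Adj x u) → (u = r ∨ u = b ∨ u = x ∨ u = o) ∨
      (v = r ∨ v = b ∨ v = x ∨ v = o) := by
    rintro u v huv (e | e)
    · exact Or.inl (Or.inr (Or.inr (Or.inl e)))
    · rcases hNx u e with e | e | e
      · exact Or.inl (Or.inl e)
      · exact Or.inr (key y y' v hy hy' hne hnadj hNx (e ▸ huv))
      · exact Or.inr (key y' y v hy' hy hne.symm (fun e => hnadj e.symm)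
          (fun z hz => (hNx z hz).imp id Or.symm) (e ▸ huv))
  have := h.card_edges_le_of_singleton hx hxA (by omega)
    (starAway G b ∅ ∪ starAway G x ∅) ?_ ?_
  · have c1 := Finset.card_union_le (starAway G b ∅) (starAway G x ∅)
    have c2 := card_starAway_le (G := G) (v := x) (T := ∅) (by simp)
    rw [Finset.card_empty] at c2
    omega
  · rintro u v huv (rfl | rfl)
    · exact Finset.mem_union_left _ (mem_starAway huv (by simp))
    · exact Finset.mem_union_right _ (mem_starAway huv (by simp))
  · intro u v huv hK
    rcases h.no_far_edge hx hxA hy hy' hne hnadj huv hK with e | e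
    · exact (key2 u v huv e).imp id Or.inl
    · exact (key2 v u huv.symm e).elim (fun e => Or.inr (Or.inl e)) Or.inl


theorem false_of_not_hasEaredClique_three (h : StuckConfig G A {o} K ∅ r b) (hx : G.Adj r x)
    (hxA : x ∉ A) (hd : 2 ≤ G.degree b) (hdr : 3 ≤ G.degree r) (hA : A.card = 4)
    (he : 10 ≤ G.edgeFinset.card) (hfree : ¬ HasEaredClique G 3)
    (hr : ∀ y ∈ A, y ≠ o → G.degree y ≤ G.degree r) : False := by
  by_cases hcl : ∀ y ∈ freeNbrs G {o} b, ∀ y' ∈ freeNbrs G {o} b, y ≠ y' → G.Adj y y'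
  · by_cases h2 : (freeNbrs G {o} b).card ≤ 1
    · exact h.false_of_card_freeNbrs_le_one hx hxA hd hdr hA he hr h2
    · exact h.false_of_clique_of_not_hasEaredClique hx hxA hd hdr hA he hfree hcl (by omega)
  · exact h.false_of_not_clique_of_not_hasEaredClique hx hxA hd hdr hA he hfree hcl

end StuckConfig

variable {n : ℕ} {G₀ : SimpleGraph (Fin n)}

theorem initial_one (hn : 0 < n) : initial n 1 = {⟨0, hn⟩} := by
  ext i
  rw [mem_initial, Finset.mem_singleton, Fin.ext_iff]
  simp only
  omega

theorem exists_joinedTo_one (hd : Antitone fun i => G₀.degree i) {k : ℕ} (hk : 2 ≤ k)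
    (hkn : k ≤ n) (h0 : k - 1 ≤ G₀.degree ⟨0, by omega⟩) :
    ∃ G, SameDegrees G₀ G ∧ JoinedTo G (initial n 1) (initial n k) := by
  refine exists_joinedTo_initial hd (by omega) hkn (fun i hi => ?_) ?_
  · rwa [(Fin.ext (by simp only; omega) : i = ⟨0, by omega⟩)]
  · intro j hj hj1 G K b x hG h hx hxA
    exact false_of_card_eq_zero h hx hxA (by rw [card_initial hj.le]; omega)

theorem exists_target_three (hn : 6 ≤ n) (hd : Antitone fun i => G₀.degree i)
    (he : n ≤ G₀.edgeFinset.card) : ∃ G, SameDegrees G₀ G ∧ ¬ G.CliqueFree 3 := by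
  by_contra! hfree
  have h2 : 1 < G₀.degree ⟨2, by omega⟩ := by
    refine le_degree_of_card_edges hd (by omega) ?_
    simp only [Nat.choose, Nat.reduceAdd]
    omega
  have hdeg : ∀ i : Fin n, i.val ≤ 2 → 2 ≤ G₀.degree i := fun i hi =>
    h2.trans_le (hd (Fin.le_def.2 hi))
  obtain ⟨G, hG, hGj⟩ := exists_joinedTo_one hd (k := 3) (by omega) (by omega)
    (hdeg _ (by simp))
  have hn_adj : ∀ G, SameDegrees G₀ G → JoinedTo G (initial n 1) (initial n 3) →
      ¬ G.Adj ⟨1, by omega⟩ ⟨2, by omega⟩ := by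
    intro G hG hGj hadj
    refine hfree G hG {⟨0, by omega⟩, ⟨1, by omega⟩, ⟨2, by omega⟩}
      (SimpleGraph.is3Clique_triple_iff.2 ⟨?_, ?_, hadj⟩)
    · exact hGj _ (by simp [mem_initial]) _ (by simp [mem_initial]) (by simp)
    · exact hGj _ (by simp [mem_initial]) _ (by simp [mem_initial]) (by simp)
  have hr : ∀ y, G.Adj ⟨1, by omega⟩ y → y ∈ initial n 3 → y ∈ initial n 1 := by
    intro y hy hyA
    rw [mem_initial] at *
    by_contra hc
    rcases (by omega : y.val = 1 ∨ y.val = 2) with e | e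
    · exact hy.ne (Fin.ext e.symm)
    · exact hn_adj G hG hGj (by convert hy; exact e.symm)
  have hb : ∀ y, G.Adj ⟨2, by omega⟩ y → y ∈ initial n 3 → y ∈ initial n 1 := by
    intro y hy hyA
    rw [mem_initial] at *
    by_contra hc
    rcases (by omega : y.val = 2 ∨ y.val = 1) with e | e
    · exact hy.ne (Fin.ext e.symm)
    · exact hn_adj G hG hGj (by convert hy.symm; exact e.symm)
  have hcfg : StuckConfig G (initial n 3) (initial n 1)
      ({e | ∃ p ∈ initial n 1, ∃ a ∈ initial n 3, e = s(p, a)} ∪ (∅ : Finset (Sym2 (Fin n))))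
      ∅ ⟨1, by omega⟩ ⟨2, by omega⟩ :=
    stuckConfig_of_inner (initial_subset (by omega)) (by simp [mem_initial]) (by simp [mem_initial])
      (by simp [mem_initial]) (by simp [mem_initial]) (by simp) hG hGj
      (fun v hv a ha => degree_le_of_notMem_initial hd hv ha)
      (fun p hp v hv => degree_le_of_notMem_initial hd hv hp) (by simp) hb
      (fun G' hG' hj' _ => hn_adj G' hG' hj')
  obtain ⟨x, hx, hxA⟩ := exists_outer_nbr hr (by
    rw [card_initial (by omega), hG]; exact hdeg _ (by simp))
  rw [initial_one (by omega)] at hcfg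
  exact hcfg.false_of_cliqueFree_three hx hxA (by rw [hG]; exact hdeg _ (by simp))
    (card_initial (by omega)) (by rw [hG.card_edges]; omega) (hfree G hG)

/-- Joining two vertices to the first four already produces a triangle with an ear. For n ≥ 7 there
are at least 10 edges, one more than a stuck configuration permits. -/
theorem exists_target_four (hn : 7 ≤ n) (hd : Antitone fun i => G₀.degree i)
    (he : 3 * n ≤ 2 * G₀.edgeFinset.card + 2) : ∃ G, SameDegrees G₀ G ∧ HasEaredClique G 3 := by
  by_contra! hfree
  have h1 : 2 < G₀.degree ⟨1, by omega⟩ := le_degree_one hd (by omega) (by omega)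
  have h3 : 1 < G₀.degree ⟨3, by omega⟩ := by
    refine le_degree_of_card_edges hd (by omega) ?_
    simp only [Nat.choose, Nat.reduceAdd]
    omega
  obtain ⟨G₁, hG₁, hj₁⟩ := exists_joinedTo_one hd (k := 4) (by omega) (by omega)
    (h1.trans_le (hd (Fin.le_def.2 (by simp))))
  obtain ⟨G, hG, hGj⟩ := exists_joinedTo_initial_succ (hG₁.antitone hd) (by omega : 1 < 4)
    (by omega) hj₁ (by rw [hG₁]; exact h1) (by
      intro G K b x hG h hx hxA
      have hG := hG₁.trans hG
      rw [initial_one (by omega)] at h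
      refine h.false_of_not_hasEaredClique_three hx hxA ?_ (by rw [hG]; exact h1)
        (card_initial (by omega)) (by rw [hG.card_edges]; omega) (hfree G hG) ?_
      · rw [hG]
        have := mem_initial.1 h.b_mem
        exact h3.trans_le (hd (Fin.le_def.2 (by simp only; omega)))
      · intro y _ hy
        refine hG.antitone hd (Fin.le_def.2 ?_)
        rw [ne_eq, Fin.ext_iff] at hy
        simp only at *
        omega)
  have hadj : ∀ i j : Fin n, i.val < 2 → j.val < 4 → i.val ≠ j.val → G.Adj i j := fun i j hi hj hij =>
    hGj i (mem_initial.2 hi) j (mem_initial.2 hj) (fun e => hij (congrArg _ e))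
  refine hfree G (hG₁.trans hG) (hasEaredClique_three (a := ⟨0, by omega⟩) (b := ⟨1, by omega⟩)
    (c := ⟨2, by omega⟩) (w := ⟨3, by omega⟩) ?_ ?_ ?_ ?_ ?_ (by simp))
  · exact hadj _ _ (by simp) (by simp) (by simp)
  · exact hadj _ _ (by simp) (by simp) (by simp)
  · exact hadj _ _ (by simp) (by simp) (by simp)
  · exact (hadj _ _ (by simp) (by simp) (by simp)).symm
  · exact (hadj _ _ (by simp) (by simp) (by simp)).symm

end SmallRealizations

/-! ### Embedding 2-trees into the targets -/

section Embedding

open scoped Classical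

theorem isContained_of_not_cliqueFree {V : Type*} {G : SimpleGraph V} {k : ℕ}
    (h : ¬ G.CliqueFree k) (T : SimpleGraph (Fin k)) : T.IsContained G := by
  exact (SimpleGraph.IsContained.of_le le_top).trans
    ((SimpleGraph.not_cliqueFree_iff_top_isContained k).1 h)

/-- A 2-tree on at least four vertices is a clique with an ear, up to edges. -/
theorem IsTwoTree.isContained_of_hasEaredClique {W : Type*} [Fintype W] [DecidableEq W]
    {G : SimpleGraph W} {k : ℕ} (hk : 3 ≤ k) (hG : HasEaredClique G k) {T : SimpleGraph (Fin (k + 1))}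
    (hT : IsTwoTree T) : T.IsContained G := by
  obtain ⟨S, w, p, q, hS, hw, hp, hq, hpq, hwp, hwq⟩ := hG
  cases hT with
  | triangle _ e =>
    obtain ⟨e⟩ := e
    have := Fintype.card_congr e.toEquiv
    simp only [Fintype.card_fin] at this
    omega
  | ear _ v hdeg hadj hrec =>
    obtain ⟨a, b, hab, hN⟩ := Set.ncard_eq_two.1 hdeg
    have hNv : ∀ u, T.Adj v u → u = a ∨ u = b := fun u hu => by
      have : u ∈ T.neighborSet v := hu
      simpa [hN] using this
    have hav : a ≠ v := by
      have : a ∈ T.neighborSet v := by simp [hN]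
      exact (T.ne_of_adj this).symm
    have hbv : b ≠ v := by
      have : b ∈ T.neighborSet v := by simp [hN]
      exact (T.ne_of_adj this).symm
    have hwp' := hwp.ne
    have hwq' := hwq.ne
    -- The vertex v goes to the ear and its two neighbours to p and q. The rest is placed
    -- arbitrarily in the clique.
    obtain ⟨g, hg⟩ := Finset.exists_equiv_extend_of_card_eq (t := insert w S)
      (by rw [Finset.card_insert_of_notMem hw, hS.card_eq, Fintype.card_fin])
      (s := {v, a, b}) (f := fun u => if u = v then w else if u = a then p else q)
      (by
        intro y hy
        simp only [Finset.mem_image, Finset.mem_insert, Finset.mem_singleton] at hy ⊢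
        obtain ⟨u, -, rfl⟩ := hy
        split_ifs
        · exact Or.inl rfl
        · exact Or.inr hp
        · exact Or.inr hq)
      (by
        intro u hu u' hu' h
        simp only [Finset.coe_insert, Finset.coe_singleton, Set.mem_insert_iff,
          Set.mem_singleton_iff] at hu hu'
        rcases hu with rfl | rfl | rfl <;> rcases hu' with rfl | rfl | rfl <;>
          simp_all [Ne.symm])
    have hgv : (g v : W) = w := by rw [hg v (by simp)]; simp
    have hga : (g a : W) = p := by rw [hg a (by simp)]; simp [hav]
    have hgb : (g b : W) = q := by rw [hg b (by simp)]; simp [hbv, hab.symm]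
    have hinj : Function.Injective fun u => (g u : W) :=
      Subtype.val_injective.comp g.injective
    have hvadj : ∀ u, T.Adj v u → G.Adj (g v) (g u) := by
      intro u hu
      rw [hgv]
      rcases hNv u hu with rfl | rfl
      · rwa [hga]
      · rwa [hgb]
    have hmem : ∀ u, u ≠ v → (g u : W) ∈ S := by
      intro u hu
      refine (Finset.mem_insert.1 (g u).2).resolve_left fun e => hu (hinj ?_)
      simp only [e, hgv]
    refine ⟨⟨⟨fun u => g u, ?_⟩, hinj⟩⟩
    intro u u' huu
    by_cases hu : u = v
    · subst hu; exact hvadj u' huu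
    by_cases hu' : u' = v
    · subst hu'; exact (hvadj u huu.symm).symm
    exact hS.isClique (hmem u hu) (hmem u' hu') (fun e => huu.ne (hinj e))

/-- The edge lists of the 2-trees on `{0, …, j + 2}` that arise by adding the vertices in order. -/
def earLists : ℕ → List (List (ℕ × ℕ))
  | 0 => [[(0, 1), (0, 2), (1, 2)]]
  | j + 1 => (earLists j).flatMap fun l => l.map fun e => (e.1, j + 3) :: (e.2, j + 3) :: l

theorem IsTwoTree.exists_earList {V : Type} {T : SimpleGraph V} (hT : IsTwoTree T) :
    ∃ j, ∃ l ∈ earLists j, ∃ f : V → ℕ, Function.Injective f ∧ Set.range f = Set.Iio (j + 3) ∧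
      ∀ u v, T.Adj u v → (f u, f v) ∈ l ∨ (f v, f u) ∈ l := by
  induction hT with
  | triangle G e =>
    obtain ⟨e⟩ := e
    refine ⟨0, _, List.mem_singleton_self _, fun v => (e v).val,
      Fin.val_injective.comp e.injective, ?_, ?_⟩
    · ext x
      constructor
      · rintro ⟨v, rfl⟩
        exact (e v).isLt
      · intro hx
        exact ⟨e.symm ⟨x, hx⟩, by simp⟩
    · intro u v huv
      have key : ∀ a b : Fin 3, a ≠ b → (a.val, b.val) ∈ [(0, 1), (0, 2), (1, 2)] ∨
          (b.val, a.val) ∈ [(0, 1), (0, 2), (1, 2)] := by decide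
      exact key _ _ (fun h => huv.ne (e.injective h))
  | ear G v hdeg hadj hrec ih =>
    obtain ⟨j, l, hl, f, hf, hr, hfl⟩ := ih
    obtain ⟨a, b, hab, hN⟩ := Set.ncard_eq_two.1 hdeg
    have ha : G.Adj v a := by
      have : a ∈ G.neighborSet v := by simp [hN]
      exact this
    have hb : G.Adj v b := by
      have : b ∈ G.neighborSet v := by simp [hN]
      exact this
    have hGab : G.Adj a b := hadj ha hb hab
    have hlt : ∀ u, f u < j + 3 := fun u => by
      have : f u ∈ Set.Iio (j + 3) := hr ▸ Set.mem_range_self u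
      exact this
    -- The two neighbours of v are adjacent in G - v, so they correspond to an entry e of the list;
    -- v receives the next label j + 3.
    have he : ∃ e ∈ l, ∀ u (hu : u ≠ v), G.Adj v u → f ⟨u, hu⟩ = e.1 ∨ f ⟨u, hu⟩ = e.2 := by
      have hvu : ∀ u, G.Adj v u → u = a ∨ u = b := fun u hu => by
        have : u ∈ G.neighborSet v := hu
        simpa [hN] using this
      rcases hfl ⟨a, ha.ne'⟩ ⟨b, hb.ne'⟩ hGab with h | h
      · refine ⟨_, h, fun u hu huv => ?_⟩
        rcases hvu u huv with rfl | rfl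
        · exact Or.inl rfl
        · exact Or.inr rfl
      · refine ⟨_, h, fun u hu huv => ?_⟩
        rcases hvu u huv with rfl | rfl
        · exact Or.inr rfl
        · exact Or.inl rfl
    obtain ⟨e, hel, he⟩ := he
    refine ⟨j + 1, (e.1, j + 3) :: (e.2, j + 3) :: l, List.mem_flatMap.2 ⟨l, hl,
      List.mem_map.2 ⟨e, hel, rfl⟩⟩, fun u => if h : u = v then j + 3 else f ⟨u, h⟩, ?_, ?_, ?_⟩
    · intro u u' h
      simp only at h
      split_ifs at h with h1 h2 h2
      · rw [h1, h2]
      · exact absurd h (hlt _).ne'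
      · exact absurd h (hlt _).ne
      · exact congrArg Subtype.val (hf h)
    · ext x
      constructor
      · rintro ⟨u, rfl⟩
        simp only [Set.mem_Iio]
        split_ifs
        · omega
        · exact (hlt _).trans (by omega)
      · intro hx
        rcases Nat.lt_succ_iff_lt_or_eq.1 (Set.mem_Iio.1 hx) with h | h
        · have : x ∈ Set.range f := by rw [hr]; exact h
          obtain ⟨u, rfl⟩ := this
          exact ⟨u.1, dif_neg u.2⟩
        · exact ⟨v, by simp only [dif_pos]; omega⟩
    · have key : ∀ u (hu : u ≠ v), G.Adj v u →
          (f ⟨u, hu⟩, j + 3) ∈ (e.1, j + 3) :: (e.2, j + 3) :: l := by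
        intro u hu huv
        rcases he u hu huv with h | h
        · rw [h]; simp
        · rw [h]; simp
      intro u u' huu
      by_cases h1 : u = v
      · subst h1
        simp only [dif_pos, dif_neg huu.ne']
        exact Or.inr (key u' huu.ne' huu)
      · by_cases h2 : u' = v
        · subst h2
          simp only [dif_pos, dif_neg huu.ne]
          exact Or.inl (key u huu.ne huu.symm)
        · simp only [dif_neg h1, dif_neg h2]
          exact (hfl ⟨u, h1⟩ ⟨u', h2⟩ huu).imp (fun h => by simp [h]) (fun h => by simp [h])

/-- No edge in the list `l` joins the entries of `c` at a pair of positions from `I`. -/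
def avoids (I : List (Fin 4 × Fin 4)) (l : List (ℕ × ℕ)) (c : List ℕ) : Bool :=
  I.all fun p => l.all fun e =>
    !((c.getD p.1 0).beq e.1 && (c.getD p.2 0).beq e.2 ||
      (c.getD p.2 0).beq e.1 && (c.getD p.1 0).beq e.2)

/-- The non-edges of two disjoint edges on four vertices. -/
def matchingPairs : List (Fin 4 × Fin 4) := [(0, 2), (0, 3), (1, 2), (1, 3)]

/-- The non-edges of a path with two edges and an isolated vertex. -/
def pathPairs : List (Fin 4 × Fin 4) := [(1, 2), (0, 3), (1, 3), (2, 3)]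

theorem exists_avoids_matchingPairs : ∀ l ∈ earLists 4, ∃ c : List ℕ, c.length = 4 ∧ c.Nodup ∧
    (∀ x ∈ c, x < 7) ∧ avoids matchingPairs l c = true := by
  -- These quadruples suffice for all 945 edge lists. The order matters: the first two and the last
  -- two entries are the pairs allowed to be adjacent.
  have h : ((earLists 4).all fun l => [[3, 4, 5, 6], [3, 5, 4, 6], [3, 6, 4, 5], [0, 1, 5, 6],
      [2, 4, 5, 6], [0, 5, 4, 6], [2, 3, 5, 6], [1, 6, 4, 5], [0, 6, 4, 5], [1, 2, 4, 6],
      [0, 3, 4, 5], [0, 4, 5, 6], [1, 3, 4, 5], [0, 2, 4, 5], [1, 4, 5, 6], [1, 5, 4, 6]].any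
      fun c => c.length == 4 && (decide c.Nodup && ((c.all fun x => decide (x < 7)) &&
        avoids matchingPairs l c))) = true := by decide +kernel
  intro l hl
  obtain ⟨c, -, hc⟩ := List.any_eq_true.1 (List.all_eq_true.1 h l hl)
  simp only [Bool.and_eq_true, beq_iff_eq, decide_eq_true_eq, List.all_eq_true] at hc
  exact ⟨c, hc⟩

theorem exists_avoids_pathPairs : ∀ l ∈ earLists 4, ∃ c : List ℕ, c.length = 4 ∧ c.Nodup ∧
    (∀ x ∈ c, x < 7) ∧ avoids pathPairs l c = true := by
  -- Here the first entry is the centre of the path, the next two are its ends and the last is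
  -- isolated.
  have h : ((earLists 4).all fun l => [[3, 4, 5, 6], [4, 5, 6, 3], [6, 3, 5, 4], [4, 5, 6, 0],
      [5, 4, 6, 1], [5, 4, 6, 2], [4, 1, 6, 5], [5, 0, 6, 4], [4, 2, 6, 5], [1, 2, 3, 6],
      [2, 1, 3, 6], [1, 0, 3, 6], [4, 0, 5, 6], [5, 1, 6, 4], [0, 3, 4, 6], [1, 2, 6, 5],
      [5, 2, 6, 4], [1, 3, 6, 5], [4, 1, 5, 6], [4, 0, 6, 5], [1, 3, 5, 6], [0, 2, 6, 5]].any
      fun c => c.length == 4 && (decide c.Nodup && ((c.all fun x => decide (x < 7)) &&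
        avoids pathPairs l c))) = true := by decide +kernel
  intro l hl
  obtain ⟨c, -, hc⟩ := List.any_eq_true.1 (List.all_eq_true.1 h l hl)
  simp only [Bool.and_eq_true, beq_iff_eq, decide_eq_true_eq, List.all_eq_true] at hc
  exact ⟨c, hc⟩

theorem IsTwoTree.exists_four {T : SimpleGraph (Fin 7)} (hT : IsTwoTree T)
    {I : List (Fin 4 × Fin 4)} (hI : ∀ l ∈ earLists 4, ∃ c : List ℕ, c.length = 4 ∧ c.Nodup ∧
      (∀ x ∈ c, x < 7) ∧ avoids I l c = true) :
    ∃ g : Fin 4 → Fin 7, Function.Injective g ∧ ∀ p ∈ I, ¬ T.Adj (g p.1) (g p.2) := by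
  obtain ⟨j, l, hl, f, hf, hr, hfl⟩ := hT.exists_earList
  have hj : j = 4 := by
    have h1 := Set.ncard_range_of_injective hf
    rw [hr, Set.ncard_Iio_nat] at h1
    simpa using h1
  subst hj
  obtain ⟨c, hc4, hcn, hc7, hav⟩ := hI l hl
  have hex : ∀ i : Fin 4, ∃ u, f u = c.getD i 0 := by
    intro i
    have : c.getD i 0 ∈ Set.range f := by
      rw [hr, Set.mem_Iio, List.getD_eq_getElem _ _ (by omega)]
      exact hc7 _ (List.getElem_mem _)
    exact this
  choose g hg using hex
  refine ⟨g, ?_, ?_⟩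
  · intro i i' h
    have h2 : c.getD i 0 = c.getD i' 0 := by rw [← hg, ← hg, h]
    rw [List.getD_eq_getElem _ _ (by omega), List.getD_eq_getElem _ _ (by omega),
      hcn.getElem_inj_iff] at h2
    exact Fin.ext h2
  · intro p hp hadj
    have h := fun e he => List.all_eq_true.1 (List.all_eq_true.1 hav p hp) e he
    rcases hfl _ _ hadj with e | e
    · have := h _ e
      simp [hg] at this
    · have := h _ e
      simp [hg] at this

/-- The four chosen vertices of the 2-tree go to C in the order given by h, and the other three go
to P. Edges touching P are free, and those inside C avoid the pairs in I. -/
theorem isContained_of_joinedTo {V : Type*} [Fintype V] [DecidableEq V] {G : SimpleGraph V}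
    {P C : Finset V} (hP : P.card = 3) (hC : C.card = 4) (hPC : Disjoint P C)
    (hG : JoinedTo G P (P ∪ C)) {I : List (Fin 4 × Fin 4)} {h : Fin 4 → V}
    (hinj : Function.Injective h) (hh : ∀ i, h i ∈ C)
    (hadj : ∀ i j, i ≠ j → (i, j) ∉ I → (j, i) ∉ I → G.Adj (h i) (h j)) {T : SimpleGraph (Fin 7)}
    {g : Fin 4 → Fin 7} (hg : Function.Injective g) (hgI : ∀ p ∈ I, ¬ T.Adj (g p.1) (g p.2)) :
    T.IsContained G := by
  have hhC : Finset.univ.image h = C := by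
    refine Finset.eq_of_subset_of_card_le ?_ ?_
    · intro y hy
      obtain ⟨i, -, rfl⟩ := Finset.mem_image.1 hy
      exact hh i
    · rw [Finset.card_image_of_injective _ hinj, hC]
      simp
  obtain ⟨φ, hφ⟩ := Finset.exists_equiv_extend_of_card_eq (t := P ∪ C)
    (by rw [Finset.card_union_of_disjoint hPC, hP, hC, Fintype.card_fin])
    (s := Finset.univ.image g) (f := Function.extend g h fun _ => h 0)
    (by
      intro y hy
      simp only [Finset.mem_image, Finset.mem_univ, true_and] at hy
      obtain ⟨-, ⟨i, rfl⟩, rfl⟩ := hy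
      rw [hg.extend_apply]
      exact Finset.mem_union_right _ (hh i))
    (by
      intro u hu u' hu' e
      simp only [Finset.coe_image, Finset.coe_univ, Set.image_univ, Set.mem_range] at hu hu'
      obtain ⟨i, rfl⟩ := hu
      obtain ⟨i', rfl⟩ := hu'
      rw [hg.extend_apply, hg.extend_apply] at e
      rw [hinj e])
  have hφg : ∀ i, (φ (g i) : V) = h i := by
    intro i
    rw [hφ _ (Finset.mem_image_of_mem _ (Finset.mem_univ _)), hg.extend_apply]
  have hφinj : Function.Injective fun u => (φ u : V) := Subtype.val_injective.comp φ.injective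
  have hmem : ∀ u, (∀ i, u ≠ g i) → (φ u : V) ∈ P := by
    intro u hu
    refine (Finset.mem_union.1 (φ u).2).resolve_right fun hc => ?_
    obtain ⟨i, -, hi⟩ := Finset.mem_image.1 (hhC.ge hc)
    exact hu i (hφinj (by simp only [hφg, hi]))
  refine ⟨⟨⟨fun u => φ u, ?_⟩, hφinj⟩⟩
  intro u v huv
  have hne : (φ u : V) ≠ φ v := fun e => huv.ne (hφinj e)
  by_cases hu : ∀ i, u ≠ g i
  · exact hG _ (hmem u hu) _ (φ v).2 hne
  by_cases hv : ∀ i, v ≠ g i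
  · exact (hG _ (hmem v hv) _ (φ u).2 hne.symm).symm
  push Not at hu hv
  obtain ⟨i, rfl⟩ := hu
  obtain ⟨j, rfl⟩ := hv
  simp only [hφg]
  exact hadj i j (fun e => huv.ne (congrArg g e)) (fun e => hgI _ e huv)
    (fun e => hgI _ e huv.symm)

/-- Two distinct edges are disjoint or share exactly one end; these two patterns match
`matchingPairs` and `pathPairs`. -/
theorem HasTwoEdgeJoin.exists_pattern {V : Type*} [Fintype V] [DecidableEq V] {G : SimpleGraph V}
    {C : Finset V} (hC : C.card = 4) (he : 2 ≤ (edgesIn G C).card) :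
    ∃ h : Fin 4 → V, Function.Injective h ∧ (∀ i, h i ∈ C) ∧
      ((G.Adj (h 0) (h 1) ∧ G.Adj (h 2) (h 3)) ∨ (G.Adj (h 0) (h 1) ∧ G.Adj (h 0) (h 2))) := by
  have path : ∀ a b c, G.Adj a b → G.Adj a c → a ∈ C → b ∈ C → c ∈ C → b ≠ c →
      ∃ h : Fin 4 → V, Function.Injective h ∧ (∀ i, h i ∈ C) ∧
      ((G.Adj (h 0) (h 1) ∧ G.Adj (h 2) (h 3)) ∨ (G.Adj (h 0) (h 1) ∧ G.Adj (h 0) (h 2))) := by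
    intro a b c hab hac ha hb hc hbc
    obtain ⟨d, hd⟩ : (C \ {a, b, c}).Nonempty := by
      rw [← Finset.card_pos]
      have := Finset.le_card_sdiff {a, b, c} C
      have := Finset.card_le_three (a := a) (b := b) (c := c)
      omega
    simp only [Finset.mem_sdiff, Finset.mem_insert, Finset.mem_singleton, not_or] at hd
    obtain ⟨hdC, hda, hdb, hdc⟩ := hd
    refine ⟨![a, b, c, d], ?_, ?_, Or.inr ⟨hab, hac⟩⟩
    · intro i j hij
      have h1 := hab.ne
      have h2 := hac.ne
      fin_cases i <;> fin_cases j <;> simp_all [Ne.symm, eq_comm]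
    · intro i
      fin_cases i <;> simp_all
  obtain ⟨e, he1, e', he2, hee⟩ := Finset.one_lt_card.1 (by omega : 1 < (edgesIn G C).card)
  induction e using Sym2.ind with
  | _ a b =>
  induction e' using Sym2.ind with
  | _ c d =>
  obtain ⟨hab, ha, hb⟩ := mem_edgesIn.1 he1
  obtain ⟨hcd, hc, hd⟩ := mem_edgesIn.1 he2
  by_cases hac : a = c
  · subst hac
    exact path a b d hab hcd ha hb hd (fun e => hee (by rw [e]))
  by_cases had : a = d
  · subst had
    exact path a b c hab hcd.symm ha hb hc (fun e => hee (by rw [e, Sym2.eq_swap]))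
  by_cases hbc : b = c
  · subst hbc
    exact path b a d hab.symm hcd hb ha hd (fun e => hee (by rw [e, Sym2.eq_swap]))
  by_cases hbd : b = d
  · subst hbd
    exact path b a c hab.symm hcd.symm hb ha hc (fun e => hee (by rw [e]))
  refine ⟨![a, b, c, d], ?_, ?_, Or.inl ⟨hab, hcd⟩⟩
  · intro i j hij
    have h1 := hab.ne
    have h2 := hcd.ne
    fin_cases i <;> fin_cases j <;> simp_all [Ne.symm, eq_comm]
  · intro i
    fin_cases i <;> simp_all

theorem IsTwoTree.isContained_of_hasTwoEdgeJoin {V : Type*} [Fintype V] [DecidableEq V]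
    {G : SimpleGraph V} (hG : HasTwoEdgeJoin G) {T : SimpleGraph (Fin 7)} (hT : IsTwoTree T) :
    T.IsContained G := by
  obtain ⟨P, C, hP, hC, hPC, hj, he⟩ := hG
  obtain ⟨h, hinj, hh, ⟨h1, h2⟩ | ⟨h1, h2⟩⟩ := HasTwoEdgeJoin.exists_pattern hC he
  · obtain ⟨g, hg, hgI⟩ := hT.exists_four exists_avoids_matchingPairs
    refine isContained_of_joinedTo hP hC hPC hj hinj hh ?_ hg hgI
    intro i j
    fin_cases i <;> fin_cases j <;> simp [matchingPairs, h1, h2, h1.symm, h2.symm]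
  · obtain ⟨g, hg, hgI⟩ := hT.exists_four exists_avoids_pathPairs
    refine isContained_of_joinedTo hP hC hPC hj hinj hh ?_ hg hgI
    intro i j
    fin_cases i <;> fin_cases j <;> simp [pathPairs, h1, h2, h1.symm, h2.symm]

end Embedding

/-! ### Extremal sequences -/

section Sharpness

open scoped Classical

/-- Two adjacent vertices `a` and `b`, joined to all other vertices. -/
def book {V : Type} (a b : V) : SimpleGraph V where
  Adj u v := u ≠ v ∧ (u = a ∨ u = b ∨ v = a ∨ v = b)
  symm.symm u v h := ⟨h.1.symm, by tauto⟩
  loopless.irrefl _ h := h.1 rfl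

/-- Every vertex other than a and b has exactly the adjacent neighbours a and b, and removing it
leaves a smaller book. -/
theorem isTwoTree_book (m : ℕ) : ∀ {V : Type} [Finite V] (a b : V), a ≠ b → Nat.card V = m + 3 →
    IsTwoTree (book a b) := by
  induction m with
  | zero =>
    intro V _ a b hab hV
    have hfin := Fintype.ofFinite V
    rw [Nat.card_eq_fintype_card] at hV
    refine IsTwoTree.triangle _ ⟨⟨Fintype.equivFinOfCardEq hV, ?_⟩⟩
    intro u v
    simp only [SimpleGraph.top_adj, ne_eq, EmbeddingLike.apply_eq_iff_eq]
    refine ⟨fun huv => ⟨huv, ?_⟩, fun h => h.1⟩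
    by_contra! hc
    have := Finset.card_le_univ ({u, v, a, b} : Finset V)
    rw [Finset.card_insert_of_notMem (by simp [huv, hc]), Finset.card_insert_of_notMem
      (by simp [hc]), Finset.card_pair hab] at this
    omega
  | succ m ih =>
    intro V _ a b hab hV
    have hfin := Fintype.ofFinite V
    obtain ⟨v, hv⟩ : ∃ v, v ∉ ({a, b} : Finset V) := by
      by_contra! hc
      have := Finset.card_le_card (fun v _ => hc v : Finset.univ ⊆ ({a, b} : Finset V))
      rw [Finset.card_univ, ← Nat.card_eq_fintype_card, hV, Finset.card_pair hab] at this
      omega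
    simp only [Finset.mem_insert, Finset.mem_singleton, not_or] at hv
    have hN : (book a b).neighborSet v = {a, b} := by
      ext u
      simp only [book, SimpleGraph.mem_neighborSet, Set.mem_insert_iff, Set.mem_singleton_iff]
      constructor
      · rintro ⟨-, h⟩
        tauto
      · rintro (rfl | rfl)
        · exact ⟨hv.1, by tauto⟩
        · exact ⟨hv.2, by tauto⟩
    refine IsTwoTree.ear _ v (by rw [hN, Set.ncard_pair hab]) ?_ ?_
    · rw [hN]
      rintro u (rfl | rfl) w _ huw
      · exact ⟨huw, Or.inl rfl⟩
      · exact ⟨huw, Or.inr (Or.inl rfl)⟩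
    · have hc : Nat.card ({v}ᶜ : Set V) = m + 3 := by
        have := Set.ncard_add_ncard_compl {v}
        rw [Set.ncard_singleton, hV] at this
        rw [Nat.card_coe_set_eq]
        omega
      have := ih (V := ({v}ᶜ : Set V)) ⟨a, Ne.symm hv.1⟩ ⟨b, Ne.symm hv.2⟩
        (fun e => hab (congrArg Subtype.val e)) hc
      convert this using 1
      ext u w
      simp only [book, SimpleGraph.comap_adj, Function.Embedding.subtype_apply, ne_eq,
        Subtype.ext_iff]

theorem le_degree_of_forall_adj {n k : ℕ} {G : SimpleGraph (Fin n)} {T : SimpleGraph (Fin k)}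
    (φ : T.Copy G) {a : Fin k} (ha : ∀ u, u ≠ a → T.Adj a u) : k - 1 ≤ G.degree (φ a) := by
  have hsub : (Finset.univ.erase a).image φ ⊆ G.neighborFinset (φ a) := by
    intro y hy
    obtain ⟨u, hu, rfl⟩ := Finset.mem_image.1 hy
    rw [SimpleGraph.mem_neighborFinset]
    exact φ.toHom.map_adj (ha u (Finset.ne_of_mem_erase hu))
  have := Finset.card_le_card hsub
  rwa [Finset.card_image_of_injective (f := (φ : Fin k → Fin n)) _ φ.injective, Finset.card_erase_of_mem (Finset.mem_univ _),
    Finset.card_univ, Fintype.card_fin, SimpleGraph.card_neighborFinset_eq_degree] at this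

/-- A copy of the book would supply two distinct vertices of degree at least k - 1. -/
theorem not_hasTwoTreeRealization {n k : ℕ} (hk : 3 ≤ k) {π : Fin n → ℕ}
    (h : ∀ i j, k - 1 ≤ π i → k - 1 ≤ π j → i = j) : ¬ HasTwoTreeRealization k π := by
  rintro ⟨G, hG, hT⟩
  set a : Fin k := ⟨0, by omega⟩
  set b : Fin k := ⟨1, by omega⟩
  have hab : a ≠ b := by simp [a, b]
  obtain ⟨φ⟩ := hT (book a b) (isTwoTree_book (k - 3) a b hab (by
    rw [Nat.card_eq_fintype_card, Fintype.card_fin]; omega))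
  have ha := le_degree_of_forall_adj φ (a := a) fun u hu => ⟨hu.symm, Or.inl rfl⟩
  have hb := le_degree_of_forall_adj φ (a := b) fun u hu => ⟨hu.symm, Or.inr (Or.inl rfl)⟩
  rw [hG] at ha hb
  exact hab (φ.injective (h _ _ ha hb))

/-- The graph obtained from `H` by adding a first vertex adjacent to all others. -/
def cone {m : ℕ} (H : SimpleGraph (Fin m)) : SimpleGraph (Fin (m + 1)) where
  Adj i j := i ≠ j ∧ ∀ i' j', i = Fin.succ i' → j = Fin.succ j' → H.Adj i' j'
  symm.symm _ _ h := ⟨h.1.symm, fun i' j' hi hj => (h.2 j' i' hj hi).symm⟩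
  loopless.irrefl _ h := h.1 rfl

theorem degree_cone_zero {m : ℕ} (H : SimpleGraph (Fin m)) : (cone H).degree 0 = m := by
  have : (cone H).neighborFinset 0 = Finset.univ.erase 0 := by
    ext j
    simp only [SimpleGraph.mem_neighborFinset, Finset.mem_erase, Finset.mem_univ, and_true]
    exact ⟨fun h => h.1.symm, fun h => ⟨h.symm, fun i' j' hi => absurd hi.symm (Fin.succ_ne_zero i')⟩⟩
  rw [← SimpleGraph.card_neighborFinset_eq_degree, this, Finset.card_erase_of_mem
    (Finset.mem_univ _), Finset.card_univ, Fintype.card_fin]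
  rfl

theorem degree_cone_succ {m : ℕ} (H : SimpleGraph (Fin m)) (i : Fin m) :
    (cone H).degree i.succ = H.degree i + 1 := by
  have : (cone H).neighborFinset i.succ = insert 0 ((H.neighborFinset i).image Fin.succ) := by
    ext j
    rw [SimpleGraph.mem_neighborFinset, Finset.mem_insert, Finset.mem_image]
    constructor
    · intro h
      refine (Fin.eq_zero_or_eq_succ j).imp id ?_
      rintro ⟨j', rfl⟩
      exact ⟨j', by simpa using h.2 i j' rfl rfl, rfl⟩
    · rintro (rfl | ⟨j', h, rfl⟩)
      · exact ⟨Fin.succ_ne_zero i, fun i' j' _ h => absurd h.symm (Fin.succ_ne_zero j')⟩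
      · rw [SimpleGraph.mem_neighborFinset] at h
        refine ⟨fun e => h.ne (Fin.succ_injective _ e), fun i₁ j₁ h1 h2 => ?_⟩
        rwa [← Fin.succ_injective _ h1, ← Fin.succ_injective _ h2]
  rw [← SimpleGraph.card_neighborFinset_eq_degree, this, Finset.card_insert_of_notMem (by
    simp [Fin.succ_ne_zero]), Finset.card_image_of_injective _ (Fin.succ_injective _),
    SimpleGraph.card_neighborFinset_eq_degree]

theorem isGraphicSeq_starSeq {m d : ℕ} (hd : d < m) (H : SimpleGraph (Fin m))
    (hH : ∀ i, H.degree i = d) : IsGraphicSeq (starSeq (m + 1) (d + 3)) := by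
  refine ⟨?_, cone H, ?_⟩
  · intro i j hij
    have := Fin.le_def.1 hij
    simp only [starSeq]
    split_ifs <;> omega
  · intro i
    rcases Fin.eq_zero_or_eq_succ i with rfl | ⟨i, rfl⟩
    · simpa [starSeq] using degree_cone_zero H
    · simpa [starSeq, hH] using degree_cone_succ H i

theorem sum_starSeq {m d : ℕ} : ∑ i, starSeq (m + 1) (d + 3) i = (d + 2) * m := by
  simp [Fin.sum_univ_succ, starSeq]
  ring

theorem starSeq_sharp {m d : ℕ} (hd : d < m) (H : SimpleGraph (Fin m))
    (hH : ∀ i, H.degree i = d) : IsGraphicSeq (starSeq (m + 1) (d + 3)) ∧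
      ∑ i, starSeq (m + 1) (d + 3) i = (d + 3 - 1) * (m + 1 - 1) ∧
      ¬ HasTwoTreeRealization (d + 3) (starSeq (m + 1) (d + 3)) := by
  refine ⟨isGraphicSeq_starSeq hd H hH, sum_starSeq, not_hasTwoTreeRealization (by omega) ?_⟩
  intro i j hi hj
  simp only [starSeq] at hi hj
  split_ifs at hi hj with h1 h2
  · exact Fin.ext (by omega)
  all_goals omega

/-- The circulant graph with connection set `S`. -/
def circulant {A : Type*} [AddCommGroup A] (S : Finset A) (h0 : 0 ∉ S) (hneg : ∀ a ∈ S, -a ∈ S) :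
    SimpleGraph A where
  Adj u v := v - u ∈ S
  symm.symm u v h := by simpa using hneg _ h
  loopless.irrefl _ h := h0 (by simpa using h)

theorem degree_circulant {A : Type*} [AddCommGroup A] [Fintype A] (S : Finset A) (h0 : 0 ∉ S)
    (hneg : ∀ a ∈ S, -a ∈ S) (u : A) : (circulant S h0 hneg).degree u = S.card := by
  have : (circulant S h0 hneg).neighborFinset u = S.image fun a => u + a := by
    ext v
    rw [SimpleGraph.mem_neighborFinset, Finset.mem_image]
    constructor
    · exact fun h => ⟨v - u, h, by simp⟩
    · rintro ⟨a, ha, rfl⟩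
      simpa [circulant] using ha
  rw [← SimpleGraph.card_neighborFinset_eq_degree, this,
    Finset.card_image_of_injective _ (add_right_injective u)]

/-- The pairs `{2 i, 2 i + 1}`. -/
def pairing (m : ℕ) : SimpleGraph (Fin m) where
  Adj i j := i ≠ j ∧ i.val / 2 = j.val / 2
  symm.symm _ _ h := ⟨h.1.symm, h.2.symm⟩
  loopless.irrefl _ h := h.1 rfl

theorem degree_pairing {m : ℕ} (i : Fin m) :
    (pairing m).degree i = if i.val + 1 = m ∧ i.val % 2 = 0 then 0 else 1 := by
  rw [← SimpleGraph.card_neighborFinset_eq_degree]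
  have hmem : ∀ j, j ∈ (pairing m).neighborFinset i ↔ i.val ≠ j.val ∧ i.val / 2 = j.val / 2 := by
    intro j
    rw [SimpleGraph.mem_neighborFinset, ne_eq, Fin.val_inj]
    exact Iff.rfl
  split_ifs with h
  · rw [Finset.card_eq_zero, Finset.eq_empty_iff_forall_notMem]
    intro j hj
    rw [hmem] at hj
    omega
  · rw [Finset.card_eq_one]
    refine ⟨⟨if i.val % 2 = 0 then i.val + 1 else i.val - 1, by split_ifs <;> omega⟩, ?_⟩
    ext j
    rw [hmem, Finset.mem_singleton, Fin.ext_iff]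
    simp only
    split_ifs <;> omega

theorem exists_regular_two (m : ℕ) : ∃ H : SimpleGraph (Fin (m + 3)), ∀ i, H.degree i = 2 := by
  have hn : ∀ a : Fin (m + 3), 0 < a.val → (-a).val = m + 3 - a.val := fun a ha => by
    rw [Fin.val_neg', Nat.mod_eq_of_lt (by omega)]
  refine ⟨circulant {⟨1, by omega⟩, ⟨m + 2, by omega⟩} ?_ ?_, fun i => ?_⟩
  · simp [Fin.ext_iff]
  · intro a ha
    simp only [Finset.mem_insert, Finset.mem_singleton, Fin.ext_iff] at ha ⊢
    rw [hn a (by omega)]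
    omega
  · rw [degree_circulant, Finset.card_pair (by simp)]

theorem exists_regular_four (m : ℕ) : ∃ H : SimpleGraph (Fin (m + 5)), ∀ i, H.degree i = 4 := by
  have hn : ∀ a : Fin (m + 5), 0 < a.val → (-a).val = m + 5 - a.val := fun a ha => by
    rw [Fin.val_neg', Nat.mod_eq_of_lt (by omega)]
  refine ⟨circulant {⟨1, by omega⟩, ⟨2, by omega⟩, ⟨m + 3, by omega⟩, ⟨m + 4, by omega⟩} ?_ ?_,
    fun i => ?_⟩
  · simp [Fin.ext_iff]
  · intro a ha
    simp only [Finset.mem_insert, Finset.mem_singleton, Fin.ext_iff] at ha ⊢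
    rw [hn a (by omega)]
    omega
  · rw [degree_circulant, Finset.card_insert_of_notMem (by simp),
      Finset.card_insert_of_notMem (by simp), Finset.card_pair (by simp)]

/-- For odd m the pairing leaves the last vertex isolated, so its cone has one vertex of degree m, m
- 1 of degree 2 and a last one of degree 1. -/
theorem exists_sharp_four {m : ℕ} (hm : 2 ≤ m) (hodd : Odd m) :
    ∃ π : Fin (m + 1) → ℕ, IsGraphicSeq π ∧ ∑ i, π i = 3 * m - 1 ∧
      ¬ HasTwoTreeRealization 4 π := by
  have hdeg : ∀ i : Fin m, (pairing m).degree i = if i.val + 1 = m then 0 else 1 := by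
    intro i
    rw [degree_pairing]
    rw [Nat.odd_iff] at hodd
    congr 1
    rw [eq_iff_iff]
    omega
  set π : Fin (m + 1) → ℕ := fun i => if i.val = 0 then m else if i.val = m then 1 else 2 with hπ
  refine ⟨π, ⟨?_, cone (pairing m), ?_⟩, ?_, not_hasTwoTreeRealization (by omega) ?_⟩
  · intro i j hij
    have := Fin.le_def.1 hij
    have hj := j.isLt
    simp only [hπ]
    split_ifs <;> omega
  · intro i
    rcases Fin.eq_zero_or_eq_succ i with rfl | ⟨i, rfl⟩
    · simpa [hπ] using degree_cone_zero (pairing m)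
    · have := degree_cone_succ (pairing m) i
      rw [hdeg] at this
      rw [this]
      by_cases h : i.val + 1 = m <;> simp [hπ, h]
  · obtain ⟨m, rfl⟩ := Nat.exists_eq_add_of_le' (by omega : 1 ≤ m)
    rw [Fin.sum_univ_succ, Fin.sum_univ_castSucc]
    have h1 : ∀ i : Fin m, π i.castSucc.succ = 2 := by
      intro i
      have := i.isLt
      simp only [hπ, Fin.val_succ, Fin.val_castSucc]
      rw [if_neg (by omega), if_neg (by omega)]
    have h2 : π (Fin.last m).succ = 1 := by simp [hπ]
    have h3 : π 0 = m + 1 := by simp [hπ]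
    rw [Finset.sum_congr rfl fun i _ => h1 i, h2, h3]
    simp only [Finset.sum_const, Finset.card_univ, Fintype.card_fin, smul_eq_mul]
    omega
  · intro i j hi hj
    simp only [hπ] at hi hj
    split_ifs at hi hj <;> omega

end Sharpness

/-! ### Assembly of the theorem -/

section Main

open scoped Classical

theorem hasTwoTreeRealization_of_sum {k n : ℕ}
    (hkn : (k = 3 ∧ 6 ≤ n) ∨ (k = 4 ∧ 7 ≤ n) ∨ (k = 5 ∧ 24 ≤ n) ∨ (k = 7 ∧ 93 ≤ n))
    {π : Fin n → ℕ} (hπ : IsGraphicSeq π) (hsum : (k - 1) * (n - 1) < ∑ i, π i) :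
    HasTwoTreeRealization k π := by
  obtain ⟨hanti, G₀, hG₀⟩ := hπ
  have hd : Antitone fun i => G₀.degree i := by
    intro i j hij
    simp only [hG₀ i, hG₀ j]
    exact hanti hij
  have he : ∑ i, π i = 2 * G₀.edgeFinset.card := by
    rw [← G₀.sum_degrees_eq_twice_card_edges]
    exact Finset.sum_congr rfl fun i _ => (hG₀ i).symm
  rw [he] at hsum
  have hreal : ∀ G, SameDegrees G₀ G → IsRealization π G := fun G hG i => (hG i).trans (hG₀ i)
  -- With e edges, 2e > (k - 1)(n - 1) reads e ≥ n, 2e ≥ 3n - 2, e ≥ 2n - 1 and e ≥ 3n - 2 in the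
  -- four cases; integrality supplies the last unit.
  rcases hkn with ⟨rfl, hn⟩ | ⟨rfl, hn⟩ | ⟨rfl, hn⟩ | ⟨rfl, hn⟩
  · obtain ⟨G, hG, h⟩ := exists_target_three hn hd (by omega)
    exact ⟨G, hreal G hG, fun T _ => isContained_of_not_cliqueFree h T⟩
  · obtain ⟨G, hG, h⟩ := exists_target_four hn hd (by omega)
    exact ⟨G, hreal G hG, fun T hT => hT.isContained_of_hasEaredClique le_rfl h⟩
  · obtain ⟨G, hG, h⟩ := exists_target_five hn hd (by omega)
    exact ⟨G, hreal G hG, fun T hT => hT.isContained_of_hasEaredClique (by omega) h⟩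
  · obtain ⟨G, hG, h⟩ := exists_target_seven hn hd (by omega)
    refine ⟨G, hreal G hG, fun T hT => ?_⟩
    rcases h with h | h
    · exact hT.isContained_of_hasEaredClique (by omega) h
    · exact hT.isContained_of_hasTwoEdgeJoin h

end Main

theorem theorem1p4 (k n : ℕ)
    (hkn : (k = 3 ∧ 6 ≤ n) ∨ (k = 4 ∧ 7 ≤ n) ∨ (k = 5 ∧ 24 ≤ n) ∨ (k = 7 ∧ 93 ≤ n)) :
    -- the sufficient condition
    (∀ π : Fin n → ℕ, IsGraphicSeq π → (k - 1) * (n - 1) < ∑ i, π i →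
      HasTwoTreeRealization k π) ∧
    -- sharpness
    (¬ (k = 4 ∧ Even n) →
      IsGraphicSeq (starSeq n k) ∧ ∑ i, starSeq n k i = (k - 1) * (n - 1) ∧
        ¬ HasTwoTreeRealization k (starSeq n k)) ∧
    -- sharpness when `(k - 1) * (n - 1)` is odd, so that no graphic sequence has this sum
    (k = 4 ∧ Even n →
      ∃ π : Fin n → ℕ, IsGraphicSeq π ∧ ∑ i, π i = (k - 1) * (n - 1) - 1 ∧
        ¬ HasTwoTreeRealization k π) := by
  refine ⟨fun π => hasTwoTreeRealization_of_sum hkn, fun hpar => ?_, ?_⟩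
  · rcases hkn with ⟨rfl, hn⟩ | ⟨rfl, hn⟩ | ⟨rfl, hn⟩ | ⟨rfl, hn⟩
    · obtain ⟨m, rfl⟩ := Nat.exists_eq_add_of_le' hn
      exact starSeq_sharp (d := 0) (by omega) (⊥ : SimpleGraph (Fin (m + 5))) (by simp)
    · obtain ⟨m, rfl⟩ := Nat.exists_eq_add_of_le' hn
      -- Here n is odd, so the number n - 1 of paired vertices is even and none is left over.
      refine starSeq_sharp (d := 1) (by omega) (pairing (m + 6)) fun i => ?_
      rw [degree_pairing, if_neg]
      rw [Nat.even_iff] at hpar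
      omega
    · obtain ⟨m, rfl⟩ := Nat.exists_eq_add_of_le' hn
      obtain ⟨H, hH⟩ := exists_regular_two (m + 20)
      exact starSeq_sharp (d := 2) (by omega) H hH
    · obtain ⟨m, rfl⟩ := Nat.exists_eq_add_of_le' hn
      obtain ⟨H, hH⟩ := exists_regular_four (m + 87)
      exact starSeq_sharp (d := 4) (by omega) H hH
  · rintro ⟨rfl, hev⟩
    obtain ⟨m, rfl⟩ := Nat.exists_eq_add_of_le' (by omega : 1 ≤ n)
    refine exists_sharp_four (by omega) ?_
    rw [Nat.even_iff] at hev
    rw [Nat.odd_iff]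
    omega
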